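/- Let $1\le d\le 3$. For $L>0$ let $\Lambda_L=[-L/2,L/2)^d$, $|\Lambda_L|=L^d$, $\Lambda_L^*=(L^{-1}\mathbb Z)^d$, and for $p\in\Lambda_L^*$ let $\varphi_p(x)=|\Lambda_L|^{-1/2}e^{2\pi i p\cdot x}$, an orthonormal basis of $L^2(\Lambda_L)$. Write $\int_{|q|\le\kappa,*}g(q)\,dq=|\Lambda_L|^{-1}\sum_{q\in\Lambda_L^*,|q|\le\kappa}g(q)$ and $M_\kappa=\sup_{L\ge1}|\Lambda_L|^{-1}\,\#\{q\in\Lambda_L^*:|q|\le\kappa\}$. Let $D_L$ be the periodic kinetic energy, i.e. the self-adjoint operator on $L^2(\Lambda_L)$ that multiplies the $p$-th Fourier coefficient by $\nu(p)=p^2/2$ (on its maximal domain), and $R_L(z)=(D_L-z)^{-1}$. Let $B$ be a real-valued Schwartz function on $\mathbb R^d$ that either has compact support or is invariant under all reflections $x_j\mapsto-x_j$ of the coordinates, and let $B_\#$ be the $L$-periodic extension of $B|_{\Lambda_L}$. Let $M$ be a Poisson variable with mean $|\Lambda_L|$, let $y_1,y_2,\dots$ be i.i.d. uniform on $\Lambda_L$,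 and let $v_1,v_2,\dots$ be i.i.d. real weights, all independent, with joint expectation $\mathbf E_L$. Put $V_L(x)=\sum_{\gamma=1}^M v_\gamma B_\#(x-y_\gamma)$ and $H_\lambda=H_{\lambda,L}=D_L+\lambda V_L$. Assume (Hypothesis H4) that there is a constant $C$ with $\mathbf E|v_\gamma|^n\le C$ for all $n\in\mathbb N$, and that the weights are positive almost surely. Let $\chi:\mathbb R\to[0,1]$ be smooth with $\chi=1$ on $[-1,1]$ and $\chi(t)=0$ for $|t|\ge2$, and let $\chi_a(t)=\chi(at)$, $\hat g(\alpha)=\int_{\mathbb R} g(t)e^{-2\pi i\alpha t}dt$. For $\psi_1,\psi_2\in L^2(\Lambda_L)$, $n\in\mathbb N_0$, $E\in\mathbb R$, $\eta,\delta>0$ and $z\in\mathbb C\setminus[0,\infty)$ define $$T_{n,L}[z;\psi_1,\psi_2]=\mathbf E_L\langle\psi_1,R_L(z)[V_LR_L(z)]^n\psi_2\rangle,$$ $$S_{n,L}[E+i\eta;\chi;\psi_1,\psi_2;\delta]=(-1)^n\int_{\mathbb R}\widehat{\chi}_{a(\eta,\delta)}(\alpha)\,T_{n,L}[E+i\eta+2\pi\alpha;\psi_1,\psi_2]\,d\alpha,\qquad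 a(\eta,\delta)=\frac{\eta}{|\ln(\eta\delta/2)|+1}.$$ Let $f_{E,\eta}(x)=\dfrac{\eta}{(x-E)^2+\eta^2}$. Then for all $\eta>0$, $\epsilon>0$, $\lambda_0>0$ and $E_0>0$ there exist $N\in\mathbb N_0$ and $\kappa>0$ such that for all $\lambda\in[0,\lambda_0]$, all $E\in[-E_0,E_0]$ and all $L\ge1$: the operator $f_{E,\eta}(H_\lambda)$ is almost surely trace class on $L^2(\Lambda_L)$, its trace is integrable with respect to $\mathbf E_L$, and $$\left|\frac1{|\Lambda_L|}\mathbf E_L\,\mathrm{Tr}_L f_{E,\eta}(H_\lambda)-\sum_{n=0}^N\int_{|q|\le\kappa,*}\lambda^n\,\mathrm{Im}\,S_{n,L}\Big[E+i\eta;\chi;\varphi_q,\varphi_q;\frac{\epsilon}{2M_\kappa}\Big]dq\right|\le\epsilon .$$ -/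

import Mathlib

open MeasureTheory Complex
open scoped FourierTransform SchwartzMap ENNReal

noncomputable section

namespace PoissonDOS

/-! ### The box, its dual lattice, and the plane waves -/

/-- The position (and momentum) space `ℝ^d` with the Euclidean norm. -/
abbrev Space (d : ℕ) : Type := EuclideanSpace ℝ (Fin d)

/-- The box `Λ_L = [-L/2, L/2)^d`. -/
def box (d : ℕ) (L : ℝ) : Set (Space d) := {x | ∀ j, x j ∈ Set.Ico (-(L / 2)) (L / 2)}

/-- Lebesgue measure on `Λ_L`. -/
abbrev boxMeasure (d : ℕ) (L : ℝ) : Measure (Space d) := volume.restrict (box d L)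

/-- The Hilbert space `L²(Λ_L)`. -/
abbrev L2Box (d : ℕ) (L : ℝ) : Type := Lp ℂ 2 (boxMeasure d L)

/-- The point `m / L` of the dual lattice `Λ_L^* = (L⁻¹ ℤ)^d`, which is indexed by `m ∈ ℤ^d`. -/
def dualPt {d : ℕ} (L : ℝ) (m : Fin d → ℤ) : Space d := WithLp.toLp 2 fun j => (m j : ℝ) / L

/-- The normalized sum `|Λ_L|⁻¹ ∑_{p ∈ Λ_L^*, |p| ≤ κ} g(p)` over the (finitely many) dual lattice
points of norm at most `κ`; here `|Λ_L| = L^d`. -/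
def dualInt {d : ℕ} (L κ : ℝ) (g : (Fin d → ℤ) → ℝ) : ℝ :=
  (L ^ d)⁻¹ * ∑' m : {m : Fin d → ℤ // ‖dualPt L m‖ ≤ κ}, g m

/-- `M_κ = sup_{L ≥ 1} |Λ_L|⁻¹ #{p ∈ Λ_L^* : |p| ≤ κ}`. -/
def modeBound (d : ℕ) (κ : ℝ) : ℝ :=
  sSup {x | ∃ L : ℝ, 1 ≤ L ∧ x = dualInt (d := d) L κ fun _ => 1}

/-- The function `φ_p(x) = |Λ_L|^{-1/2} e^{2π i p·x}` for `p = m / L`. -/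
def planeWaveFun {d : ℕ} (L : ℝ) (m : Fin d → ℤ) (x : Space d) : ℂ :=
  ((Real.sqrt (L ^ d))⁻¹ : ℝ) * exp (2 * Real.pi * I * (inner ℝ (dualPt L m) x : ℝ))

lemma box_eq (d : ℕ) (L : ℝ) : box d L = (MeasurableEquiv.toLp 2 (Fin d → ℝ)).symm ⁻¹'
    (Set.univ.pi fun _ => Set.Ico (-(L / 2)) (L / 2)) := by
  ext x
  simp [box, Set.mem_pi]

lemma volume_box_lt_top (d : ℕ) (L : ℝ) : volume (box d L) < ⊤ := by
  rw [box_eq, (EuclideanSpace.volume_preserving_symm_measurableEquiv_toLp (Fin d)).measure_preimage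
    (MeasurableSet.univ_pi fun _ => measurableSet_Ico).nullMeasurableSet, Real.volume_pi_Ico]
  exact ENNReal.prod_lt_top fun _ _ => ENNReal.ofReal_lt_top

instance instFiniteBox (d : ℕ) (L : ℝ) : IsFiniteMeasure (boxMeasure d L) :=
  isFiniteMeasure_restrict.2 (volume_box_lt_top d L).ne

lemma memLp_planeWaveFun {d : ℕ} (L : ℝ) (m : Fin d → ℤ) :
    MemLp (planeWaveFun L m) 2 (boxMeasure d L) := by
  refine MemLp.of_bound (C := |(Real.sqrt (L ^ d))⁻¹|)
    (Continuous.aestronglyMeasurable ?_) (Filter.Eventually.of_forall fun x => ?_)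
  · unfold planeWaveFun
    fun_prop
  · unfold planeWaveFun
    rw [norm_mul, Complex.norm_real, Real.norm_eq_abs, Complex.norm_exp]
    simp

/-- The plane wave `φ_p`, `p = m / L`, as an element of `L²(Λ_L)`. -/
def planeWave {d : ℕ} (L : ℝ) (m : Fin d → ℤ) : L2Box d L := (memLp_planeWaveFun L m).toLp

lemma integral_exp_box (L : ℝ) (hL : 0 < L) (k : ℤ) :
    ∫ t in Set.Ico (-(L / 2)) (L / 2), exp (2 * Real.pi * I * ((k : ℝ) / L * t : ℝ))
      = if k = 0 then (L : ℂ) else 0 := by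
  rw [integral_Ico_eq_integral_Ioc, ← intervalIntegral.integral_of_le (by linarith)]
  have hL' : (L : ℂ) ≠ 0 := by exact_mod_cast hL.ne'
  split_ifs with hk
  · subst hk
    simp
  · have hk' : (k : ℂ) ≠ 0 := by exact_mod_cast hk
    have hc : (2 * Real.pi * I * k / L : ℂ) ≠ 0 := by
      have := Complex.two_pi_I_ne_zero
      exact div_ne_zero (mul_ne_zero this hk') hL'
    have h1 : ∀ t : ℝ, exp (2 * Real.pi * I * ((k : ℝ) / L * t : ℝ))
        = exp ((2 * Real.pi * I * k / L : ℂ) * t) := by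
      intro t
      congr 1
      push_cast
      ring
    simp_rw [h1]
    rw [integral_exp_mul_complex hc]
    have h2 : exp ((2 * Real.pi * I * k / L : ℂ) * ((L / 2 : ℝ) : ℂ))
        = exp ((2 * Real.pi * I * k / L : ℂ) * ((-(L / 2) : ℝ) : ℂ)) := by
      rw [Complex.exp_eq_exp_iff_exists_int]
      refine ⟨k, ?_⟩
      push_cast
      field_simp
      ring
    rw [h2, sub_self, zero_div]

lemma orthonormal_planeWave {d : ℕ} {L : ℝ} (hL : 0 < L) :
    Orthonormal ℂ (planeWave (d := d) L) := by
  rw [orthonormal_iff_ite]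
  intro m n
  have h0 : inner ℂ (planeWave L m) (planeWave (d := d) L n)
      = ∫ x in box d L, (((L ^ d)⁻¹ : ℝ) : ℂ) *
          ∏ j, exp (2 * Real.pi * I * (((n j - m j : ℤ) : ℝ) / L * x j : ℝ)) := by
    rw [L2.inner_def]
    refine integral_congr_ae ?_
    filter_upwards [(memLp_planeWaveFun L m).coeFn_toLp, (memLp_planeWaveFun L n).coeFn_toLp]
      with x hm hn
    rw [planeWave, planeWave, hm, hn, RCLike.inner_apply, planeWaveFun, planeWaveFun, map_mul,
      Complex.conj_ofReal, ← Complex.exp_conj]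
    have hs : (((L ^ d)⁻¹ : ℝ) : ℂ)
        = (((Real.sqrt (L ^ d))⁻¹ : ℝ) : ℂ) * (((Real.sqrt (L ^ d))⁻¹ : ℝ) : ℂ) := by
      rw [← Complex.ofReal_mul, ← mul_inv, Real.mul_self_sqrt (by positivity)]
    rw [hs, mul_mul_mul_comm, ← Complex.exp_add, ← Complex.exp_sum]
    congr 2
    simp only [map_mul, Complex.conj_ofReal, Complex.conj_I, PiLp.inner_apply, dualPt,
      map_ofNat, RCLike.inner_apply, conj_trivial]
    push_cast
    rw [Finset.mul_sum, Finset.mul_sum, ← Finset.sum_add_distrib]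
    refine Finset.sum_congr rfl fun j _ => ?_
    ring
  rw [h0, integral_const_mul, box_eq]
  have h1 := (EuclideanSpace.volume_preserving_symm_measurableEquiv_toLp
    (Fin d)).setIntegral_preimage_emb (MeasurableEquiv.measurableEmbedding _)
    (fun y : Fin d → ℝ => ∏ j, exp (2 * Real.pi * I * (((n j - m j : ℤ) : ℝ) / L * y j : ℝ)))
    (Set.univ.pi fun _ => Set.Ico (-(L / 2)) (L / 2))
  have h2 : ∀ x : Space d, (∏ j, exp (2 * Real.pi * I * (((n j - m j : ℤ) : ℝ) / L * x j : ℝ)))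
      = (fun y : Fin d → ℝ => ∏ j, exp (2 * Real.pi * I * (((n j - m j : ℤ) : ℝ) / L * y j : ℝ)))
        ((MeasurableEquiv.toLp 2 (Fin d → ℝ)).symm x) := fun x => rfl
  simp_rw [h2]
  rw [h1, volume_pi, Measure.restrict_pi_pi,
    integral_fintype_prod_eq_prod
      (f := fun j (t : ℝ) => exp (2 * Real.pi * I * (((n j - m j : ℤ) : ℝ) / L * t : ℝ)))]
  simp_rw [integral_exp_box L hL]
  split_ifs with hmn
  · subst hmn
    simp [hL.ne']
  · obtain ⟨j, hj⟩ := Function.ne_iff.1 hmn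
    rw [Finset.prod_eq_zero (Finset.mem_univ j), mul_zero]
    rw [if_neg]
    exact sub_ne_zero.2 (Ne.symm hj)

/-- Square-summable coefficients give a convergent Fourier series in `L²(Λ_L)`. -/
lemma summable_planeWave {d : ℕ} (L : ℝ) {c : (Fin d → ℤ) → ℂ} (hc : Memℓp c 2) :
    Summable fun m => c m • planeWave L m := by
  by_cases hL : 0 < L
  · have h := (orthonormal_planeWave (d := d) hL).orthogonalFamily.summable_iff_norm_sq_summable c
    simp only [LinearIsometry.toSpanSingleton_apply] at h
    rw [h]
    have h3 := (memℓp_gen_iff (by norm_num)).1 hc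
    simpa using h3
  · rcases Nat.eq_zero_or_pos d with hd | hd
    · subst hd
      exact Summable.of_finite
    · have hb : box d L = ∅ := by
        ext x
        simp only [box, Set.mem_ofPred_eq, Set.mem_empty_iff_false, iff_false]
        intro h
        have := h ⟨0, hd⟩
        have h1 := this.1
        have h2 := this.2
        linarith
      have hz : ∀ f : L2Box d L, f = 0 := by
        intro f
        rw [Lp.eq_zero_iff_ae_eq_zero]
        have h0 : ae (boxMeasure d L) ≤ ⊥ := by simp [boxMeasure, hb]
        exact Filter.eventually_bot.filter_mono h0
      have : (fun m => c m • planeWave (d := d) L m) = fun _ => 0 := funext fun m => hz _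
      rw [this]
      exact summable_zero

/-! ### The Hamiltonian -/

/-- The energy function `ν(p) = p² / 2`. -/
def energy {d : ℕ} (p : Space d) : ℝ := ‖p‖ ^ 2 / 2

/-- The coefficients `ν(p) ⟨φ_p, f⟩`, i.e. `|Λ_L|^{-1/2} ν(p) f̂(p)`, for `p = m / L`. -/
def kineticCoeff {d : ℕ} (L : ℝ) (f : L2Box d L) (m : Fin d → ℤ) : ℂ :=
  (energy (dualPt L m) : ℂ) * inner ℂ (planeWave L m) f

lemma kineticCoeff_add {d : ℕ} (L : ℝ) (f g : L2Box d L) :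
    kineticCoeff L (f + g) = kineticCoeff L f + kineticCoeff L g := by
  funext m
  simp [kineticCoeff, inner_add_right, mul_add]

lemma kineticCoeff_smul {d : ℕ} (L : ℝ) (c : ℂ) (f : L2Box d L) :
    kineticCoeff L (c • f) = c • kineticCoeff L f := by
  funext m
  simp [kineticCoeff, inner_smul_right, mul_left_comm]

/-- The periodic kinetic energy `D_L = -(ħ²/2m) Δ_L = -[2(2π)²]⁻¹ Δ_L` on
`{f ∈ L²(Λ_L) : ν f̂ ∈ ℓ²(Λ_L^*)}`, which multiplies the Fourier coefficients by `ν`. -/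
def kinetic (d : ℕ) (L : ℝ) : L2Box d L →ₗ.[ℂ] L2Box d L where
  domain :=
    { carrier := {f | Memℓp (kineticCoeff L f) 2}
      add_mem' := fun {f g} hf hg => by
        simp only [Set.mem_ofPred_eq] at *
        rw [kineticCoeff_add]
        exact hf.add hg
      zero_mem' := by
        have : kineticCoeff L (0 : L2Box d L) = 0 := by
          funext m
          simp [kineticCoeff]
        simp only [Set.mem_ofPred_eq]
        rw [this]
        exact zero_memℓp
      smul_mem' := fun c f hf => by
        simp only [Set.mem_ofPred_eq] at *
        rw [kineticCoeff_smul]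
        exact hf.const_smul c }
  toFun :=
    { toFun := fun f => ∑' m, kineticCoeff L (f : L2Box d L) m • planeWave L m
      map_add' := fun f g => by
        rw [← (summable_planeWave L f.2).tsum_add (summable_planeWave L g.2)]
        simp [kineticCoeff_add, add_smul]
      map_smul' := fun c f => by
        rw [RingHom.id_apply, ← (summable_planeWave L f.2).tsum_const_smul c]
        simp [kineticCoeff_smul, mul_smul] }

/-- The representative of `x` modulo `(L ℤ)^d` in the box `Λ_L`. -/
def wrap {d : ℕ} (L : ℝ) (x : Space d) : Space d :=
  WithLp.toLp 2 fun j => x j - L * (⌊x j / L + 1 / 2⌋ : ℤ)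

/-- The `L`-periodic extension `h_#` of the restriction of `h` to `Λ_L`. -/
def periodize {d : ℕ} (L : ℝ) (h : Space d → ℝ) (x : Space d) : ℝ := h (wrap L x)

/-- A realization of the randomness: the number `M` of impurities, their positions
`y_1, …, y_M` and their weights `v_1, …, v_M`. -/
abbrev Config (d : ℕ) : Type := Σ M : ℕ, (Fin M → Space d) × (Fin M → ℝ)

/-- The random potential `V_{L,ω}(x) = ∑_{γ=1}^M v_γ B_#(x - y_γ)`. -/
def potential {d : ℕ} (L : ℝ) (B : 𝓢(Space d, ℝ)) (ω : Config d) (x : Space d) : ℝ :=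
  ∑ γ, ω.2.2 γ * periodize L B (x - ω.2.1 γ)

lemma measurable_wrap {d : ℕ} (L : ℝ) : Measurable (wrap (d := d) L) := by
  unfold wrap
  refine (MeasurableEquiv.toLp 2 (Fin d → ℝ)).measurable.comp ?_
  refine measurable_pi_lambda _ fun j => ?_
  have hj : Measurable fun x : Space d => x j := by fun_prop
  have hf : Measurable fun x : Space d => ((⌊x j / L + 1 / 2⌋ : ℤ) : ℝ) :=
    measurable_from_top.comp (Int.measurable_floor.comp ((hj.div_const L).add_const _))
  exact hj.sub (hf.const_mul L)

lemma memLp_potential {d : ℕ} (L : ℝ) (B : 𝓢(Space d, ℝ)) (ω : Config d) :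
    MemLp (fun x => (potential L B ω x : ℂ)) ⊤ (boxMeasure d L) := by
  obtain ⟨C, hC⟩ : ∃ C, ∀ x, ‖B x‖ ≤ C := ⟨_, fun x => B.norm_le_seminorm ℝ x⟩
  refine memLp_top_of_bound (C := ∑ γ, ‖ω.2.2 γ‖ * C) ?_ (Filter.Eventually.of_forall fun x => ?_)
  · refine Measurable.aestronglyMeasurable ?_
    refine Complex.measurable_ofReal.comp ?_
    unfold potential periodize
    refine Finset.measurable_fun_sum _ fun γ _ => Measurable.const_mul ?_ _
    exact B.continuous.measurable.comp ((measurable_wrap L).comp (measurable_id.sub_const _))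
  · rw [Complex.norm_real]
    unfold potential
    refine (norm_sum_le _ _).trans (Finset.sum_le_sum fun γ _ => ?_)
    rw [norm_mul]
    exact mul_le_mul_of_nonneg_left (hC _) (norm_nonneg _)

/-- The bounded operator of multiplication by `V_{L,ω}` on `L²(Λ_L)`. -/
def potentialOp {d : ℕ} (L : ℝ) (B : 𝓢(Space d, ℝ)) (ω : Config d) :
    L2Box d L →L[ℂ] L2Box d L :=
  (ContinuousLinearMap.mul ℂ ℂ).holderL (boxMeasure d L) ⊤ 2 2 (memLp_potential L B ω).toLp

/-- The random Schrödinger operator `H_{λ,L} = D_L + λ V_{L,ω}` on the domain of `D_L`. -/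
def hamiltonian {d : ℕ} (L : ℝ) (B : 𝓢(Space d, ℝ)) (lam : ℝ) (ω : Config d) :
    L2Box d L →ₗ.[ℂ] L2Box d L where
  domain := (kinetic d L).domain
  toFun := (kinetic d L).toFun +
    ((lam : ℂ) • potentialOp L B ω).toLinearMap.domRestrict (kinetic d L).domain

/-! ### Resolvents, the function `f_{E,η}(H)`, and the trace -/

/-- `R` is the bounded two-sided inverse `(A - z)⁻¹` of `A - z : dom A → X`. -/
def IsResolventAt {X : Type*} [NormedAddCommGroup X] [NormedSpace ℂ X]
    (A : X →ₗ.[ℂ] X) (z : ℂ) (R : X →L[ℂ] X) : Prop :=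
  (∀ f, ∃ h : R f ∈ A.domain, A ⟨R f, h⟩ - z • R f = f) ∧
    ∀ f : A.domain, R (A f - z • (f : X)) = f

open Classical in
/-- The resolvent `(A - z)⁻¹` (and `0` if `A - z` has no bounded inverse). -/
def resolventOp {X : Type*} [NormedAddCommGroup X] [NormedSpace ℂ X]
    (A : X →ₗ.[ℂ] X) (z : ℂ) : X →L[ℂ] X :=
  if h : ∃ R, IsResolventAt A z R then h.choose else 0

/-- `f_{E,η}(A)` for a self-adjoint `A` and `f_{E,η}(x) = η / ((x - E)² + η²)`, that is
`η [(A - E)² + η²]⁻¹ = η (A - (E + iη))⁻¹ (A - (E - iη))⁻¹`. -/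
def lorentzian {X : Type*} [NormedAddCommGroup X] [NormedSpace ℂ X]
    (A : X →ₗ.[ℂ] X) (E η : ℝ) : X →L[ℂ] X :=
  (η : ℂ) • (resolventOp A (E + η * I) ∘L resolventOp A (E - η * I))

/-- The diagonal matrix elements `⟨φ_p, A φ_p⟩` in the orthonormal basis of plane waves. For a
positive operator `A`, being trace class means that they are summable. -/
def diagElt {d : ℕ} {L : ℝ} (A : L2Box d L →L[ℂ] L2Box d L) (m : Fin d → ℤ) : ℂ :=
  inner ℂ (planeWave L m) (A (planeWave L m))

/-- The trace on `L²(Λ_L)`. -/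
def traceL {d : ℕ} {L : ℝ} (A : L2Box d L →L[ℂ] L2Box d L) : ℂ := ∑' m, diagElt A m

/-! ### The randomness and the expansion coefficients -/

/-- The joint law of `(M, y, v)`: `M` is Poisson with mean `|Λ_L| = L^d` and, given `M`, the
positions are i.i.d. uniform on `Λ_L` and the weights are i.i.d. with law `μ`, independently of each
other. Integration against it is `E_L = E_M E_y^{⊗M} E_v^{⊗M}`. -/
def configLaw (d : ℕ) (L : ℝ) (μ : Measure ℝ) : Measure (Config d) :=
  Measure.sum fun M : ℕ => (ProbabilityTheory.poissonMeasure (L ^ d).toNNReal {M}) •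
    (((Measure.pi fun _ : Fin M => ProbabilityTheory.cond volume (box d L)).prod
      (Measure.pi fun _ : Fin M => μ)).map (Sigma.mk M))

/-- Uniformly bounded absolute moments of the weights. -/
def BoundedMoments (μ : Measure ℝ) : Prop :=
  ∃ C : ℝ, ∀ n : ℕ, Integrable (fun v : ℝ => |v| ^ n) μ ∧ ∫ v, |v| ^ n ∂μ ≤ C

/-- Smooth cutoff functions: `χ : ℝ → [0,1]` smooth, `χ = 1` on `[-1,1]`, `χ(t) = 0` for `|t| ≥ 2`. -/
structure IsCutoff (χ : ℝ → ℝ) : Prop where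
  smooth : ContDiff ℝ (⊤ : ℕ∞) χ
  mem_Icc : ∀ t, χ t ∈ Set.Icc (0 : ℝ) 1
  eq_one : ∀ t, |t| ≤ 1 → χ t = 1
  eq_zero : ∀ t, 2 ≤ |t| → χ t = 0

/-- The reflection `x_j ↦ -x_j` of the `j`-th coordinate. -/
def reflect {d : ℕ} (j : Fin d) (x : Space d) : Space d :=
  WithLp.toLp 2 fun i => if i = j then -x i else x i

/-- The single-site profile is compactly supported or symmetric under all coordinate reflections. -/
def AdmissibleProfile {d : ℕ} (B : 𝓢(Space d, ℝ)) : Prop :=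
  HasCompactSupport B ∨ ∀ j x, B (reflect j x) = B x

/-- `T_{n,L}[z; ψ₁, ψ₂] = E_L ⟨ψ₁, R_L(z) [V_L R_L(z)]^n ψ₂⟩`, with `R_L(z) = (D_L - z)⁻¹`. -/
def coeffT {d : ℕ} (L : ℝ) (B : 𝓢(Space d, ℝ)) (μ : Measure ℝ) (n : ℕ) (z : ℂ)
    (ψ₁ ψ₂ : L2Box d L) : ℂ :=
  ∫ ω, inner ℂ ψ₁ ((resolventOp (kinetic d L) z *
    (potentialOp L B ω * resolventOp (kinetic d L) z) ^ n) ψ₂) ∂(configLaw d L μ)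

/-- The regularization scale `a(η, δ) = η / (|ln(ηδ/2)| + 1)`. -/
def scale (η δ : ℝ) : ℝ := η / (|Real.log (η * δ / 2)| + 1)

/-- `S_{n,L}[E + iη; χ; ψ₁, ψ₂; δ]
  = (-1)^n ∫ (χ_a)^(α) T_{n,L}[E + iη + 2πα; ψ₁, ψ₂] dα`, with `a = a(η, δ)`,
`χ_a(t) = χ(a t)` and the Fourier transform `ĝ(α) = ∫ g(t) e^{-2π i α t} dt`. -/
def coeffS {d : ℕ} (L : ℝ) (B : 𝓢(Space d, ℝ)) (μ : Measure ℝ) (χ : ℝ → ℝ) (n : ℕ) (E η δ : ℝ)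
    (ψ₁ ψ₂ : L2Box d L) : ℂ :=
  (-1) ^ n * ∫ α : ℝ, 𝓕 (fun t : ℝ => (χ (scale η δ * t) : ℂ)) α *
    coeffT L B μ n (E + η * I + 2 * Real.pi * α) ψ₁ ψ₂

end PoissonDOS

end

/-!
# The averaged density of states as a finite, volume-uniform Born series

The Lorentzian of a self-adjoint operator is the imaginary part of its resolvent at `E + iη`
(`HasRealResolvent.inner_lorentzian`), so the trace is the sum over the momenta `q` of the
diagonal elements `Im ⟨φ_q, (H - E - iη)⁻¹ φ_q⟩`. The resolvent is the time integral of the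
unitary group weighted by `e^{-ηt}`; integrating over the spectral parameter against the Fourier
transform of `χ_a` inserts the cutoff `χ(at)` into this integral, at the price of an error
`e^{-η/a} / η`, which for `a = a(η, δ)` is at most `δ / 2` (`HasRealResolvent.norm_sub_integral_le`,
`exp_neg_div_scale_le`). What remains is an expansion over a finite time, for which the averaged Born
series converges.

**Averages of the Born terms.** The `n`-th term `⟨φ, R (V R)^n φ⟩` is expanded into words in the
impurities. The operator of a single impurity at a uniform position is bounded, but on average it is
of size `x = L^{-d}`; by Cauchy-Schwarz, a factor `√x` is gained at the first and at the last
occurrence of each letter, hence `x` per distinct letter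
(`IsSparse.norm_integral_inner_wordVec_le`). Bounding the number of words by the exponential moment
of a binomial variable (`sum_pow_card_image_le`) and averaging over the Poisson number of
impurities yields, as bounded moments force `|v| ≤ 1` (`BoundedMoments.ae_abs_le_one`), a
bound `‖R‖^{n+1} K^n n! t^{-n} exp(e^t - 1)` for every `t > 0`, which does not depend on the volume
(`norm_integral_inner_power_le`).

**Gaining `1 / n!` from the cutoff.** As `χ_a` has compact support, its Fourier transform is entire
of exponential type and the terms are holomorphic in the upper half plane. The line of integration
may thus be moved up to any height `β` (`integral_laplaceFourier_mul_shift`). This costs `e^{Cβ}`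
and gains `β^{-n}` from the resolvents; height `n + 1` compensates the `n!`, and a large `t` turns
the series into a geometric one (`norm_integral_laplaceFourier_coeffT_le`). The sum of the series is
identified in a fixed volume, where the exponential moments of the number of impurities make the
remainder vanish, again by moving the line (`norm_integral_expectation_sub_sum_le`). Together, the
tail after `N` terms is small uniformly in `L` and `E` (`exists_order`).

**The momentum cutoff.** One step of the resolvent expansion bounds the diagonal element at
momentum `p` by a constant times `(1 + ‖V φ_p‖²) (1 + p²)^{-2}` (`diagReal_le`), where the average of
`‖V φ_p‖²` is bounded uniformly in the volume (`integral_norm_potentialOp_sq_le`). For `d ≤ 3` this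
decay is summable over the dual lattice, uniformly after division by the volume
(`exists_summable_modeWeight`), so that the trace exists and momenta above some `κ` contribute at most `ε / 2`
(`exists_cutoff`). Below `κ` there are at most `M_κ |Λ_L|` momenta, each with error at most `δ = ε / (2 M_κ)`.
-/

noncomputable section

namespace PoissonDOS

/-! ### Resolvents of symmetric operators with a real resolvent point -/

section Resolvent

open scoped ComplexConjugate

variable {X : Type*} [NormedAddCommGroup X]

theorem IsResolventAt.unique [NormedSpace ℂ X] {T : X →ₗ.[ℂ] X} {z : ℂ} {R S : X →L[ℂ] X}
    (hR : IsResolventAt T z R) (hS : IsResolventAt T z S) : R = S := by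
  ext f
  obtain ⟨h, hf⟩ := hS.1 f
  have := hR.2 ⟨S f, h⟩
  rwa [hf] at this

theorem IsResolventAt.resolventOp_eq [NormedSpace ℂ X] {T : X →ₗ.[ℂ] X} {z : ℂ} {R : X →L[ℂ] X}
    (hR : IsResolventAt T z R) : resolventOp T z = R := by
  have h : ∃ R, IsResolventAt T z R := ⟨R, hR⟩
  rw [resolventOp, dif_pos h]
  exact h.choose_spec.unique hR

theorem IsResolventAt.map_eq [NormedSpace ℂ X] {T : X →ₗ.[ℂ] X} {z : ℂ} {R : X →L[ℂ] X}
    (hR : IsResolventAt T z R) (f : X) : ∃ h : R f ∈ T.domain, T ⟨R f, h⟩ = f + z • R f := by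
  obtain ⟨h, hf⟩ := hR.1 f
  exact ⟨h, sub_eq_iff_eq_add.1 hf⟩

theorem IsResolventAt.apply_map [NormedSpace ℂ X] {T : X →ₗ.[ℂ] X} {z : ℂ} {R : X →L[ℂ] X}
    (hR : IsResolventAt T z R) {f : X} (hf : f ∈ T.domain) : R (T ⟨f, hf⟩) = f + z • R f := by
  have := hR.2 ⟨f, hf⟩
  rw [map_sub, map_smul] at this
  exact sub_eq_iff_eq_add.1 this

theorem isResolventAt_iff [NormedSpace ℂ X] {T : X →ₗ.[ℂ] X} {z : ℂ} {R : X →L[ℂ] X} :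
    IsResolventAt T z R ↔ (∀ f, ∃ h : R f ∈ T.domain, T ⟨R f, h⟩ = f + z • R f) ∧
      ∀ f (hf : f ∈ T.domain), R (T ⟨f, hf⟩) = f + z • R f := by
  refine ⟨fun h => ⟨h.map_eq, fun f hf => h.apply_map hf⟩, fun h => ⟨fun f => ?_, fun f => ?_⟩⟩
  · obtain ⟨hd, hf⟩ := h.1 f
    exact ⟨hd, sub_eq_iff_eq_add.2 hf⟩
  · rw [map_sub, map_smul]
    exact sub_eq_iff_eq_add.2 (h.2 f f.2)

/-- The first resolvent identity. -/
theorem IsResolventAt.sub_eq [NormedSpace ℂ X] {T : X →ₗ.[ℂ] X} {z w : ℂ} {R S : X →L[ℂ] X}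
    (hR : IsResolventAt T z R) (hS : IsResolventAt T w S) : R - S = (z - w) • (R * S) := by
  ext f
  obtain ⟨h, hf⟩ := hS.map_eq f
  have h1 := hR.apply_map h
  rw [hf, map_add, map_smul] at h1
  change R f - S f = (z - w) • R (S f)
  rw [sub_smul, eq_sub_of_add_eq h1]
  abel

/-- The operator `T + W` on the domain of `T`. -/
def pert [NormedSpace ℂ X] (T : X →ₗ.[ℂ] X) (W : X →L[ℂ] X) : X →ₗ.[ℂ] X where
  domain := T.domain
  toFun := T.toFun + W.toLinearMap.domRestrict T.domain

theorem isResolventAt_pert_iff [NormedSpace ℂ X] {T : X →ₗ.[ℂ] X} {W : X →L[ℂ] X} {z : ℂ}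
    {R : X →L[ℂ] X} : IsResolventAt (pert T W) z R ↔
      (∀ f, ∃ h : R f ∈ T.domain, T ⟨R f, h⟩ = f + z • R f - W (R f)) ∧
      ∀ f (hf : f ∈ T.domain), R (T ⟨f, hf⟩) = f + z • R f - R (W f) := by
  rw [isResolventAt_iff]
  have h1 : ∀ f (hf : f ∈ T.domain), pert T W ⟨f, hf⟩ = T ⟨f, hf⟩ + W f := fun f hf => rfl
  refine and_congr (forall_congr' fun f => exists_congr fun hf => ?_)
    (forall_congr' fun f => forall_congr' fun hf => ?_)
  · rw [eq_sub_iff_add_eq]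
    exact Eq.congr_left (h1 _ hf)
  · rw [eq_sub_iff_add_eq, ← map_add]
    exact Eq.congr_left (congrArg R (h1 _ hf))

/-- The second resolvent identity. -/
theorem IsResolventAt.pert_eq_sub [NormedSpace ℂ X] {T : X →ₗ.[ℂ] X} {W : X →L[ℂ] X} {z : ℂ}
    {R S : X →L[ℂ] X} (hR : IsResolventAt (pert T W) z R) (hS : IsResolventAt T z S) :
    R = S - R * (W * S) := by
  ext f
  obtain ⟨h, hf⟩ := hS.map_eq f
  have h1 := (isResolventAt_pert_iff.1 hR).2 _ h
  rw [hf, map_add, map_smul, add_sub_right_comm] at h1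
  exact add_right_cancel h1

/-- The second resolvent identity with the factors in the other order. -/
theorem IsResolventAt.pert_eq_sub' [NormedSpace ℂ X] {T : X →ₗ.[ℂ] X} {W : X →L[ℂ] X} {z : ℂ}
    {R S : X →L[ℂ] X} (hR : IsResolventAt (pert T W) z R) (hS : IsResolventAt T z S) :
    R = S - S * (W * R) := by
  ext f
  obtain ⟨h, hf⟩ := (isResolventAt_pert_iff.1 hR).1 f
  have h1 := hS.apply_map h
  rw [hf, map_sub, map_add, map_smul, add_sub_right_comm] at h1
  exact (add_right_cancel h1).symm

/-- The iterated second resolvent identity: the Born series with its remainder. -/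
theorem IsResolventAt.pert_eq_sum [NormedSpace ℂ X] {T : X →ₗ.[ℂ] X} {W : X →L[ℂ] X} {z : ℂ}
    {R S : X →L[ℂ] X} (hR : IsResolventAt (pert T W) z R) (hS : IsResolventAt T z S) (N : ℕ) :
    R = ∑ n ∈ Finset.range N, (-1 : ℂ) ^ n • (S * (W * S) ^ n)
      + (-1 : ℂ) ^ N • (R * (W * S) ^ N) := by
  induction N with
  | zero => simp
  | succ N ih =>
    rw [Finset.sum_range_succ]
    conv_lhs => rw [ih]
    rw [add_assoc]
    congr 1
    conv_lhs => rw [hR.pert_eq_sub hS]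
    rw [sub_mul, smul_sub, mul_assoc R (W * S), ← pow_succ', sub_eq_add_neg, pow_succ (-1 : ℂ)]
    simp

theorem units_apply_inv_apply [NormedSpace ℂ X] (u : (X →L[ℂ] X)ˣ) (f : X) :
    (u : X →L[ℂ] X) ((u⁻¹ : (X →L[ℂ] X)ˣ).1 f) = f :=
  congrArg (fun A : X →L[ℂ] X => A f) u.mul_inv

theorem units_inv_apply_apply [NormedSpace ℂ X] (u : (X →L[ℂ] X)ˣ) (f : X) :
    (u⁻¹ : (X →L[ℂ] X)ˣ).1 ((u : X →L[ℂ] X) f) = f :=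
  congrArg (fun A : X →L[ℂ] X => A f) u.inv_mul

/-- A bounded perturbation which is small relative to the resolvent keeps the resolvent point. -/
theorem IsResolventAt.exists_pert [NormedSpace ℂ X] [CompleteSpace X] {T : X →ₗ.[ℂ] X}
    {W : X →L[ℂ] X} {z : ℂ} {A : X →L[ℂ] X} (hA : IsResolventAt T z A) (h : ‖W * A‖ < 1) :
    ∃ R, IsResolventAt (pert T W) z R := by
  have hu : IsUnit (1 + W * A) := by
    have := isUnit_one_sub_of_norm_lt_one (x := -(W * A)) (by rwa [norm_neg])
    rwa [sub_neg_eq_add] at this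
  obtain ⟨u, hu⟩ := hu
  have hu' : ∀ f, (u : X →L[ℂ] X) f = f + W (A f) := fun f => by rw [hu]; rfl
  refine ⟨A * (u⁻¹ : (X →L[ℂ] X)ˣ).1, isResolventAt_pert_iff.2 ⟨fun f => ?_, fun f hf => ?_⟩⟩
  · obtain ⟨hd, hf⟩ := hA.map_eq ((u⁻¹ : (X →L[ℂ] X)ˣ).1 f)
    refine ⟨hd, hf.trans ?_⟩
    have h1 := units_apply_inv_apply u f
    rw [hu'] at h1
    change _ = f + z • A ((u⁻¹ : (X →L[ℂ] X)ˣ).1 f) - W (A ((u⁻¹ : (X →L[ℂ] X)ˣ).1 f))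
    generalize (u⁻¹ : (X →L[ℂ] X)ˣ).1 f = g at h1 ⊢
    rw [← h1]
    abel
  · have h0 := hA.apply_map hf
    have h1 : (u : X →L[ℂ] X) (T ⟨f, hf⟩ - z • f) = T ⟨f, hf⟩ - z • f + W f := by
      rw [hu', map_sub, map_smul, h0, add_sub_cancel_right]
    have h2 := congrArg (fun g => A ((u⁻¹ : (X →L[ℂ] X)ˣ).1 g)) h1
    simp only [units_inv_apply_apply, map_sub, map_add, map_smul, h0] at h2
    rw [add_sub_cancel_right] at h2
    change A ((u⁻¹ : (X →L[ℂ] X)ˣ).1 _) = f + z • A ((u⁻¹ : (X →L[ℂ] X)ˣ).1 f)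
      - A ((u⁻¹ : (X →L[ℂ] X)ˣ).1 (W f))
    nth_rewrite 2 [h2]
    abel

/-- From a real resolvent point `c` to an arbitrary `z` for which `1 - (z - c) (T - c)⁻¹` is
invertible. -/
theorem IsResolventAt.of_unit [NormedSpace ℂ X] {T : X →ₗ.[ℂ] X} {c z : ℂ} {A : X →L[ℂ] X}
    (hA : IsResolventAt T c A) (u : (X →L[ℂ] X)ˣ) (hu : (u : X →L[ℂ] X) = 1 - (z - c) • A) :
    IsResolventAt T z (A * ((u⁻¹ : (X →L[ℂ] X)ˣ) : X →L[ℂ] X)) := by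
  have hc : Commute A ((u⁻¹ : (X →L[ℂ] X)ˣ) : X →L[ℂ] X) := by
    refine Commute.units_inv_right ?_
    rw [hu]
    exact (Commute.one_right A).sub_right ((Commute.refl A).smul_right _)
  have hu' : ∀ f, (u : X →L[ℂ] X) f = f - (z - c) • A f := fun f => by rw [hu]; rfl
  refine isResolventAt_iff.2 ⟨fun f => ?_, fun f hf => ?_⟩
  · obtain ⟨hd, hf⟩ := hA.map_eq ((u⁻¹ : (X →L[ℂ] X)ˣ).1 f)
    refine ⟨hd, hf.trans ?_⟩
    have h1 := units_apply_inv_apply u f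
    rw [hu', sub_eq_iff_eq_add, sub_smul] at h1
    change _ = f + z • A _
    nth_rewrite 1 [h1]
    abel
  · have h0 := hA.apply_map hf
    have h1 : A (T ⟨f, hf⟩) = (u : X →L[ℂ] X) f + z • A f := by
      rw [h0, hu', sub_smul]
      abel
    rw [hc.eq]
    change (u⁻¹ : (X →L[ℂ] X)ˣ).1 (A _) = f + z • (u⁻¹ : (X →L[ℂ] X)ˣ).1 (A f)
    rw [h1, map_add, map_smul, units_inv_apply_apply]

variable [InnerProductSpace ℂ X]

theorem isFormalAdjoint_pert {T : X →ₗ.[ℂ] X} (hT : T.IsFormalAdjoint T) {W : X →L[ℂ] X}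
    (hW : ∀ f g, inner ℂ (W f) g = inner ℂ f (W g)) :
    (pert T W).IsFormalAdjoint (pert T W) := by
  intro f g
  change inner ℂ (T f + W f) (g : X) = inner ℂ (f : X) (T g + W g)
  rw [inner_add_left, inner_add_right, hW, hT f g]

/-- The resolvent of a symmetric operator at `conj z` is the adjoint of the one at `z`. -/
theorem IsResolventAt.inner_eq {T : X →ₗ.[ℂ] X} (hT : T.IsFormalAdjoint T) {z : ℂ}
    {R S : X →L[ℂ] X} (hR : IsResolventAt T z R) (hS : IsResolventAt T (conj z) S) (f g : X) :
    inner ℂ (R f) g = inner ℂ f (S g) := by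
  obtain ⟨h1, hf⟩ := hR.1 f
  obtain ⟨h2, hg⟩ := hS.1 g
  have := hT ⟨R f, h1⟩ ⟨S g, h2⟩
  conv_lhs => rw [← hg]
  conv_rhs => rw [← hf]
  rw [inner_sub_right, inner_sub_left, inner_smul_left, inner_smul_right, this]

theorem IsResolventAt.norm_apply_le {T : X →ₗ.[ℂ] X} (hT : T.IsFormalAdjoint T) {z : ℂ}
    {R : X →L[ℂ] X} (hR : IsResolventAt T z R) (f : X) : |z.im| * ‖R f‖ ≤ ‖f‖ := by
  obtain ⟨h1, hf⟩ := hR.1 f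
  have h2 := hT ⟨R f, h1⟩ ⟨R f, h1⟩
  have h3 : (inner ℂ (R f) (T ⟨R f, h1⟩)).im = 0 := by
    rw [← Complex.conj_eq_iff_im, inner_conj_symm, h2]
  have h4 : (inner ℂ (R f) f).im = - (z.im * ‖R f‖ ^ 2) := by
    have h5 := congrArg (fun g => (inner ℂ (R f) g).im) hf
    rw [← h5, inner_sub_right, inner_smul_right, Complex.sub_im, h3, inner_self_eq_norm_sq_to_K]
    simp [Complex.mul_im, ← Complex.ofReal_pow]
  have h5 : |(inner ℂ (R f) f).im| ≤ ‖R f‖ * ‖f‖ :=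
    (Complex.abs_im_le_norm _).trans (norm_inner_le_norm _ _)
  rw [h4, abs_neg, abs_mul, abs_of_nonneg (sq_nonneg ‖R f‖)] at h5
  rcases (norm_nonneg (R f)).eq_or_lt with h0 | h0
  · rw [← h0, mul_zero]
    exact norm_nonneg _
  · refine le_of_mul_le_mul_left ?_ h0
    calc ‖R f‖ * (|z.im| * ‖R f‖) = |z.im| * ‖R f‖ ^ 2 := by ring
      _ ≤ _ := h5

theorem IsResolventAt.norm_le {T : X →ₗ.[ℂ] X} (hT : T.IsFormalAdjoint T) {z : ℂ}
    (hz : z.im ≠ 0) {R : X →L[ℂ] X} (hR : IsResolventAt T z R) : ‖R‖ ≤ |z.im|⁻¹ := by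
  refine R.opNorm_le_bound (by positivity) fun f => ?_
  rw [inv_mul_eq_div, le_div_iff₀ (by positivity), mul_comm]
  exact hR.norm_apply_le hT f

/-- `T` is symmetric and has a real resolvent point, as every semibounded self-adjoint operator
does. Such a `T` is self-adjoint. -/
structure HasRealResolvent (T : X →ₗ.[ℂ] X) : Prop where
  symm : T.IsFormalAdjoint T
  exists_real : ∃ c : ℝ, ∃ A, IsResolventAt T c A

variable [CompleteSpace X]

theorem IsResolventAt.isSelfAdjoint {T : X →ₗ.[ℂ] X} (hT : T.IsFormalAdjoint T) {c : ℝ}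
    {A : X →L[ℂ] X} (hA : IsResolventAt T c A) : IsSelfAdjoint A := by
  rw [ContinuousLinearMap.isSelfAdjoint_iff_isSymmetric]
  intro f g
  exact hA.inner_eq hT (by rwa [Complex.conj_ofReal]) f g

theorem isUnit_one_sub_smul {A : X →L[ℂ] X} (hA : IsSelfAdjoint A) {w : ℂ} (hw : w.im ≠ 0) :
    IsUnit (1 - w • A) := by
  have hw0 : w ≠ 0 := by
    rintro rfl
    simp at hw
  have h1 : w⁻¹ ∉ spectrum ℂ A := by
    intro h
    have := hA.im_eq_zero_of_mem_spectrum h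
    rw [Complex.inv_im, div_eq_zero_iff, neg_eq_zero] at this
    rcases this with h | h
    · exact hw h
    · exact hw0 (Complex.normSq_eq_zero.1 h)
  rw [spectrum.notMem_iff] at h1
  have h2 : 1 - w • A = (Units.mk0 w hw0) • (algebraMap ℂ (X →L[ℂ] X) w⁻¹ - A) := by
    rw [Units.smul_mk0, smul_sub, Algebra.algebraMap_eq_smul_one, smul_smul, mul_inv_cancel₀ hw0,
      one_smul]
  rw [h2]
  exact h1.smul _

theorem HasRealResolvent.exists_resolvent {T : X →ₗ.[ℂ] X} (hT : HasRealResolvent T) {z : ℂ}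
    (hz : z.im ≠ 0) : ∃ R, IsResolventAt T z R := by
  obtain ⟨c, A, hA⟩ := hT.exists_real
  obtain ⟨u, hu⟩ := isUnit_one_sub_smul (hA.isSelfAdjoint hT.symm) (w := z - c) (by simpa using hz)
  exact ⟨_, hA.of_unit u hu⟩

theorem HasRealResolvent.isResolventAt {T : X →ₗ.[ℂ] X} (hT : HasRealResolvent T) {z : ℂ}
    (hz : z.im ≠ 0) : IsResolventAt T z (resolventOp T z) := by
  obtain ⟨R, hR⟩ := hT.exists_resolvent hz
  rwa [hR.resolventOp_eq]

theorem HasRealResolvent.norm_resolventOp_le {T : X →ₗ.[ℂ] X} (hT : HasRealResolvent T) {z : ℂ}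
    (hz : z.im ≠ 0) : ‖resolventOp T z‖ ≤ |z.im|⁻¹ :=
  (hT.isResolventAt hz).norm_le hT.symm hz

theorem HasRealResolvent.continuousAt_resolventOp {T : X →ₗ.[ℂ] X} (hT : HasRealResolvent T)
    {z : ℂ} (hz : z.im ≠ 0) : ContinuousAt (resolventOp T) z := by
  have h1 : ∀ᶠ w in nhds z, |z.im| / 2 < |w.im| :=
    (Complex.continuous_im.abs.continuousAt).eventually (lt_mem_nhds (half_lt_self (by positivity)))
  refine tendsto_iff_norm_sub_tendsto_zero.2 ?_
  have h2 : Filter.Tendsto (fun w : ℂ => ‖w - z‖ * ((|z.im| / 2)⁻¹ * |z.im|⁻¹)) (nhds z)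
      (nhds 0) := by
    have : Filter.Tendsto (fun w : ℂ => ‖w - z‖ * ((|z.im| / 2)⁻¹ * |z.im|⁻¹)) (nhds z)
        (nhds (‖z - z‖ * ((|z.im| / 2)⁻¹ * |z.im|⁻¹))) := by
      refine Continuous.tendsto ?_ z
      fun_prop
    simpa using this
  refine squeeze_zero' (.of_forall fun _ => norm_nonneg _) ?_ h2
  filter_upwards [h1] with w hw
  have hw0 : w.im ≠ 0 := abs_pos.1 (lt_trans (by positivity) hw)
  rw [(hT.isResolventAt hw0).sub_eq (hT.isResolventAt hz), norm_smul]
  refine mul_le_mul_of_nonneg_left ((norm_mul_le _ _).trans ?_) (norm_nonneg _)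
  refine mul_le_mul ((hT.norm_resolventOp_le hw0).trans ?_) (hT.norm_resolventOp_le hz)
    (norm_nonneg _) (by positivity)
  exact inv_anti₀ (by positivity) hw.le

theorem HasRealResolvent.hasDerivAt_resolventOp {T : X →ₗ.[ℂ] X} (hT : HasRealResolvent T)
    {z : ℂ} (hz : z.im ≠ 0) :
    HasDerivAt (resolventOp T) (resolventOp T z * resolventOp T z) z := by
  rw [hasDerivAt_iff_tendsto_slope]
  have h1 : Filter.Tendsto (fun w => resolventOp T w * resolventOp T z) (nhdsWithin z {z}ᶜ)
      (nhds (resolventOp T z * resolventOp T z)) :=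
    ((hT.continuousAt_resolventOp hz).tendsto.mul_const _).mono_left nhdsWithin_le_nhds
  refine h1.congr' ?_
  have h2 : ∀ᶠ w in nhdsWithin z {z}ᶜ, w.im ≠ 0 :=
    (Complex.continuous_im.continuousAt.eventually_ne hz).filter_mono nhdsWithin_le_nhds
  filter_upwards [h2, self_mem_nhdsWithin] with w hw hne
  rw [slope_def_module, (hT.isResolventAt hw).sub_eq (hT.isResolventAt hz), smul_smul,
    inv_mul_cancel₀ (sub_ne_zero.2 hne), one_smul]

/-- The Lorentzian of a self-adjoint operator is the imaginary part of its resolvent. -/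
theorem HasRealResolvent.inner_lorentzian {T : X →ₗ.[ℂ] X} (hT : HasRealResolvent T) (E : ℝ)
    {η : ℝ} (hη : 0 < η) (f : X) :
    inner ℂ f (lorentzian T E η f) = ((inner ℂ f (resolventOp T (E + η * I) f)).im : ℂ) := by
  have h1 : ((E : ℂ) + η * I).im ≠ 0 := by simpa using hη.ne'
  have h2 : ((E : ℂ) - η * I).im ≠ 0 := by simpa using hη.ne'
  have hR := hT.isResolventAt h1
  have hS := hT.isResolventAt h2
  have h3 := congrArg (fun A : X →L[ℂ] X => inner ℂ f (A f)) (hR.sub_eq hS)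
  have h4 := hR.inner_eq hT.symm (f := f) (g := f) (S := resolventOp T (E - η * I))
    (by simpa [sub_eq_add_neg] using hS)
  change inner ℂ f (resolventOp T (E + η * I) f - resolventOp T (E - η * I) f)
    = inner ℂ f ((E + η * I - (E - η * I) : ℂ) •
      resolventOp T (E + η * I) (resolventOp T (E - η * I) f)) at h3
  rw [inner_sub_right, inner_smul_right, ← h4, ← inner_conj_symm (resolventOp T (E + η * I) f) f,
    Complex.sub_conj] at h3
  change inner ℂ f ((η : ℂ) • resolventOp T (E + η * I) (resolventOp T (E - η * I) f)) = _
  rw [inner_smul_right]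
  have h5 : ((E : ℂ) + η * I - (E - η * I)) = 2 * I * η := by ring
  rw [h5] at h3
  have h6 : (2 * I : ℂ) ≠ 0 := by simp
  refine mul_left_cancel₀ h6 ?_
  rw [← mul_assoc, ← h3]
  push_cast
  ring

/-- The Lorentzian `η (T - z)⁻¹ (T - z̄)⁻¹` is the positive operator `η |(T - z)⁻¹|²`. -/
theorem HasRealResolvent.inner_lorentzian_eq_norm_sq {T : X →ₗ.[ℂ] X} (hT : HasRealResolvent T)
    (E : ℝ) {η : ℝ} (hη : 0 < η) (f : X) :
    inner ℂ f (lorentzian T E η f) = ((η * ‖resolventOp T (E - η * I) f‖ ^ 2 : ℝ) : ℂ) := by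
  have h1 : ((E : ℂ) + η * I).im ≠ 0 := by simpa using hη.ne'
  have h2 : ((E : ℂ) - η * I).im ≠ 0 := by simpa using hη.ne'
  have h4 := (hT.isResolventAt h2).inner_eq hT.symm (f := f)
    (g := resolventOp T (E - η * I) f) (S := resolventOp T (E + η * I))
    (by simpa [sub_eq_add_neg] using hT.isResolventAt h1)
  change inner ℂ f ((η : ℂ) • resolventOp T (E + η * I) (resolventOp T (E - η * I) f)) = _
  rw [inner_smul_right, ← h4, inner_self_eq_norm_sq_to_K]
  push_cast
  rfl

end Resolvent

/-! ### Shifting a line of integration, and Fourier transforms of test functions -/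

/-- Cauchy's theorem for a horizontal strip. -/
theorem integral_shift_line {k : ℂ → ℂ} {β C : ℝ} (hβ : 0 ≤ β)
    (hd : ∀ w : ℂ, 0 ≤ w.im → DifferentiableAt ℂ k w)
    (hb : ∀ w : ℂ, 0 ≤ w.im → w.im ≤ β → ‖k w‖ ≤ C * (1 + w.re ^ 2)⁻¹) :
    ∫ x : ℝ, k x = ∫ x : ℝ, k (x + β * I) := by
  have hint : ∀ b : ℝ, 0 ≤ b → b ≤ β → Integrable fun x : ℝ => k (x + b * I) := by
    intro b hb0 hbβ
    refine (integrable_inv_one_add_sq.const_mul C).mono' ?_ (.of_forall fun x => ?_)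
    · refine Continuous.aestronglyMeasurable (continuous_iff_continuousAt.2 fun x => ?_)
      refine ContinuousAt.comp (f := fun x : ℝ => (x + b * I : ℂ)) (g := k)
        (hd _ (by simpa using hb0)).continuousAt (by fun_prop)
    · simpa using hb (x + b * I) (by simpa using hb0) (by simpa using hbβ)
  have h0 := intervalIntegral_tendsto_integral (hint 0 le_rfl hβ) Filter.tendsto_neg_atTop_atBot
    Filter.tendsto_id
  have h1 := intervalIntegral_tendsto_integral (hint β hβ le_rfl) Filter.tendsto_neg_atTop_atBot
    Filter.tendsto_id
  have h2 := h0.sub h1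
  have h3 : Filter.Tendsto (fun T : ℝ => 2 * (C * (1 + T ^ 2)⁻¹ * β)) Filter.atTop (nhds 0) := by
    have : Filter.Tendsto (fun T : ℝ => (1 + T ^ 2)⁻¹) Filter.atTop (nhds 0) :=
      tendsto_inv_atTop_zero.comp
        (Filter.tendsto_atTop_add_const_left _ _ (Filter.tendsto_pow_atTop two_ne_zero))
    simpa using ((this.const_mul C).mul_const β).const_mul 2
  have h4 : Filter.Tendsto (fun T : ℝ => (∫ x in (-T)..T, k (x + (0 : ℝ) * I)) -
      ∫ x in (-T)..T, k (x + β * I)) Filter.atTop (nhds 0) := by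
    refine squeeze_zero_norm (fun T => ?_) h3
    have hr := Complex.integral_boundary_rect_eq_zero_of_differentiableOn k (-T : ℝ)
      ((T : ℝ) + (β : ℝ) * I) (fun w hw => by
        refine (hd w ?_).differentiableWithinAt
        have := hw.2
        simp only [Set.mem_preimage] at this
        simp [Set.uIcc_of_le hβ] at this
        exact this.1)
    simp only [ofReal_im, ofReal_re, add_re, add_im, mul_re, mul_im, I_re, I_im, mul_zero, mul_one,
      sub_zero, add_zero, zero_add] at hr
    have hv : ∀ s : ℝ, s ^ 2 = T ^ 2 →
        ‖∫ y in (0 : ℝ)..β, k (s + y * I)‖ ≤ C * (1 + T ^ 2)⁻¹ * β := by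
      intro s hs
      have := intervalIntegral.norm_integral_le_of_norm_le_const (a := 0) (b := β)
        (f := fun y : ℝ => k (s + y * I)) (C := C * (1 + T ^ 2)⁻¹) (fun y hy => by
          rw [Set.uIoc_of_le hβ] at hy
          simpa [hs] using hb (s + y * I) (by simpa using hy.1.le) (by simpa using hy.2))
      simpa [abs_of_nonneg hβ] using this
    have e : (∫ x in (-T)..T, k (x + (0 : ℝ) * I)) - ∫ x in (-T)..T, k (x + β * I)
        = I • (∫ y in (0 : ℝ)..β, k ((-T : ℝ) + y * I)) - I • ∫ y in (0 : ℝ)..β, k (T + y * I) := by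
      rw [← sub_eq_zero, ← hr]
      ring
    rw [e]
    refine (norm_sub_le _ _).trans ?_
    rw [norm_smul, norm_smul, norm_I, one_mul, one_mul, two_mul]
    exact add_le_add (hv _ (by simp)) (hv _ rfl)
  have h5 := tendsto_nhds_unique h2 h4
  rw [sub_eq_zero] at h5
  simpa using h5

/-- The Fourier transform of `u` at a complex frequency. -/
def laplaceFourier (u : ℝ → ℂ) (w : ℂ) : ℂ := ∫ t : ℝ, exp (-(2 * Real.pi * I * w) * t) * u t

theorem fourier_eq_laplaceFourier (u : ℝ → ℂ) (α : ℝ) : 𝓕 u α = laplaceFourier u α := by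
  rw [Real.fourier_eq', laplaceFourier]
  refine integral_congr_ae (.of_forall fun t => ?_)
  simp only [smul_eq_mul]
  congr 2
  simp
  ring

section TestFunction

variable {u : ℝ → ℂ} {r : ℝ}

theorem hasCompactSupport_of_abs (hs : ∀ t, r < |t| → u t = 0) : HasCompactSupport u := by
  refine HasCompactSupport.of_support_subset_isCompact (isCompact_Icc (a := -r) (b := r)) ?_
  intro t ht
  by_contra h
  refine ht (hs t ?_)
  by_contra h2
  exact h (Set.mem_Icc.2 (abs_le.1 (not_lt.1 h2)))

theorem integrable_exp_mul (hu : Continuous u) (hs : ∀ t, r < |t| → u t = 0) (w : ℂ) :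
    Integrable fun t : ℝ => exp (w * t) * u t :=
  have h : HasCompactSupport fun t : ℝ => exp (w * t) * u t :=
    hasCompactSupport_of_abs (r := r) fun t ht => by simp [hs t ht]
  Continuous.integrable_of_hasCompactSupport (by fun_prop) h

theorem norm_laplaceFourier_le (hu : Continuous u) (hs : ∀ t, r < |t| → u t = 0) (w : ℂ) :
    ‖laplaceFourier u w‖ ≤ (∫ t, ‖u t‖) * Real.exp (2 * Real.pi * r * |w.im|) := by
  rw [← integral_mul_const]
  refine norm_integral_le_of_norm_le ((hu.integrable_of_hasCompactSupport
    (hasCompactSupport_of_abs hs)).norm.mul_const _) (.of_forall fun t => ?_)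
  rw [norm_mul, mul_comm]
  by_cases ht : r < |t|
  · simp [hs t ht]
  · refine mul_le_mul_of_nonneg_left ?_ (norm_nonneg _)
    rw [Complex.norm_exp]
    refine Real.exp_le_exp.2 ?_
    have : (-(2 * Real.pi * I * w) * t).re = 2 * Real.pi * (t * w.im) := by
      simp
      ring
    rw [this, mul_assoc (2 * Real.pi) r]
    refine mul_le_mul_of_nonneg_left ?_ (by positivity)
    refine (le_abs_self _).trans ?_
    rw [abs_mul]
    exact mul_le_mul_of_nonneg_right (not_lt.1 ht) (abs_nonneg _)

theorem deriv_eq_zero_of_abs (hs : ∀ t, r < |t| → u t = 0) : ∀ t, r < |t| → deriv u t = 0 := by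
  intro t ht
  have : u =ᶠ[nhds t] fun _ => 0 := by
    filter_upwards [continuous_abs.continuousAt.eventually (lt_mem_nhds ht)] with s h
    exact hs s h
  rw [this.deriv_eq, deriv_const]

theorem laplaceFourier_deriv (hu : ContDiff ℝ 1 u) (hs : ∀ t, r < |t| → u t = 0) (w : ℂ) :
    laplaceFourier (deriv u) w = 2 * Real.pi * I * w * laplaceFourier u w := by
  set c := -(2 * Real.pi * I * w) with hc
  have he : ∀ t : ℝ, HasDerivAt (fun t : ℝ => exp (c * t)) (c * exp (c * t)) t := by
    intro t
    have := ((hasDerivAt_id (t : ℂ)).const_mul c).cexp.comp_ofReal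
    simpa [mul_comm] using this
  have hu' : ∀ t, HasDerivAt u (deriv u t) t := fun t =>
    (hu.differentiable one_ne_zero t).hasDerivAt
  have h1 := integrable_exp_mul hu.continuous hs c
  have h2 := integrable_exp_mul (hu.continuous_deriv le_rfl) (deriv_eq_zero_of_abs hs) c
  have h := integral_mul_deriv_eq_deriv_mul_of_integrable (u := fun t : ℝ => exp (c * t)) (v := u)
    (u' := fun t : ℝ => c * exp (c * t)) (v' := deriv u) (fun t _ => he t) (fun t _ => hu' t) h2
    (by simpa [mul_assoc, Pi.mul_def] using h1.const_mul c) h1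
  rw [laplaceFourier, ← hc, h, laplaceFourier, ← integral_const_mul, ← integral_neg]
  refine integral_congr_ae (.of_forall fun t => ?_)
  simp only [hc]
  ring

/-- Twice differentiable functions of compact support have a Fourier transform which decays
quadratically in every horizontal strip. -/
theorem exists_norm_laplaceFourier_le (hu : ContDiff ℝ 2 u) (hs : ∀ t, r < |t| → u t = 0) :
    ∃ C, 0 ≤ C ∧ ∀ w : ℂ, ‖laplaceFourier u w‖
      ≤ C * Real.exp (2 * Real.pi * r * |w.im|) * (1 + w.re ^ 2)⁻¹ := by
  have hu1 : ContDiff ℝ 1 (deriv u) := (contDiff_succ_iff_deriv (n := 1)).1 hu |>.2.2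
  have hs1 := deriv_eq_zero_of_abs hs
  refine ⟨(∫ t, ‖u t‖) + ∫ t, ‖deriv (deriv u) t‖, by positivity, fun w => ?_⟩
  have h0 := norm_laplaceFourier_le hu.continuous hs w
  have h2 := norm_laplaceFourier_le (hu1.continuous_deriv le_rfl) (deriv_eq_zero_of_abs hs1) w
  rw [laplaceFourier_deriv hu1 hs1, laplaceFourier_deriv (hu.of_le (by norm_num)) hs,
    ← mul_assoc, norm_mul, norm_mul] at h2
  have h3 : w.re ^ 2 ≤ ‖2 * Real.pi * I * w‖ * ‖2 * Real.pi * I * w‖ := by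
    have : ‖2 * Real.pi * I * w‖ = 2 * Real.pi * ‖w‖ := by
      simp [abs_of_pos Real.pi_pos]
    rw [this, ← pow_two, ← sq_abs w.re]
    refine pow_le_pow_left₀ (abs_nonneg _) ((Complex.abs_re_le_norm w).trans ?_) 2
    have := Real.pi_gt_three
    nlinarith [norm_nonneg w]
  rw [← div_eq_mul_inv, le_div_iff₀ (by positivity), mul_add, mul_one, add_mul]
  refine add_le_add h0 (le_trans ?_ h2)
  rw [mul_comm]
  exact mul_le_mul_of_nonneg_right h3 (norm_nonneg _)

theorem differentiable_laplaceFourier (hu : Continuous u) (hs : ∀ t, r < |t| → u t = 0) :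
    Differentiable ℂ (laplaceFourier u) := by
  intro w
  have hsupp : ∀ w : ℂ, Integrable fun t : ℝ => exp (-(2 * Real.pi * I * w) * t) * u t :=
    fun w => integrable_exp_mul hu hs _
  have hv : Continuous fun t : ℝ => (-(2 * Real.pi * I) * t) * u t := by fun_prop
  have hvs : ∀ t, r < |t| → (-(2 * Real.pi * I) * t) * u t = 0 := fun t ht => by simp [hs t ht]
  refine (hasDerivAt_integral_of_dominated_loc_of_deriv_le (μ := volume) (x₀ := w)
    (F := fun (w : ℂ) (t : ℝ) => exp (-(2 * Real.pi * I * w) * t) * u t)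
    (F' := fun (w : ℂ) (t : ℝ) => exp (-(2 * Real.pi * I * w) * t) * ((-(2 * Real.pi * I) * t) * u t))
    (s := Metric.ball w 1)
    (bound := fun t => Real.exp (2 * Real.pi * (r * (‖w‖ + 1))) * ‖(-(2 * Real.pi * I) * t) * u t‖)
    (Metric.ball_mem_nhds w one_pos) (.of_forall fun w => (hsupp w).1) (hsupp w)
    (integrable_exp_mul hv hvs _).1 ?_ ?_ ?_).2.differentiableAt
  · refine .of_forall fun t z hz => ?_
    by_cases ht : r < |t|
    · simp [hs t ht]
    · rw [norm_mul]
      refine mul_le_mul_of_nonneg_right ?_ (norm_nonneg _)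
      rw [Complex.norm_exp]
      refine Real.exp_le_exp.2 ?_
      have : (-(2 * Real.pi * I * z) * t).re = 2 * Real.pi * (t * z.im) := by
        simp
        ring
      rw [this]
      refine mul_le_mul_of_nonneg_left ?_ (by positivity)
      have h1 : ‖z‖ ≤ ‖w‖ + 1 := by
        have := norm_sub_norm_le z w
        rw [Metric.mem_ball, dist_eq_norm] at hz
        linarith
      refine (le_abs_self _).trans ?_
      rw [abs_mul]
      exact mul_le_mul (not_lt.1 ht) ((Complex.abs_im_le_norm z).trans h1) (abs_nonneg _)
        ((abs_nonneg _).trans (not_lt.1 ht))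
  · exact ((hv.integrable_of_hasCompactSupport (hasCompactSupport_of_abs hvs)).norm).const_mul _
  · refine .of_forall fun t z _ => ?_
    have h1 : HasDerivAt (fun z : ℂ => -(2 * Real.pi * I * z) * t) (-(2 * Real.pi * I) * t) z := by
      have := ((hasDerivAt_id z).const_mul (-(2 * Real.pi * I) * t))
      refine (this.congr_deriv (by simp)).congr_of_eventuallyEq (.of_forall fun y => ?_)
      simp
      ring
    refine (h1.cexp.mul_const (u t)).congr_deriv ?_
    ring

theorem integrable_laplaceFourier (hu : ContDiff ℝ 2 u) (hs : ∀ t, r < |t| → u t = 0) :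
    Integrable fun α : ℝ => laplaceFourier u α := by
  obtain ⟨C, -, hC⟩ := exists_norm_laplaceFourier_le hu hs
  refine (integrable_inv_one_add_sq.const_mul C).mono' ?_ (.of_forall fun α => ?_)
  · exact ((differentiable_laplaceFourier hu.continuous hs).continuous.comp
      continuous_ofReal).aestronglyMeasurable
  · simpa using hC α

theorem integral_laplaceFourier_mul_exp (hu : ContDiff ℝ 2 u) (hs : ∀ t, r < |t| → u t = 0)
    (t : ℝ) : ∫ α : ℝ, laplaceFourier u α * exp (2 * Real.pi * α * t * I) = u t := by
  have h1 : 𝓕 u = fun α : ℝ => laplaceFourier u α := funext fun α => fourier_eq_laplaceFourier u α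
  have h2 := hu.continuous.fourierInv_fourier_eq
    (hu.continuous.integrable_of_hasCompactSupport (hasCompactSupport_of_abs hs))
    (h1 ▸ integrable_laplaceFourier hu hs)
  rw [h1] at h2
  conv_rhs => rw [← h2]
  rw [Real.fourierInv_eq']
  refine integral_congr_ae (.of_forall fun α => ?_)
  simp only [smul_eq_mul]
  rw [mul_comm]
  congr 2
  simp
  ring

end TestFunction

/-! ### Regularization of the resolvent -/

theorem integral_exp_resolvent {z : ℂ} (hz : 0 < z.im) (h : ℝ) :
    I * ∫ t in Set.Ioi (0 : ℝ), exp (I * (z - h) * t) = (h - z)⁻¹ := by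
  have h1 : (I * (z - h)).re < 0 := by simpa using hz
  have h2 : (h - z : ℂ) ≠ 0 := by
    intro h0
    have := congrArg Complex.im h0
    simp at this
    linarith
  have h3 : (z - h : ℂ) ≠ 0 := by
    rw [← neg_sub]
    exact neg_ne_zero.2 h2
  rw [integral_exp_mul_complex_Ioi h1]
  simp only [ofReal_zero, mul_zero, Complex.exp_zero]
  field_simp
  ring

theorem integrableOn_exp_resolvent {z : ℂ} (hz : 0 < z.im) (h : ℝ) :
    IntegrableOn (fun t : ℝ => exp (I * (z - h) * t)) (Set.Ioi 0) :=
  integrableOn_exp_mul_complex_Ioi (by simpa using hz) 0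

theorem norm_exp_resolvent (z : ℂ) (h t : ℝ) :
    ‖exp (I * (z - h) * t)‖ = Real.exp (-z.im * t) := by
  rw [Complex.norm_exp]
  congr 1
  simp

/-- Integrating the translates of `x ↦ (x - z)⁻¹` against the Fourier transform of `u` inserts `u`
into the representation of `(x - z)⁻¹` as a time integral. -/
theorem integral_laplaceFourier_mul_resolvent {u : ℝ → ℂ} {r : ℝ} (hu : ContDiff ℝ 2 u)
    (hs : ∀ t, r < |t| → u t = 0) {z : ℂ} (hz : 0 < z.im) (h : ℝ) :
    ∫ α : ℝ, laplaceFourier u α * (h - (z + 2 * Real.pi * α))⁻¹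
      = I * ∫ t in Set.Ioi (0 : ℝ), u t * exp (I * (z - h) * t) := by
  have e1 : ∀ α : ℝ, laplaceFourier u α * (h - (z + 2 * Real.pi * α))⁻¹
      = I * ∫ t in Set.Ioi (0 : ℝ), laplaceFourier u α * exp (2 * Real.pi * α * t * I)
        * exp (I * (z - h) * t) := by
    intro α
    have hz' : 0 < (z + 2 * Real.pi * α : ℂ).im := by simpa using hz
    rw [← integral_exp_resolvent hz' h, mul_left_comm, ← integral_const_mul]
    congr 1
    refine integral_congr_ae (.of_forall fun t => ?_)
    simp only
    rw [mul_assoc (laplaceFourier u α), ← Complex.exp_add]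
    congr 2
    ring
  simp_rw [e1]
  rw [integral_const_mul, integral_integral_swap]
  · congr 1
    refine integral_congr_ae (.of_forall fun t => ?_)
    simp only
    rw [integral_mul_const, integral_laplaceFourier_mul_exp hu hs]
  · have h1 := (integrable_laplaceFourier hu hs).mul_prod (integrableOn_exp_resolvent hz h)
    refine h1.mono ?_ (.of_forall fun p => ?_)
    · refine Continuous.aestronglyMeasurable ?_
      have := (differentiable_laplaceFourier hu.continuous hs).continuous
      simp only [Function.uncurry_def]
      fun_prop
    · simp only [Function.uncurry, norm_mul]
      have : ‖exp (2 * Real.pi * p.1 * p.2 * I)‖ = 1 := by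
        have := Complex.norm_exp_ofReal_mul_I (2 * Real.pi * p.1 * p.2)
        push_cast at this
        exact this
      rw [this, mul_one]

/-- The time cutoff at `1 / a` changes `(x - z)⁻¹` by at most `e^{- Im z / a} / Im z`. -/
theorem norm_resolvent_sub_integral_le {u : ℝ → ℂ} {r a : ℝ} (ha : 0 < a) (hu : ContDiff ℝ 2 u)
    (hs : ∀ t, r < |t| → u t = 0) (hu1 : ∀ t, ‖1 - u t‖ ≤ 1) (hu2 : ∀ t, |t| ≤ a⁻¹ → u t = 1)
    {z : ℂ} (hz : 0 < z.im) (h : ℝ) :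
    ‖(h - z)⁻¹ - ∫ α : ℝ, laplaceFourier u α * (h - (z + 2 * Real.pi * α))⁻¹‖
      ≤ Real.exp (-(z.im / a)) / z.im := by
  have hi := integrableOn_exp_resolvent hz h
  have hi2 : IntegrableOn (fun t : ℝ => u t * exp (I * (z - h) * t)) (Set.Ioi 0) := by
    have := integrable_exp_mul hu.continuous hs (I * (z - h))
    simpa only [mul_comm] using this.integrableOn
  rw [integral_laplaceFourier_mul_resolvent hu hs hz, ← integral_exp_resolvent hz h, ← mul_sub,
    norm_mul, norm_I, one_mul, ← integral_sub hi hi2]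
  have h0 : (0 : ℝ) ≤ a⁻¹ := by positivity
  have h1 : ∫ t in Set.Ioi a⁻¹, Real.exp (-z.im * t) = Real.exp (-(z.im / a)) / z.im := by
    rw [integral_exp_mul_Ioi (by linarith), div_neg, neg_div, neg_neg, div_eq_mul_inv z.im, neg_mul]
  have h2 : ∫ t in Set.Ioi (0 : ℝ), (exp (I * (z - h) * t) - u t * exp (I * (z - h) * t))
      = ∫ t in Set.Ioi a⁻¹, (exp (I * (z - h) * t) - u t * exp (I * (z - h) * t)) := by
    refine (setIntegral_eq_of_subset_of_forall_sdiff_eq_zero measurableSet_Ioi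
      (Set.Ioi_subset_Ioi h0) fun t ht => ?_)
    have ht1 : 0 < t := ht.1
    have ht2 : t ≤ a⁻¹ := not_lt.1 ht.2
    rw [hu2 t (by rwa [abs_of_pos ht1]), one_mul, sub_self]
  rw [h2, ← h1]
  refine norm_integral_le_of_norm_le (integrableOn_exp_mul_Ioi (by linarith) _)
    (.of_forall fun t => ?_)
  rw [← norm_exp_resolvent z h t]
  calc ‖exp (I * (z - h) * t) - u t * exp (I * (z - h) * t)‖
      = ‖1 - u t‖ * ‖exp (I * (z - h) * t)‖ := by rw [← norm_mul]; congr 1; ring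
    _ ≤ 1 * ‖exp (I * (z - h) * t)‖ := mul_le_mul_of_nonneg_right (hu1 t) (norm_nonneg _)
    _ = _ := one_mul _

section Operator

variable {X : Type*} [NormedAddCommGroup X] [InnerProductSpace ℂ X] [CompleteSpace X]
  {T : X →ₗ.[ℂ] X}

/-- The function `x ↦ x / (1 - w x)`, which turns `(T - c)⁻¹` into `(T - c - w)⁻¹`. -/
def mobius (w x : ℂ) : ℂ := x * (1 - w * x)⁻¹

theorem one_sub_mul_ne_zero {w x : ℂ} (hw : w.im ≠ 0) (hx : x.im = 0) : 1 - w * x ≠ 0 := by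
  intro h
  have h1 := congrArg Complex.im h
  have h2 := congrArg Complex.re h
  simp [hx] at h1 h2
  rcases h1 with h1 | h1
  · exact hw h1
  · simp [h1] at h2

theorem mobius_eq {w x : ℂ} (hw : w.im ≠ 0) (hx : x.im = 0) (hx0 : x ≠ 0) :
    mobius w x = ((x.re⁻¹ : ℝ) - w)⁻¹ := by
  have hx' : x = (x.re : ℂ) := Complex.ext rfl (by simpa using hx)
  have h := one_sub_mul_ne_zero hw hx
  have h2 : (x.re⁻¹ : ℝ) - w = x⁻¹ * (1 - w * x) := by
    rw [ofReal_inv, ← hx', mul_sub, mul_one, mul_left_comm, inv_mul_cancel₀ hx0, mul_one]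
  rw [mobius, h2, mul_inv, inv_inv]

theorem norm_mobius_le {w x : ℂ} (hw : w.im ≠ 0) (hx : x.im = 0) : ‖mobius w x‖ ≤ |w.im|⁻¹ := by
  by_cases hx0 : x = 0
  · simp [mobius, hx0]
  · rw [mobius_eq hw hx hx0, norm_inv]
    refine inv_anti₀ (by positivity) ?_
    have := Complex.abs_im_le_norm ((x.re⁻¹ : ℝ) - w : ℂ)
    simpa using this

theorem IsResolventAt.cfc_mobius {c : ℝ} {A R : X →L[ℂ] X} (hT : T.IsFormalAdjoint T)
    (hA : IsResolventAt T c A) {z : ℂ} (hz : z.im ≠ 0) (hR : IsResolventAt T z R) :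
    cfc (mobius (z - c)) A = R := by
  have hsa := hA.isSelfAdjoint hT
  have hn : IsStarNormal A := hsa.isStarNormal
  have hw : (z - c).im ≠ 0 := by simpa using hz
  have hc : ContinuousOn (mobius (z - c)) (spectrum ℂ A) := by
    refine continuousOn_id.mul (ContinuousOn.inv₀ (by fun_prop) fun x hx => ?_)
    exact one_sub_mul_ne_zero hw (hsa.im_eq_zero_of_mem_spectrum hx)
  have h1 : cfc (mobius (z - c)) A * (1 - (z - c) • A) = A := by
    have e : (1 - (z - c) • A) = cfc (fun x => 1 - (z - c) * x) A := by
      rw [cfc_sub (fun _ => 1) (fun x => (z - c) * x) A, cfc_const_one ℂ A,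
        cfc_const_mul_id (z - c) A]
    rw [e, ← cfc_mul (mobius (z - c)) (fun x => 1 - (z - c) * x) A hc (by fun_prop)]
    conv_rhs => rw [← cfc_id ℂ A]
    refine cfc_congr fun x hx => ?_
    have := one_sub_mul_ne_zero hw (hsa.im_eq_zero_of_mem_spectrum hx)
    simp only [mobius, id]
    rw [mul_assoc, inv_mul_cancel₀ this, mul_one]
  have h2 : R * (1 - (z - c) • A) = A := by
    rw [mul_sub, mul_one, mul_smul_comm, ← hR.sub_eq hA, sub_sub_cancel]
  obtain ⟨v, hv⟩ := isUnit_one_sub_smul hsa hw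
  rw [← hv] at h1 h2
  exact v.isUnit.mul_right_cancel (h1.trans h2.symm)

/-- The operator version of `norm_resolvent_sub_integral_le`. -/
theorem HasRealResolvent.norm_sub_integral_le (hT : HasRealResolvent T) {u : ℝ → ℂ} {r a : ℝ}
    (ha : 0 < a) (hu : ContDiff ℝ 2 u) (hs : ∀ t, r < |t| → u t = 0) (hu1 : ∀ t, ‖1 - u t‖ ≤ 1)
    (hu2 : ∀ t, |t| ≤ a⁻¹ → u t = 1) {z : ℂ} (hz : 0 < z.im) :
    ‖resolventOp T z - ∫ α : ℝ, laplaceFourier u α • resolventOp T (z + 2 * Real.pi * α)‖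
      ≤ Real.exp (-(z.im / a)) / z.im := by
  obtain ⟨c, A, hA⟩ := hT.exists_real
  have hsa := hA.isSelfAdjoint hT.symm
  have hn : IsStarNormal A := hsa.isStarNormal
  have hspec : ∀ x ∈ spectrum ℂ A, x.im = 0 := fun x hx => hsa.im_eq_zero_of_mem_spectrum hx
  have him : ∀ α : ℝ, (z + 2 * Real.pi * α : ℂ).im = z.im := fun α => by simp
  have him' : ∀ α : ℝ, (z + 2 * Real.pi * α - c : ℂ).im = z.im := fun α => by simp
  have hcont : ∀ w : ℂ, w.im ≠ 0 → ContinuousOn (mobius w) (spectrum ℂ A) := fun w hw =>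
    continuousOn_id.mul (ContinuousOn.inv₀ (by fun_prop) fun x hx =>
      one_sub_mul_ne_zero hw (hspec x hx))
  have e1 : ∀ α : ℝ, laplaceFourier u α • resolventOp T (z + 2 * Real.pi * α)
      = cfc (fun x => laplaceFourier u α * mobius (z + 2 * Real.pi * α - c) x) A := by
    intro α
    have h0 : (z + 2 * Real.pi * α : ℂ).im ≠ 0 := by rw [him]; exact hz.ne'
    have h1 : (z + 2 * Real.pi * α - c : ℂ).im ≠ 0 := by rw [him']; exact hz.ne'
    rw [cfc_const_mul _ _ A (hcont _ h1), hA.cfc_mobius hT.symm h0 (hT.isResolventAt h0)]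
  have hz' : (z - c : ℂ).im ≠ 0 := by simpa using hz.ne'
  have hjoint : ContinuousOn (Function.uncurry fun (α : ℝ) x =>
      laplaceFourier u α * mobius (z + 2 * Real.pi * α - c) x) (Set.univ ×ˢ spectrum ℂ A) := by
    have := (differentiable_laplaceFourier hu.continuous hs).continuous
    simp only [Function.uncurry_def, mobius]
    refine ContinuousOn.mul (by fun_prop) (ContinuousOn.mul (by fun_prop)
      (ContinuousOn.inv₀ (by fun_prop) fun p hp => ?_))
    exact one_sub_mul_ne_zero (by rw [him']; exact hz.ne') (hspec _ hp.2)
  have hbound : ∀ (α : ℝ), ∀ x ∈ spectrum ℂ A,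
      ‖laplaceFourier u α * mobius (z + 2 * Real.pi * α - c) x‖
        ≤ ‖laplaceFourier u α‖ * |z.im|⁻¹ := by
    intro α x hx
    rw [norm_mul]
    refine mul_le_mul_of_nonneg_left ?_ (norm_nonneg _)
    have := norm_mobius_le (w := z + 2 * Real.pi * α - c) (by rw [him']; exact hz.ne') (hspec x hx)
    rwa [him'] at this
  have hbi : HasFiniteIntegral (fun α : ℝ => ‖laplaceFourier u α‖ * |z.im|⁻¹) volume :=
    ((integrable_laplaceFourier hu hs).norm.mul_const _).2
  simp_rw [e1]
  rw [← cfc_integral (fun (α : ℝ) x => laplaceFourier u α * mobius (z + 2 * Real.pi * α - c) x)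
    (fun α => ‖laplaceFourier u α‖ * |z.im|⁻¹) A hjoint (.of_forall hbound) hbi,
    ← hA.cfc_mobius hT.symm hz.ne' (hT.isResolventAt hz.ne')]
  have hci : ContinuousOn (fun x => ∫ α : ℝ, laplaceFourier u α *
      mobius (z + 2 * Real.pi * α - c) x) (spectrum ℂ A) := by
    refine continuousOn_of_dominated (bound := fun α : ℝ => ‖laplaceFourier u α‖ * |z.im|⁻¹)
      (fun x hx => ?_) (fun x hx => .of_forall fun α => hbound α x hx)
      ((integrable_laplaceFourier hu hs).norm.mul_const _) (.of_forall fun α => ?_)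
    · have h : Continuous fun α : ℝ =>
          laplaceFourier u α * mobius (z + 2 * Real.pi * α - c) x := by
        have := (differentiable_laplaceFourier hu.continuous hs).continuous
        unfold mobius
        refine (by fun_prop : Continuous fun α : ℝ => laplaceFourier u α).mul
          (continuous_const.mul (Continuous.inv₀ (by fun_prop) fun α => ?_))
        exact one_sub_mul_ne_zero (by rw [him']; exact hz.ne') (hspec x hx)
      exact h.aestronglyMeasurable
    · exact continuousOn_const.mul (hcont _ (by rw [him']; exact hz.ne'))
  rw [← cfc_sub _ _ A (hcont _ hz') hci]
  refine norm_cfc_le (by positivity) fun x hx => ?_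
  by_cases hx0 : x = 0
  · simp only [hx0, mobius, zero_mul, mul_zero, integral_zero, sub_zero, norm_zero]
    positivity
  · have := norm_resolvent_sub_integral_le ha hu hs hu1 hu2 hz (x.re⁻¹ + c)
    rw [mobius_eq hz' (hspec x hx) hx0]
    have e2 : ∀ α : ℝ, mobius (z + 2 * Real.pi * α - c) x
        = ((x.re⁻¹ + c : ℝ) - (z + 2 * Real.pi * α))⁻¹ := by
      intro α
      rw [mobius_eq (by rw [him']; exact hz.ne') (hspec x hx) hx0]
      congr 1
      push_cast
      ring
    simp_rw [e2]
    have e3 : ((x.re⁻¹ : ℝ) : ℂ) - (z - c) = ((x.re⁻¹ + c : ℝ) : ℂ) - z := by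
      push_cast
      ring
    rw [e3]
    exact this

end Operator

/-! ### The regularized Born series -/

section Shift

variable {u : ℝ → ℂ} {r : ℝ}

/-- For `h` bounded and holomorphic in the upper half plane, the line over which the translates of
`h` are averaged may be moved up. -/
theorem integral_laplaceFourier_mul_shift (hu : ContDiff ℝ 2 u) (hs : ∀ t, r < |t| → u t = 0)
    (hr : 0 ≤ r) {h : ℂ → ℂ} {z : ℂ} {K : ℝ} (hd : ∀ w : ℂ, z.im ≤ w.im → DifferentiableAt ℂ h w)
    (hK : ∀ w : ℂ, z.im ≤ w.im → ‖h w‖ ≤ K) {β : ℝ} (hβ : 0 ≤ β) :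
    ∫ α : ℝ, laplaceFourier u α * h (z + 2 * Real.pi * α)
      = ∫ α : ℝ, laplaceFourier u (α + β * I) * h (z + 2 * Real.pi * (α + β * I)) := by
  obtain ⟨C, hC0, hC⟩ := exists_norm_laplaceFourier_le hu hs
  have him : ∀ w : ℂ, 0 ≤ w.im → z.im ≤ (z + 2 * Real.pi * w).im := by
    intro w hw
    have : (z + 2 * Real.pi * w).im = z.im + 2 * Real.pi * w.im := by simp
    rw [this]
    have := Real.pi_pos
    nlinarith [mul_nonneg this.le hw]
  refine integral_shift_line (k := fun w => laplaceFourier u w * h (z + 2 * Real.pi * w))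
    (C := C * Real.exp (2 * Real.pi * r * β) * K) hβ (fun w hw => ?_) fun w hw hw' => ?_
  · refine (differentiable_laplaceFourier hu.continuous hs w).mul ?_
    exact DifferentiableAt.comp (g := h) w (hd _ (him w hw)) (by fun_prop)
  · rw [norm_mul]
    refine (mul_le_mul (hC w) (hK _ (him w hw)) (norm_nonneg _) (by positivity)).trans ?_
    have h1 : Real.exp (2 * Real.pi * r * |w.im|) ≤ Real.exp (2 * Real.pi * r * β) := by
      rw [abs_of_nonneg hw]
      gcongr
    have hK0 : 0 ≤ K := (norm_nonneg _).trans (hK z le_rfl)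
    calc C * Real.exp (2 * Real.pi * r * |w.im|) * (1 + w.re ^ 2)⁻¹ * K
        ≤ C * Real.exp (2 * Real.pi * r * β) * (1 + w.re ^ 2)⁻¹ * K := by gcongr
      _ = _ := by ring

/-- An average over a line at height `β`, bounded by the supremum on that line. -/
theorem norm_integral_laplaceFourier_mul_le {C : ℝ} (hC0 : 0 ≤ C)
    (hC : ∀ w : ℂ, ‖laplaceFourier u w‖
      ≤ C * Real.exp (2 * Real.pi * r * |w.im|) * (1 + w.re ^ 2)⁻¹)
    {g : ℝ → ℂ} {K β : ℝ} (hβ : 0 ≤ β) (hg : ∀ α, ‖g α‖ ≤ K) :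
    ‖∫ α : ℝ, laplaceFourier u (α + β * I) * g α‖
      ≤ Real.pi * C * Real.exp (2 * Real.pi * r * β) * K := by
  have h1 : Real.pi * C * Real.exp (2 * Real.pi * r * β) * K
      = ∫ α : ℝ, C * Real.exp (2 * Real.pi * r * β) * K * (1 + α ^ 2)⁻¹ := by
    rw [integral_const_mul, integral_univ_inv_one_add_sq]
    ring
  rw [h1]
  refine norm_integral_le_of_norm_le (integrable_inv_one_add_sq.const_mul _)
    (.of_forall fun α => ?_)
  have := hC (α + β * I)
  rw [norm_mul]
  simp only [add_im, ofReal_im, mul_im, ofReal_re, I_im, mul_one, I_re, mul_zero, add_zero,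
    zero_add, add_re, mul_re, sub_self, abs_of_nonneg hβ] at this
  refine (mul_le_mul this (hg α) (norm_nonneg _) (by positivity)).trans (le_of_eq ?_)
  ring

theorem integrable_laplaceFourier_mul (hu : ContDiff ℝ 2 u) (hs : ∀ t, r < |t| → u t = 0)
    {g : ℝ → ℂ} (hg : Continuous g) {K : ℝ} (hK : ∀ α, ‖g α‖ ≤ K) :
    Integrable fun α : ℝ => laplaceFourier u α * g α :=
  (integrable_laplaceFourier hu hs).mul_bdd hg.aestronglyMeasurable (.of_forall hK)

end Shift

section Born

variable {X : Type*} [NormedAddCommGroup X] [InnerProductSpace ℂ X]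

/-- The term `R(z) [W R(z)]^n` of the Born series of `T + W`, with `R(z) = (T - z)⁻¹`. -/
def bornTerm (T : X →ₗ.[ℂ] X) (W : X →L[ℂ] X) (n : ℕ) (z : ℂ) : X →L[ℂ] X :=
  resolventOp T z * (W * resolventOp T z) ^ n

theorem bornTerm_zero (T : X →ₗ.[ℂ] X) (W : X →L[ℂ] X) : bornTerm T W 0 = resolventOp T := by
  funext z
  simp [bornTerm]

/-- The functional `A ↦ ⟨φ, A φ⟩`. -/
def expectation (φ : X) : (X →L[ℂ] X) →L[ℂ] ℂ :=
  (innerSL ℂ φ) ∘L (ContinuousLinearMap.apply ℂ X φ)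

theorem expectation_apply (φ : X) (A : X →L[ℂ] X) : expectation φ A = inner ℂ φ (A φ) := rfl

theorem norm_expectation_le {φ : X} (hφ : ‖φ‖ = 1) (A : X →L[ℂ] X) : ‖expectation φ A‖ ≤ ‖A‖ := by
  rw [expectation_apply]
  refine (norm_inner_le_norm _ _).trans ?_
  rw [hφ, one_mul]
  simpa [hφ] using A.le_opNorm φ

variable [CompleteSpace X] {T : X →ₗ.[ℂ] X} {W : X →L[ℂ] X}

theorem HasRealResolvent.norm_mul_pow_le (hT : HasRealResolvent T) {R : X →L[ℂ] X} {z : ℂ}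
    (hz : 0 < z.im) (hR : ‖R‖ ≤ z.im⁻¹) (n : ℕ) :
    ‖R * (W * resolventOp T z) ^ n‖ ≤ ‖W‖ ^ n * z.im⁻¹ ^ (n + 1) := by
  have h1 := hT.norm_resolventOp_le hz.ne'
  rw [abs_of_pos hz] at h1
  have h0 : ‖(W * resolventOp T z) ^ n‖ ≤ (‖W‖ * z.im⁻¹) ^ n := by
    rcases n.eq_zero_or_pos with rfl | hn
    · rw [pow_zero, pow_zero]
      exact ContinuousLinearMap.norm_id_le
    · refine (norm_pow_le' _ hn).trans (pow_le_pow_left₀ (norm_nonneg _) ?_ n)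
      exact (norm_mul_le _ _).trans (mul_le_mul_of_nonneg_left h1 (norm_nonneg _))
  calc ‖R * (W * resolventOp T z) ^ n‖ ≤ z.im⁻¹ * (‖W‖ * z.im⁻¹) ^ n :=
        (norm_mul_le _ _).trans (mul_le_mul hR h0 (norm_nonneg _) (by positivity))
    _ = _ := by rw [mul_pow, pow_succ]; ring

theorem HasRealResolvent.norm_bornTerm_le (hT : HasRealResolvent T) {z : ℂ}
    (hz : 0 < z.im) (n : ℕ) : ‖bornTerm T W n z‖ ≤ ‖W‖ ^ n * z.im⁻¹ ^ (n + 1) := by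
  refine hT.norm_mul_pow_le hz ?_ n
  simpa [abs_of_pos hz] using hT.norm_resolventOp_le hz.ne'

theorem HasRealResolvent.differentiableAt_bornTerm (hT : HasRealResolvent T) {z : ℂ}
    (hz : z.im ≠ 0) (n : ℕ) : DifferentiableAt ℂ (bornTerm T W n) z := by
  have h := (hT.hasDerivAt_resolventOp hz).differentiableAt
  exact h.mul (((differentiableAt_const W).mul h).pow n)

theorem HasRealResolvent.continuous_bornTerm (hT : HasRealResolvent T) {z : ℂ} (hz : z.im ≠ 0)
    (n : ℕ) : Continuous fun α : ℝ => bornTerm T W n (z + 2 * Real.pi * α) := by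
  refine continuous_iff_continuousAt.2 fun α => ?_
  refine ContinuousAt.comp (f := fun α : ℝ => (z + 2 * Real.pi * α : ℂ)) (g := bornTerm T W n)
    (hT.differentiableAt_bornTerm (by simpa using hz) n).continuousAt (by fun_prop)

/-- The resolvent of `T + W` is approximated by its regularized Born series: the first error comes
from the regularization, the second one is the remainder of the series, evaluated at height `β`. -/
theorem HasRealResolvent.norm_expectation_sub_sum_le (hT : HasRealResolvent T)
    (hH : HasRealResolvent (pert T W)) {φ : X} (hφ : ‖φ‖ = 1) {u : ℝ → ℂ} {r a : ℝ}
    (ha : 0 < a) (hr : 0 ≤ r) (hu : ContDiff ℝ 2 u) (hs : ∀ t, r < |t| → u t = 0)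
    (hu1 : ∀ t, ‖1 - u t‖ ≤ 1) (hu2 : ∀ t, |t| ≤ a⁻¹ → u t = 1)
    {C : ℝ} (hC0 : 0 ≤ C) (hC : ∀ w : ℂ, ‖laplaceFourier u w‖
      ≤ C * Real.exp (2 * Real.pi * r * |w.im|) * (1 + w.re ^ 2)⁻¹)
    {z : ℂ} (hz : 0 < z.im) (N : ℕ) {β : ℝ} (hβ : 0 < β) :
    ‖expectation φ (resolventOp (pert T W) z) - ∑ n ∈ Finset.range N,
        (-1) ^ n * ∫ α : ℝ, laplaceFourier u α *
          expectation φ (bornTerm T W n (z + 2 * Real.pi * α))‖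
      ≤ Real.exp (-(z.im / a)) / z.im
        + Real.pi * C * Real.exp (2 * Real.pi * r * β) * (‖W‖ ^ N * β⁻¹ ^ (N + 1)) := by
  have hpi := Real.pi_gt_three
  have him : ∀ α : ℝ, (z + 2 * Real.pi * α : ℂ).im = z.im := fun α => by simp
  set rem : ℂ → X →L[ℂ] X := fun w => resolventOp (pert T W) w * (W * resolventOp T w) ^ N with hrem
  have hremd : ∀ w : ℂ, z.im ≤ w.im → DifferentiableAt ℂ rem w := by
    intro w hw
    have hw0 : w.im ≠ 0 := (hz.trans_le hw).ne'
    have h := (hT.hasDerivAt_resolventOp hw0).differentiableAt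
    exact ((hH.hasDerivAt_resolventOp hw0).differentiableAt).mul
      (((differentiableAt_const W).mul h).pow N)
  have hremb : ∀ w : ℂ, 0 < w.im → ‖rem w‖ ≤ ‖W‖ ^ N * w.im⁻¹ ^ (N + 1) := by
    intro w hw
    refine hT.norm_mul_pow_le hw ?_ N
    simpa [abs_of_pos hw] using hH.norm_resolventOp_le hw.ne'
  have hremb' : ∀ w : ℂ, ∀ b, 0 < b → b ≤ w.im →
      ‖expectation φ (rem w)‖ ≤ ‖W‖ ^ N * b⁻¹ ^ (N + 1) := by
    intro w b hb hw
    refine (norm_expectation_le hφ _).trans ((hremb w (hb.trans_le hw)).trans ?_)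
    have : w.im⁻¹ ≤ b⁻¹ := inv_anti₀ hb hw
    have : 0 ≤ w.im⁻¹ := inv_nonneg.2 (hb.trans_le hw).le
    gcongr
  -- the regularized remainder, evaluated on the line at height `β`
  have h2 : ‖∫ α : ℝ, laplaceFourier u α * expectation φ (rem (z + 2 * Real.pi * α))‖
      ≤ Real.pi * C * Real.exp (2 * Real.pi * r * β) * (‖W‖ ^ N * β⁻¹ ^ (N + 1)) := by
    rw [integral_laplaceFourier_mul_shift hu hs hr (h := fun w => expectation φ (rem w))
      (fun w hw => (expectation φ).differentiableAt.comp w (hremd w hw))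
      (fun w hw => hremb' w z.im hz hw) hβ.le]
    refine norm_integral_laplaceFourier_mul_le hC0 hC hβ.le fun α => hremb' _ β hβ ?_
    have : (z + 2 * Real.pi * (α + β * I) : ℂ).im = z.im + 2 * Real.pi * β := by simp
    rw [this]
    nlinarith
  -- the error of the regularization
  have h1 : ‖expectation φ (resolventOp (pert T W) z) - ∫ α : ℝ, laplaceFourier u α *
      expectation φ (resolventOp (pert T W) (z + 2 * Real.pi * α))‖
      ≤ Real.exp (-(z.im / a)) / z.im := by
    have hcont : Continuous fun α : ℝ => resolventOp (pert T W) (z + 2 * Real.pi * α) := by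
      have := hH.continuous_bornTerm (W := W) hz.ne' 0
      rwa [bornTerm_zero] at this
    have hi : Integrable fun α : ℝ =>
        laplaceFourier u α • resolventOp (pert T W) (z + 2 * Real.pi * α) := by
      refine (integrable_laplaceFourier hu hs).smul_bdd |z.im|⁻¹
        hcont.aestronglyMeasurable (.of_forall fun α => ?_)
      have := hH.norm_resolventOp_le (z := z + 2 * Real.pi * α) (by rw [him]; exact hz.ne')
      rwa [him] at this
    have e := (expectation φ).integral_comp_comm hi
    simp only [map_smul, smul_eq_mul] at e
    rw [e, ← map_sub]
    exact (norm_expectation_le hφ _).trans (hH.norm_sub_integral_le ha hu hs hu1 hu2 hz)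
  have hint : ∀ n, Integrable fun α : ℝ => laplaceFourier u α *
      expectation φ (bornTerm T W n (z + 2 * Real.pi * α)) := by
    intro n
    refine integrable_laplaceFourier_mul hu hs ((expectation φ).continuous.comp
      (hT.continuous_bornTerm hz.ne' n)) (K := ‖W‖ ^ n * z.im⁻¹ ^ (n + 1)) fun α => ?_
    have := hT.norm_bornTerm_le (W := W) (z := z + 2 * Real.pi * α) (by rwa [him]) n
    rw [him] at this
    exact (norm_expectation_le hφ _).trans this
  have hintr : Integrable fun α : ℝ => laplaceFourier u α *
      expectation φ (rem (z + 2 * Real.pi * α)) := by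
    refine integrable_laplaceFourier_mul hu hs ?_
      (fun α => hremb' (z + 2 * Real.pi * α) z.im hz (him α).ge)
    refine continuous_iff_continuousAt.2 fun α => ?_
    refine (expectation φ).continuous.continuousAt.comp ?_
    exact ContinuousAt.comp (f := fun α : ℝ => (z + 2 * Real.pi * α : ℂ)) (g := rem)
      (hremd _ (him α).ge).continuousAt (by fun_prop)
  have e : ∫ α : ℝ, laplaceFourier u α *
      expectation φ (resolventOp (pert T W) (z + 2 * Real.pi * α))
      = (∑ n ∈ Finset.range N, (-1) ^ n * ∫ α : ℝ, laplaceFourier u α *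
          expectation φ (bornTerm T W n (z + 2 * Real.pi * α)))
        + (-1) ^ N * ∫ α : ℝ, laplaceFourier u α * expectation φ (rem (z + 2 * Real.pi * α)) := by
    simp_rw [← integral_const_mul]
    rw [← integral_finsetSum _ fun n _ => (hint n).const_mul _,
      ← integral_add (integrable_finsetSum _ fun n _ => (hint n).const_mul _)
        (hintr.const_mul _)]
    refine integral_congr_ae (.of_forall fun α => ?_)
    have hα : (z + 2 * Real.pi * α : ℂ).im ≠ 0 := by rw [him]; exact hz.ne'
    have h := (hH.isResolventAt hα).pert_eq_sum (hT.isResolventAt hα) N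
    simp only
    rw [h, map_add, map_sum, mul_add, Finset.mul_sum]
    simp only [map_smul, smul_eq_mul, hrem, bornTerm]
    congr 1
    · exact Finset.sum_congr rfl fun n _ => by ring
    · ring
  have h2' : ‖(-1) ^ N * ∫ α : ℝ, laplaceFourier u α *
      expectation φ (rem (z + 2 * Real.pi * α))‖
      ≤ Real.pi * C * Real.exp (2 * Real.pi * r * β) * (‖W‖ ^ N * β⁻¹ ^ (N + 1)) := by
    rwa [norm_mul, norm_pow, norm_neg, norm_one, one_pow, one_mul]
  have h3 := norm_add_le_of_le h1 h2'
  refine le_trans (le_of_eq ?_) h3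
  congr 1
  rw [e]
  ring

end Born

/-! ### Averages of words in independent random operators -/

theorem stronglyMeasurable_clm_apply {X Ω : Type*} [NormedAddCommGroup X] [NormedSpace ℂ X]
    [SecondCountableTopology X] [MeasurableSpace Ω] {W : Ω → X →L[ℂ] X}
    (hW : ∀ f, StronglyMeasurable fun ω => W ω f) {ψ : Ω → X} (hψ : StronglyMeasurable ψ) :
    StronglyMeasurable fun ω => W ω (ψ ω) := by
  borelize X
  have h := stronglyMeasurable_uncurry_of_continuous_of_stronglyMeasurable
    (u := fun (f : X) (ω : Ω) => W ω f) (fun ω => (W ω).continuous) hW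
  exact h.comp_measurable (hψ.measurable.prodMk measurable_id)

theorem sq_integral_le_integral_sq {Ω : Type*} [MeasurableSpace Ω] {P : Measure Ω}
    [IsProbabilityMeasure P] {p : Ω → ℝ} (hp : Integrable p P) (hp2 : Integrable (fun ω => p ω ^ 2) P) :
    (∫ ω, p ω ∂P) ^ 2 ≤ ∫ ω, p ω ^ 2 ∂P := by
  set m := ∫ ω, p ω ∂P with hm
  have h0 : 0 ≤ ∫ ω, (p ω - m) ^ 2 ∂P := integral_nonneg fun ω => sq_nonneg _
  have h1 : ∫ ω, (p ω - m) ^ 2 ∂P = (∫ ω, p ω ^ 2 ∂P) - m ^ 2 := by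
    have : ∀ ω, (p ω - m) ^ 2 = (p ω ^ 2 - 2 * m * p ω) + m ^ 2 := fun ω => by ring
    simp_rw [this]
    rw [integral_add (f := fun ω => p ω ^ 2 - 2 * m * p ω) (hp2.sub (hp.const_mul _))
      (integrable_const _), integral_sub hp2 (hp.const_mul _), integral_const_mul, ← hm]
    simp
    ring
  linarith

theorem measurePreserving_update {ι S : Type*} [Fintype ι] [DecidableEq ι] [MeasurableSpace S]
    (ν : Measure S) [IsProbabilityMeasure ν] (i : ι) :
    MeasurePreserving (fun p : (ι → S) × S => Function.update p.1 i p.2)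
      ((Measure.pi fun _ : ι => ν).prod ν) (Measure.pi fun _ : ι => ν) := by
  have hm : Measurable (fun p : (ι → S) × S => Function.update p.1 i p.2) := by
    refine measurable_pi_lambda _ fun j => ?_
    by_cases h : j = i
    · subst h
      simpa using measurable_snd
    · simp only [Function.update_of_ne h]
      exact (measurable_pi_apply j).comp measurable_fst
  refine ⟨hm, (Measure.pi_eq fun A hA => ?_).symm⟩
  rw [Measure.map_apply hm (MeasurableSet.univ_pi hA)]
  have : (fun p : (ι → S) × S => Function.update p.1 i p.2) ⁻¹' Set.univ.pi A
      = (Set.univ.pi (Function.update A i Set.univ)) ×ˢ A i := by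
    ext p
    simp only [Set.mem_preimage, Set.mem_pi, Set.mem_univ, true_imp_iff, Set.mem_prod]
    constructor
    · intro h
      refine ⟨fun j => ?_, by simpa using h i⟩
      by_cases hj : j = i
      · subst hj
        simp
      · simpa [Function.update_of_ne hj] using h j
    · rintro ⟨h1, h2⟩ j
      by_cases hj : j = i
      · subst hj
        simpa using h2
      · simpa [Function.update_of_ne hj] using h1 j
  rw [this, Measure.prod_prod, Measure.pi_pi, ← Finset.mul_prod_erase _ _ (Finset.mem_univ i),
    ← Finset.mul_prod_erase _ (fun j => ν (A j)) (Finset.mem_univ i), Function.update_self,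
    measure_univ, one_mul, mul_comm]
  congr 1
  exact Finset.prod_congr rfl fun j hj => by rw [Function.update_of_ne (Finset.ne_of_mem_erase hj)]

set_option linter.unusedSectionVars false

section Word

variable {X : Type*} [NormedAddCommGroup X] [InnerProductSpace ℂ X]

/-- A family of symmetric operators `b s`, with `s` distributed according to `ν`, which is bounded
by `β` and whose averages carry a factor `x`: in the mean square `b s` is of order `√x β`, and in
the mean it is of order `x β`. This is how the multiplication by a fixed profile, centred at a
uniformly distributed point of a box of volume `x⁻¹`, behaves. -/
structure IsSparse {S : Type*} [MeasurableSpace S] (ν : Measure S) (b : S → X →L[ℂ] X)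
    (x β : ℝ) : Prop where
  x_pos : 0 < x
  β_pos : 0 < β
  measurable : ∀ f, StronglyMeasurable fun s => b s f
  symm : ∀ s f g, inner ℂ (b s f) g = inner ℂ f (b s g)
  norm_le : ∀ s, ‖b s‖ ≤ β
  sq_le : ∀ f, ∫ s, ‖b s f‖ ^ 2 ∂ν ≤ x * β ^ 2 * ‖f‖ ^ 2
  mean_le : ∀ f g, ∫ s, ‖inner ℂ f (b s g)‖ ∂ν ≤ x * β * ‖f‖ * ‖g‖

/-- Bounded strongly measurable functions. -/
structure IsBddMeas {Ω : Type*} [MeasurableSpace Ω] {E : Type*} [NormedAddCommGroup E]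
    (θ : Ω → E) : Prop where
  meas : StronglyMeasurable θ
  bdd : ∃ K, ∀ ω, ‖θ ω‖ ≤ K

section

variable {Ω : Type*} [MeasurableSpace Ω] {E : Type*} [NormedAddCommGroup E] {θ : Ω → E}

theorem IsBddMeas.integrable (h : IsBddMeas θ) (P : Measure Ω) [IsFiniteMeasure P] :
    Integrable θ P := by
  obtain ⟨K, hK⟩ := h.bdd
  exact Integrable.of_bound h.meas.aestronglyMeasurable K (.of_forall hK)

theorem IsBddMeas.norm_sq (h : IsBddMeas θ) : IsBddMeas fun ω => ‖θ ω‖ ^ 2 := by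
  obtain ⟨K, hK⟩ := h.bdd
  refine ⟨h.meas.norm.pow 2, K ^ 2, fun ω => ?_⟩
  rw [norm_pow, norm_norm]
  exact pow_le_pow_left₀ (norm_nonneg _) (hK ω) 2

theorem IsBddMeas.norm (h : IsBddMeas θ) : IsBddMeas fun ω => ‖θ ω‖ := by
  obtain ⟨K, hK⟩ := h.bdd
  exact ⟨h.meas.norm, K, fun ω => by simpa using hK ω⟩

theorem IsBddMeas.comp (h : IsBddMeas θ) {Ω' : Type*} [MeasurableSpace Ω'] {g : Ω' → Ω}
    (hg : Measurable g) : IsBddMeas fun ω => θ (g ω) :=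
  ⟨h.meas.comp_measurable hg, h.bdd.imp fun _ hK ω => hK (g ω)⟩

theorem IsBddMeas.inner {θ ψ : Ω → X} (h : IsBddMeas θ) (h' : IsBddMeas ψ) :
    IsBddMeas fun ω => inner ℂ (θ ω) (ψ ω) := by
  obtain ⟨K, hK⟩ := h.bdd
  obtain ⟨K', hK'⟩ := h'.bdd
  refine ⟨h.meas.inner h'.meas, K * K', fun ω => (norm_inner_le_norm _ _).trans ?_⟩
  exact mul_le_mul (hK ω) (hK' ω) (norm_nonneg _) ((norm_nonneg _).trans (hK ω))

theorem IsBddMeas.clm (A : X →L[ℂ] X) {θ : Ω → X} (h : IsBddMeas θ) :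
    IsBddMeas fun ω => A (θ ω) := by
  obtain ⟨K, hK⟩ := h.bdd
  refine ⟨A.continuous.comp_stronglyMeasurable h.meas, ‖A‖ * K, fun ω => ?_⟩
  exact (A.le_opNorm _).trans (mul_le_mul_of_nonneg_left (hK ω) (norm_nonneg _))

end

variable {S : Type*} [MeasurableSpace S] {ν : Measure S} {b : S → X →L[ℂ] X} {x β : ℝ}

theorem IsSparse.isBddMeas [SecondCountableTopology X] (hb : IsSparse ν b x β) {Ω : Type*}
    [MeasurableSpace Ω] {t : Ω → S} (ht : Measurable t) {θ : Ω → X} (h : IsBddMeas θ) :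
    IsBddMeas fun ω => b (t ω) (θ ω) := by
  obtain ⟨K, hK⟩ := h.bdd
  refine ⟨stronglyMeasurable_clm_apply (fun f => (hb.measurable f).comp_measurable ht) h.meas,
    β * K, fun ω => ((b (t ω)).le_opNorm _).trans ?_⟩
  exact mul_le_mul (hb.norm_le _) (hK ω) (norm_nonneg _) hb.β_pos.le

variable [CompleteSpace X] [SecondCountableTopology X] [IsProbabilityMeasure ν]

theorem IsSparse.norm_sq_integral_le (hb : IsSparse ν b x β) {g : S → X} (hg : IsBddMeas g) :
    ‖∫ s, b s (g s) ∂ν‖ ^ 2 ≤ x * β ^ 2 * ∫ s, ‖g s‖ ^ 2 ∂ν := by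
  have hβ := hb.β_pos
  have hx := hb.x_pos
  set F := ∫ s, b s (g s) ∂ν with hF
  have hbg : IsBddMeas fun s => b s (g s) := hb.isBddMeas measurable_id hg
  have hbF : IsBddMeas fun s => b s F :=
    hb.isBddMeas measurable_id ⟨stronglyMeasurable_const, ‖F‖, fun _ => le_rfl⟩
  set τ := (x * β ^ 2)⁻¹ with hτ
  have hτ0 : 0 < τ := by positivity
  have h1 : ‖F‖ ^ 2 = ‖∫ s, inner ℂ F (b s (g s)) ∂ν‖ := by
    rw [integral_inner (hbg.integrable ν), ← hF, inner_self_eq_norm_sq_to_K]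
    simp
  have h2 : ‖∫ s, inner ℂ F (b s (g s)) ∂ν‖
      ≤ ∫ s, (τ / 2 * ‖b s F‖ ^ 2 + τ⁻¹ / 2 * ‖g s‖ ^ 2) ∂ν := by
    refine norm_integral_le_of_norm_le (((hbF.norm_sq.integrable ν).const_mul _).add
      ((hg.norm_sq.integrable ν).const_mul _)) (.of_forall fun s => ?_)
    rw [← hb.symm]
    refine (norm_inner_le_norm _ _).trans ?_
    have h3 : 0 ≤ (τ * ‖b s F‖ - ‖g s‖) ^ 2 * τ⁻¹ := by positivity
    have h4 : (τ * ‖b s F‖ - ‖g s‖) ^ 2 * τ⁻¹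
        = τ * ‖b s F‖ ^ 2 + τ⁻¹ * ‖g s‖ ^ 2 - 2 * (‖b s F‖ * ‖g s‖) := by
      field_simp
      ring
    linarith
  rw [integral_add ((hbF.norm_sq.integrable ν).const_mul _)
    ((hg.norm_sq.integrable ν).const_mul _), integral_const_mul, integral_const_mul] at h2
  have h5 : τ / 2 * ∫ s, ‖b s F‖ ^ 2 ∂ν ≤ ‖F‖ ^ 2 / 2 := by
    refine (mul_le_mul_of_nonneg_left (hb.sq_le F) (by positivity)).trans (le_of_eq ?_)
    rw [hτ]
    field_simp
  have h6 : τ⁻¹ = x * β ^ 2 := by rw [hτ, inv_inv]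
  rw [h6] at h2
  linarith

theorem IsSparse.norm_integral_const_le (hb : IsSparse ν b x β) (g : X) :
    ‖∫ s, b s g ∂ν‖ ≤ x * β * ‖g‖ := by
  set F := ∫ s, b s g ∂ν with hF
  have hbg : IsBddMeas fun s => b s g :=
    hb.isBddMeas measurable_id ⟨stronglyMeasurable_const, ‖g‖, fun _ => le_rfl⟩
  have h1 : ‖F‖ * ‖F‖ ≤ ‖F‖ * (x * β * ‖g‖) := by
    have : ‖F‖ * ‖F‖ = ‖∫ s, inner ℂ F (b s g) ∂ν‖ := by
      rw [integral_inner (hbg.integrable ν), ← hF, inner_self_eq_norm_sq_to_K]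
      simp [pow_two]
    rw [this]
    refine (norm_integral_le_integral_norm _).trans ((hb.mean_le F g).trans (le_of_eq ?_))
    ring
  rcases (norm_nonneg F).eq_or_lt with h0 | h0
  · rw [← h0]
    have := hb.β_pos
    have := hb.x_pos
    positivity
  · exact le_of_mul_le_mul_left h1 h0

variable {ι : Type*} [Fintype ι] [DecidableEq ι]

local notation "π" => Measure.pi fun _ : ι => ν

theorem integral_eq_integral_update {E : Type*} [NormedAddCommGroup E] [NormedSpace ℝ E]
    [CompleteSpace E] (i : ι) {F : (ι → S) → E} (hF : IsBddMeas F) :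
    ∫ y, F y ∂π = ∫ y, ∫ s, F (Function.update y i s) ∂ν ∂π := by
  have h := measurePreserving_update (ι := ι) ν i
  have h1 : ∫ y, F y ∂π = ∫ p, F (Function.update p.1 i p.2) ∂((π).prod ν) := by
    conv_lhs => rw [← h.map_eq]
    exact integral_map h.measurable.aemeasurable hF.meas.aestronglyMeasurable
  rw [h1, integral_prod]
  exact (hF.comp h.measurable).integrable _

/-- The function `θ` on the product space does not depend on the `i`-th coordinate. -/
def IndepOf {E : Type*} (θ : (ι → S) → E) (i : ι) : Prop :=
  ∀ y s, θ (Function.update y i s) = θ y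

theorem measurable_update_const (i : ι) (y : ι → S) :
    Measurable fun s : S => Function.update y i s :=
  measurable_update y

theorem IsSparse.integral_norm_sq_le (hb : IsSparse ν b x β) (i : ι) {θ : (ι → S) → X}
    (hθ : IsBddMeas θ) : ∫ y, ‖b (y i) (θ y)‖ ^ 2 ∂π ≤ β ^ 2 * ∫ y, ‖θ y‖ ^ 2 ∂π := by
  rw [← integral_const_mul]
  refine integral_mono ((hb.isBddMeas (measurable_pi_apply i) hθ).norm_sq.integrable _)
    ((hθ.norm_sq.integrable _).const_mul _) fun y => ?_
  simp only
  rw [← mul_pow]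
  refine pow_le_pow_left₀ (norm_nonneg _) (((b (y i)).le_opNorm _).trans ?_) 2
  exact mul_le_mul_of_nonneg_right (hb.norm_le _) (norm_nonneg _)

theorem IsSparse.integral_norm_sq_le_of_indep (hb : IsSparse ν b x β) {i : ι} {θ : (ι → S) → X}
    (hθ : IsBddMeas θ) (hi : IndepOf θ i) :
    ∫ y, ‖b (y i) (θ y)‖ ^ 2 ∂π ≤ x * β ^ 2 * ∫ y, ‖θ y‖ ^ 2 ∂π := by
  have h1 := (hb.isBddMeas (measurable_pi_apply i) hθ).norm_sq
  rw [integral_eq_integral_update i h1, ← integral_const_mul]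
  simp only [Function.update_self]
  refine integral_mono_of_nonneg (.of_forall fun y => integral_nonneg fun s => by positivity)
    ((hθ.norm_sq.integrable _).const_mul _) (.of_forall fun y => ?_)
  simp only
  simp_rw [hi y]
  exact hb.sq_le (θ y)

/-- The average of `b (y i) (θ y)` over `y i`. -/
def partialMean (ν : Measure S) (b : S → X →L[ℂ] X) (i : ι) (θ : (ι → S) → X) (y : ι → S) : X :=
  ∫ s, b s (θ (Function.update y i s)) ∂ν

theorem IsSparse.isBddMeas_partialMean (hb : IsSparse ν b x β) (i : ι) {θ : (ι → S) → X}
    (hθ : IsBddMeas θ) : IsBddMeas (partialMean ν b i θ) := by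
  have h := hb.isBddMeas (Ω := (ι → S) × S) measurable_snd
    (hθ.comp (measurePreserving_update ν i).measurable)
  obtain ⟨K, hK⟩ := h.bdd
  refine ⟨h.meas.integral_prod_right', K, fun y => ?_⟩
  have := norm_integral_le_of_norm_le_const (μ := ν) (f := fun s => b s (θ (Function.update y i s)))
    (C := K) (.of_forall fun s => hK (y, s))
  simpa [partialMean] using this

theorem IsSparse.integral_norm_sq_partialMean_le (hb : IsSparse ν b x β) (i : ι)
    {θ : (ι → S) → X} (hθ : IsBddMeas θ) :
    ∫ y, ‖partialMean ν b i θ y‖ ^ 2 ∂π ≤ x * β ^ 2 * ∫ y, ‖θ y‖ ^ 2 ∂π := by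
  rw [integral_eq_integral_update i hθ.norm_sq, ← integral_const_mul]
  refine integral_mono_of_nonneg (.of_forall fun y => by positivity) ?_ (.of_forall fun y => ?_)
  · refine Integrable.const_mul ?_ _
    exact ((hθ.norm_sq.comp (measurePreserving_update ν i).measurable).integrable
      ((π).prod ν)).integral_prod_left
  · exact hb.norm_sq_integral_le (hθ.comp (measurable_update_const i y))

theorem IsSparse.integral_norm_sq_partialMean_le_of_indep (hb : IsSparse ν b x β) {i : ι}
    {θ : (ι → S) → X} (hθ : IsBddMeas θ) (hi : IndepOf θ i) :
    ∫ y, ‖partialMean ν b i θ y‖ ^ 2 ∂π ≤ x ^ 2 * β ^ 2 * ∫ y, ‖θ y‖ ^ 2 ∂π := by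
  rw [← integral_const_mul]
  refine integral_mono_of_nonneg (.of_forall fun y => by positivity)
    ((hθ.norm_sq.integrable _).const_mul _) (.of_forall fun y => ?_)
  simp only [partialMean]
  simp_rw [hi y]
  rw [← mul_pow, ← mul_pow]
  exact pow_le_pow_left₀ (norm_nonneg _) (hb.norm_integral_const_le (θ y)) 2

theorem IsSparse.integral_inner_eq_partialMean (hb : IsSparse ν b x β) {i : ι}
    {θ ψ : (ι → S) → X} (hθ : IsBddMeas θ) (hψ : IsBddMeas ψ) (hi : IndepOf ψ i) :
    ∫ y, inner ℂ (b (y i) (θ y)) (ψ y) ∂π = ∫ y, inner ℂ (partialMean ν b i θ y) (ψ y) ∂π := by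
  have h1 := hb.isBddMeas (measurable_pi_apply i) hθ
  rw [integral_eq_integral_update i (h1.inner hψ)]
  refine integral_congr_ae (.of_forall fun y => ?_)
  simp only [Function.update_self]
  simp_rw [hi y]
  have h2 := hb.isBddMeas measurable_id (hθ.comp (measurable_update_const i y))
  rw [← inner_conj_symm, partialMean]
  simp only [id] at h2
  rw [← integral_inner (h2.integrable ν), ← integral_conj]
  exact integral_congr_ae (.of_forall fun s => (inner_conj_symm _ _).symm)

/-- The vector `R b(y_{i₁}) R b(y_{i₂}) R ⋯ R φ` of the word `i₁ i₂ …`. -/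
def wordVec (b : S → X →L[ℂ] X) (R : X →L[ℂ] X) (φ : X) (y : ι → S) : List ι → X
  | [] => R φ
  | i :: w => R (b (y i) (wordVec b R φ y w))

theorem IsSparse.isBddMeas_wordVec (hb : IsSparse ν b x β) (R : X →L[ℂ] X) (φ : X) (w : List ι) :
    IsBddMeas fun y => wordVec b R φ y w := by
  induction w with
  | nil => exact ⟨stronglyMeasurable_const, ‖R φ‖, fun _ => le_rfl⟩
  | cons i w ih => exact (hb.isBddMeas (measurable_pi_apply i) ih).clm R

theorem indepOf_wordVec (b : S → X →L[ℂ] X) (R : X →L[ℂ] X) (φ : X) {w : List ι} {i : ι}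
    (hi : i ∉ w) : IndepOf (fun y : ι → S => wordVec b R φ y w) i := by
  induction w with
  | nil => exact fun y s => rfl
  | cons j w ih =>
    rw [List.mem_cons, not_or] at hi
    intro y s
    simp only [wordVec]
    rw [Function.update_of_ne (Ne.symm hi.1)]
    exact congrArg _ (congrArg _ (ih hi.2 y s))

theorem indepOf_apply (b : S → X →L[ℂ] X) (i : ι) {θ : (ι → S) → X} {j : ι}
    (hj : IndepOf θ j) (hij : i ≠ j) : IndepOf (fun y => b (y i) (θ y)) j := by
  intro y s
  simp only
  rw [Function.update_of_ne hij, hj y s]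

theorem indepOf_partialMean (b : S → X →L[ℂ] X) (i : ι) {θ : (ι → S) → X} {j : ι}
    (hj : IndepOf θ j ∨ j = i) : IndepOf (partialMean ν b i θ) j := by
  intro y s
  simp only [partialMean]
  refine integral_congr_ae (.of_forall fun t => ?_)
  simp only
  by_cases hji : j = i
  · subst hji
    rw [Function.update_idem]
  · rw [Function.update_comm hji, (hj.resolve_right hji) _ s]

/-- The form of `norm_integral_inner_wordVec_le` which is proved by induction on the word. Testing
against functions `θ` which do not depend on the coordinates in `s` amounts to averaging over these
coordinates; each letter gains `√x` at its first and at its last occurrence. -/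
theorem IsSparse.norm_sq_integral_inner_wordVec_le (hb : IsSparse ν b x β) (R : X →L[ℂ] X)
    {ρ : ℝ} (hR : ‖R‖ ≤ ρ) (φ : X) (w : List ι) :
    ∀ (s : Finset ι) (θ : (ι → S) → X), IsBddMeas θ → (∀ i ∈ s, IndepOf θ i) →
      ‖∫ y, inner ℂ (θ y) (wordVec b R φ y w) ∂π‖ ^ 2
        ≤ (β ^ 2 * ρ ^ 2) ^ w.length * (ρ ^ 2 * ‖φ‖ ^ 2)
          * x ^ (w.toFinset.card + (w.toFinset ∩ s).card) * ∫ y, ‖θ y‖ ^ 2 ∂π := by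
  have hx := hb.x_pos
  have hβ := hb.β_pos
  have hρ : 0 ≤ ρ := (norm_nonneg _).trans hR
  induction w with
  | nil =>
    intro s θ hθ _
    simp only [wordVec, List.length_nil, pow_zero, one_mul, List.toFinset_nil, Finset.card_empty,
      Finset.empty_inter, add_zero, mul_one]
    have h1 : ‖∫ y, inner ℂ (θ y) (R φ) ∂π‖ ≤ (∫ y, ‖θ y‖ ∂π) * (ρ * ‖φ‖) := by
      rw [← integral_mul_const]
      refine norm_integral_le_of_norm_le ((hθ.norm.integrable _).mul_const _)
        (.of_forall fun y => (norm_inner_le_norm _ _).trans ?_)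
      refine mul_le_mul_of_nonneg_left ((R.le_opNorm _).trans ?_) (norm_nonneg _)
      exact mul_le_mul_of_nonneg_right hR (norm_nonneg _)
    refine (pow_le_pow_left₀ (norm_nonneg _) h1 2).trans ?_
    rw [mul_pow, mul_pow, mul_comm]
    exact mul_le_mul_of_nonneg_left
      (sq_integral_le_integral_sq (hθ.norm.integrable _) (hθ.norm_sq.integrable _)) (by positivity)
  | cons i w ih =>
    intro s θ hθ hs
    set θ₁ : (ι → S) → X := fun y => ContinuousLinearMap.adjoint R (θ y) with hθ₁
    have hm₁ : IsBddMeas θ₁ := hθ.clm _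
    have hs₁ : ∀ j ∈ s, IndepOf θ₁ j := fun j hj y t => by simp only [hθ₁, hs j hj y t]
    have hn₁ : ∫ y, ‖θ₁ y‖ ^ 2 ∂π ≤ ρ ^ 2 * ∫ y, ‖θ y‖ ^ 2 ∂π := by
      rw [← integral_const_mul]
      refine integral_mono (hm₁.norm_sq.integrable _) ((hθ.norm_sq.integrable _).const_mul _)
        fun y => ?_
      simp only
      rw [← mul_pow]
      refine pow_le_pow_left₀ (norm_nonneg _) ((ContinuousLinearMap.le_opNorm _ _).trans ?_) 2
      rw [LinearIsometryEquiv.norm_map]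
      exact mul_le_mul_of_nonneg_right hR (norm_nonneg _)
    have e : ∀ y : ι → S, inner ℂ (θ y) (wordVec b R φ y (i :: w))
        = inner ℂ (b (y i) (θ₁ y)) (wordVec b R φ y w) := by
      intro y
      rw [wordVec, hb.symm, hθ₁, ContinuousLinearMap.adjoint_inner_left]
    simp_rw [e]
    -- reduction to a test function for the shorter word
    have key : ∀ (θ₂ : (ι → S) → X) (t : Finset ι) (m : ℕ), IsBddMeas θ₂ →
        (∀ j ∈ t, IndepOf θ₂ j) →
        ∫ y, inner ℂ (b (y i) (θ₁ y)) (wordVec b R φ y w) ∂π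
          = ∫ y, inner ℂ (θ₂ y) (wordVec b R φ y w) ∂π →
        ∫ y, ‖θ₂ y‖ ^ 2 ∂π ≤ x ^ m * β ^ 2 * ∫ y, ‖θ₁ y‖ ^ 2 ∂π →
        (i :: w).toFinset.card + ((i :: w).toFinset ∩ s).card
          = w.toFinset.card + (w.toFinset ∩ t).card + m →
        ‖∫ y, inner ℂ (b (y i) (θ₁ y)) (wordVec b R φ y w) ∂π‖ ^ 2
        ≤ (β ^ 2 * ρ ^ 2) ^ (i :: w).length * (ρ ^ 2 * ‖φ‖ ^ 2)
          * x ^ ((i :: w).toFinset.card + ((i :: w).toFinset ∩ s).card)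
          * ∫ y, ‖θ y‖ ^ 2 ∂π := by
      intro θ₂ t m hm₂ ht he hn hcard
      rw [he, hcard, List.length_cons, pow_succ, pow_add x]
      refine (ih t θ₂ hm₂ ht).trans ?_
      calc _ ≤ (β ^ 2 * ρ ^ 2) ^ w.length * (ρ ^ 2 * ‖φ‖ ^ 2)
            * x ^ (w.toFinset.card + (w.toFinset ∩ t).card)
            * (x ^ m * β ^ 2 * (ρ ^ 2 * ∫ y, ‖θ y‖ ^ 2 ∂π)) := by
            refine mul_le_mul_of_nonneg_left (hn.trans ?_) (by positivity)
            exact mul_le_mul_of_nonneg_left hn₁ (by positivity)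
        _ = _ := by ring
    by_cases hiw : i ∈ w
    · have hF : (i :: w).toFinset = w.toFinset := by
        rw [List.toFinset_cons, Finset.insert_eq_self, List.mem_toFinset]
        exact hiw
      have hm₂ := hb.isBddMeas (measurable_pi_apply i) hm₁
      by_cases his : i ∈ s
      · refine key _ (s.erase i) 1 hm₂ (fun j hj => ?_) rfl ?_ ?_
        · rw [Finset.mem_erase] at hj
          exact indepOf_apply b i (hs₁ j hj.2) hj.1.symm
        · rw [pow_one]
          exact hb.integral_norm_sq_le_of_indep hm₁ (hs₁ i his)
        · rw [hF, Finset.inter_erase, add_assoc, Finset.card_erase_add_one]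
          exact Finset.mem_inter.2 ⟨List.mem_toFinset.2 hiw, his⟩
      · refine key _ s 0 hm₂ (fun j hj => ?_) rfl ?_ (by rw [hF, add_zero])
        · exact indepOf_apply b i (hs₁ j hj) (fun h => his (h ▸ hj))
        · rw [pow_zero, one_mul]
          exact hb.integral_norm_sq_le i hm₁
    · have hiF : i ∉ w.toFinset := by rwa [List.mem_toFinset]
      have hm₂ := hb.isBddMeas_partialMean i hm₁
      have he := hb.integral_inner_eq_partialMean hm₁ (hb.isBddMeas_wordVec R φ w)
        (indepOf_wordVec b R φ hiw)
      have hc : (i :: w).toFinset.card = w.toFinset.card + 1 := by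
        rw [List.toFinset_cons, Finset.card_insert_of_notMem hiF]
      by_cases his : i ∈ s
      · refine key _ s 2 hm₂ (fun j hj => indepOf_partialMean b i (.inl (hs₁ j hj))) he
          (hb.integral_norm_sq_partialMean_le_of_indep hm₁ (hs₁ i his)) ?_
        rw [hc, List.toFinset_cons, Finset.insert_inter_of_mem his, Finset.card_insert_of_notMem
          (fun h => hiF (Finset.mem_inter.1 h).1)]
        ring
      · refine key _ s 1 hm₂ (fun j hj => indepOf_partialMean b i (.inl (hs₁ j hj))) he ?_ ?_
        · rw [pow_one]
          exact hb.integral_norm_sq_partialMean_le i hm₁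
        · rw [hc, List.toFinset_cons, Finset.insert_inter_of_notMem his]
          ring

/-- The average of a word in independent sparse operators carries a factor `x` for each of its
distinct letters. -/
theorem IsSparse.norm_integral_inner_wordVec_le (hb : IsSparse ν b x β) (R : X →L[ℂ] X)
    {ρ : ℝ} (hR : ‖R‖ ≤ ρ) {φ : X} (hφ : ‖φ‖ = 1) (w : List ι) :
    ‖∫ y, inner ℂ φ (wordVec b R φ y w) ∂π‖
      ≤ ρ ^ (w.length + 1) * β ^ w.length * x ^ w.toFinset.card := by
  have hx := hb.x_pos
  have hβ := hb.β_pos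
  have hρ : 0 ≤ ρ := (norm_nonneg _).trans hR
  have h := hb.norm_sq_integral_inner_wordVec_le R hR φ w Finset.univ (fun _ => φ)
    ⟨stronglyMeasurable_const, ‖φ‖, fun _ => le_rfl⟩ fun i _ y s => rfl
  refine abs_le_of_sq_le_sq' ?_ (by positivity) |>.2
  refine h.trans (le_of_eq ?_)
  simp [hφ]
  ring

end Word

/-! ### Counting words by their number of distinct letters -/

section Counting

open Finset

variable {ι : Type*} [Fintype ι] [DecidableEq ι]

/-- If every element of `ι` is kept with probability `x`, all elements of `F` are kept with
probability `x ^ #F`. -/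
theorem pow_card_eq_sum_powerset (x : ℝ) (F : Finset ι) :
    x ^ F.card = ∑ s : Finset ι, if F ⊆ s then x ^ s.card * (1 - x) ^ (Fintype.card ι - s.card)
      else 0 := by
  have h := Finset.prod_add (fun _ : ι => x) (fun i => if i ∈ F then 0 else 1 - x) univ
  have h1 : ∏ i, (x + if i ∈ F then 0 else 1 - x) = x ^ F.card := by
    have : ∀ i, (x + if i ∈ F then 0 else 1 - x) = if i ∈ F then x else 1 := by
      intro i
      split_ifs <;> ring
    simp_rw [this]
    rw [Finset.prod_ite_mem, Finset.univ_inter, Finset.prod_const]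
  rw [← h1, h, Finset.powerset_univ]
  refine Finset.sum_congr rfl fun s _ => ?_
  rw [Finset.prod_const]
  split_ifs with hs
  · congr 1
    rw [← Finset.card_compl, ← Finset.compl_eq_univ_sdiff, ← Finset.prod_const]
    refine Finset.prod_congr rfl fun i hi => if_neg fun hiF => ?_
    exact (Finset.mem_compl.1 hi) (hs hiF)
  · obtain ⟨i, hiF, his⟩ := Finset.not_subset.1 hs
    have h2 : ∏ i ∈ univ \ s, (if i ∈ F then 0 else 1 - x) = 0 :=
      Finset.prod_eq_zero (i := i) (by simpa using his) (if_pos hiF)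
    rw [h2, mul_zero]

/-- The exponential moment bound for `∑ x ^ #(image of γ)`, which is the `n`-th moment of a
binomial variable with `#ι` trials and success probability `x`. -/
theorem sum_pow_card_image_le {x t : ℝ} (hx0 : 0 ≤ x) (hx1 : x ≤ 1) (ht : 0 < t) (n : ℕ) :
    ∑ γ : Fin n → ι, x ^ (univ.image γ).card
      ≤ n.factorial * t⁻¹ ^ n * (1 + x * (Real.exp t - 1)) ^ Fintype.card ι := by
  have h0 : 0 ≤ 1 - x := by linarith
  have h1 : ∀ s : Finset ι, ∑ γ : Fin n → ι, (if univ.image γ ⊆ s then (1 : ℝ) else 0)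
      = (s.card : ℝ) ^ n := by
    intro s
    have : (s.card : ℝ) = ∑ i, if i ∈ s then (1 : ℝ) else 0 := by simp
    rw [this, Fintype.sum_pow]
    refine Finset.sum_congr rfl fun γ _ => ?_
    by_cases h : ∀ j, γ j ∈ s
    · rw [if_pos (by simpa [Finset.image_subset_iff] using h)]
      exact (Finset.prod_eq_one fun j _ => if_pos (h j)).symm
    · obtain ⟨j, hj⟩ := not_forall.1 h
      rw [if_neg (fun h2 => hj (h2 (Finset.mem_image_of_mem γ (Finset.mem_univ j)))),
        Finset.prod_eq_zero (Finset.mem_univ j) (if_neg hj)]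
  calc ∑ γ : Fin n → ι, x ^ (univ.image γ).card
      = ∑ s : Finset ι, x ^ s.card * (1 - x) ^ (Fintype.card ι - s.card) * (s.card : ℝ) ^ n := by
        simp_rw [pow_card_eq_sum_powerset x (univ.image _), ← h1, Finset.mul_sum]
        rw [Finset.sum_comm]
        refine Finset.sum_congr rfl fun s _ => Finset.sum_congr rfl fun γ _ => ?_
        split_ifs <;> simp
    _ ≤ ∑ s : Finset ι, x ^ s.card * (1 - x) ^ (Fintype.card ι - s.card)
          * (n.factorial * t⁻¹ ^ n * Real.exp t ^ s.card) := by
        refine Finset.sum_le_sum fun s _ => mul_le_mul_of_nonneg_left ?_ (by positivity)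
        have := Real.pow_div_factorial_le_exp (s.card * t) (by positivity) n
        rw [div_le_iff₀ (by positivity), mul_pow, Real.exp_nat_mul] at this
        rw [inv_pow, mul_assoc, mul_comm, mul_assoc, inv_mul_eq_div, le_div_iff₀ (by positivity)]
        exact this
    _ = n.factorial * t⁻¹ ^ n * ∑ s : Finset ι, (x * Real.exp t) ^ s.card
          * (1 - x) ^ (Fintype.card ι - s.card) := by
        rw [Finset.mul_sum]
        refine Finset.sum_congr rfl fun s _ => ?_
        rw [mul_pow]
        ring
    _ = _ := by
        rw [Fintype.sum_pow_mul_eq_add_pow]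
        congr 2
        ring

end Counting

section Power

variable {X : Type*} [NormedAddCommGroup X] [InnerProductSpace ℂ X]
  {S : Type*} [MeasurableSpace S] {ν : Measure S} {b : S → X →L[ℂ] X} {x β : ℝ}
  {ι : Type*} [Fintype ι] [DecidableEq ι]

/-- Multiplying out a power of a sum of operators. -/
theorem mul_pow_apply_eq_sum (b : S → X →L[ℂ] X) (R : X →L[ℂ] X) (φ : X) (v : ι → ℝ) (y : ι → S)
    (n : ℕ) : (R * ((∑ i, (v i : ℂ) • b (y i)) * R) ^ n) φ
      = ∑ γ : Fin n → ι, (∏ j, (v (γ j) : ℂ)) • wordVec b R φ y (List.ofFn γ) := by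
  induction n with
  | zero =>
    simp [wordVec]
  | succ n ih =>
    rw [pow_succ']
    have h1 : (R * ((∑ i, (v i : ℂ) • b (y i)) * R * ((∑ i, (v i : ℂ) • b (y i)) * R) ^ n)) φ
        = R ((∑ i, (v i : ℂ) • b (y i)) ((R * ((∑ i, (v i : ℂ) • b (y i)) * R) ^ n) φ)) := rfl
    rw [h1, ih, ← (Fin.consEquiv fun _ => ι).sum_comp, Fintype.sum_prod_type]
    rw [sum_apply, map_sum]
    refine Finset.sum_congr rfl fun i _ => ?_
    rw [map_sum, map_sum]
    refine Finset.sum_congr rfl fun γ _ => ?_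
    have h2 : (Fin.consEquiv fun _ => ι) (i, γ) = Fin.cons i γ := rfl
    rw [h2, List.ofFn_cons, Fin.prod_univ_succ]
    simp only [Fin.cons_zero, Fin.cons_succ, wordVec, map_smul]
    rw [mul_comm, mul_smul]
    congr 1
    exact map_smul R (v i : ℂ) _

variable [CompleteSpace X] [SecondCountableTopology X] [IsProbabilityMeasure ν]

/-- The average over the positions of the `n`-th term of a Born series. -/
theorem IsSparse.norm_integral_power_le (hb : IsSparse ν b x β) (hx1 : x ≤ 1) (R : X →L[ℂ] X)
    {ρ : ℝ} (hR : ‖R‖ ≤ ρ) {φ : X} (hφ : ‖φ‖ = 1) {v : ι → ℝ} (hv : ∀ i, |v i| ≤ 1) {t : ℝ}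
    (ht : 0 < t) (n : ℕ) :
    ‖∫ y : ι → S, inner ℂ φ ((R * ((∑ i, (v i : ℂ) • b (y i)) * R) ^ n) φ)
        ∂(Measure.pi fun _ : ι => ν)‖
      ≤ ρ ^ (n + 1) * β ^ n * (n.factorial * t⁻¹ ^ n)
        * (1 + x * (Real.exp t - 1)) ^ Fintype.card ι := by
  have hβ := hb.β_pos
  have hx := hb.x_pos
  have hρ : 0 ≤ ρ := (norm_nonneg _).trans hR
  simp_rw [mul_pow_apply_eq_sum, inner_sum, inner_smul_right]
  rw [integral_finsetSum]
  · refine (norm_sum_le _ _).trans ?_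
    calc _ ≤ ∑ γ : Fin n → ι, ρ ^ (n + 1) * β ^ n * x ^ (Finset.univ.image γ).card := by
          refine Finset.sum_le_sum fun γ _ => ?_
          rw [integral_const_mul, norm_mul, norm_prod]
          have h1 : ∏ j, ‖(v (γ j) : ℂ)‖ ≤ 1 :=
            Finset.prod_le_one (fun j _ => norm_nonneg _) fun j _ => by
              rw [Complex.norm_real]
              exact hv _
          have h2 := hb.norm_integral_inner_wordVec_le R hR hφ (List.ofFn γ)
          rw [List.length_ofFn] at h2
          have h3 : (List.ofFn γ).toFinset = Finset.univ.image γ := by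
            ext i
            simp [List.mem_ofFn]
          rw [h3] at h2
          exact (mul_le_of_le_one_left (norm_nonneg _) h1).trans h2
      _ ≤ _ := by
          rw [← Finset.mul_sum, mul_assoc _ (_ * _) (_ ^ _)]
          exact mul_le_mul_of_nonneg_left (sum_pow_card_image_le hx.le hx1 ht n) (by positivity)
  · intro γ _
    refine Integrable.const_mul ?_ _
    refine IsBddMeas.integrable (IsBddMeas.inner ?_ (hb.isBddMeas_wordVec R φ _)) _
    exact ⟨stronglyMeasurable_const, ‖φ‖, fun _ => le_rfl⟩

end Power

/-! ### Measurable dependence of the resolvent on the perturbation -/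

section Measurability

variable {X : Type*} [NormedAddCommGroup X] [InnerProductSpace ℂ X]
  {Ω : Type*} [MeasurableSpace Ω]

/-- The solution `u ω` of `Q ω (u ω) = g` depends measurably on `ω` if `Q ω` does and is bounded
below: up to a controlled error, `u ω` is the first member of a dense sequence which solves the
equation approximately. -/
theorem stronglyMeasurable_of_apply_eq [SecondCountableTopology X] {Q : Ω → X →L[ℂ] X}
    (hQ : ∀ f, StronglyMeasurable fun ω => Q ω f) {g : X} {u : Ω → X} (hu : ∀ ω, Q ω (u ω) = g)
    {C : Ω → ℝ} (hC : ∀ ω f, ‖f‖ ≤ C ω * ‖Q ω f‖) : StronglyMeasurable u := by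
  classical
  let e : ℕ → X := TopologicalSpace.denseSeq X
  have hex : ∀ (n : ℕ) (ω : Ω), ∃ k, ‖Q ω (e k) - g‖ < 1 / ((n : ℝ) + 1) := by
    intro n ω
    have ho : IsOpen {f | ‖Q ω f - g‖ < 1 / ((n : ℝ) + 1)} :=
      isOpen_lt (by fun_prop) continuous_const
    obtain ⟨k, hf⟩ := (TopologicalSpace.denseRange_denseSeq X).exists_mem_open ho
      ⟨u ω, by simp only [Set.mem_ofPred_eq, hu, sub_self, norm_zero]; positivity⟩
    exact ⟨k, hf⟩
  have hmeas : ∀ n : ℕ, StronglyMeasurable fun ω => e (Nat.find (hex n ω)) := by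
    intro n
    have h1 : Measurable fun ω => Nat.find (hex n ω) := measurable_find _ fun k =>
      ((hQ (e k)).sub stronglyMeasurable_const).norm.measurable measurableSet_Iio
    exact (StronglyMeasurable.of_discrete (f := e)).comp_measurable h1
  refine stronglyMeasurable_of_tendsto Filter.atTop hmeas (tendsto_pi_nhds.2 fun ω => ?_)
  refine tendsto_iff_norm_sub_tendsto_zero.2 ?_
  have h0 : Filter.Tendsto (fun n : ℕ => |C ω| * (1 / ((n : ℝ) + 1))) Filter.atTop (nhds 0) := by
    simpa using tendsto_one_div_add_atTop_nhds_zero_nat.const_mul |C ω|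
  refine squeeze_zero (fun _ => norm_nonneg _) (fun n => ?_) h0
  refine (hC ω _).trans ((mul_le_mul_of_nonneg_right (le_abs_self _) (norm_nonneg _)).trans ?_)
  refine mul_le_mul_of_nonneg_left ?_ (abs_nonneg _)
  rw [map_sub, hu]
  exact (Nat.find_spec (hex n ω)).le

variable [SecondCountableTopology X] {T : X →ₗ.[ℂ] X}
  {W : Ω → X →L[ℂ] X}

theorem stronglyMeasurable_resolventOp_pert {z : ℂ} {R₀ : X →L[ℂ] X}
    (hT : IsResolventAt T z R₀) {R : Ω → X →L[ℂ] X}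
    (hR : ∀ ω, IsResolventAt (pert T (W ω)) z (R ω))
    (hW : ∀ f, StronglyMeasurable fun ω => W ω f) (f : X) :
    StronglyMeasurable fun ω => R ω f := by
  refine stronglyMeasurable_of_apply_eq (Q := fun ω => 1 + R₀ * W ω) (g := R₀ f)
    (C := fun ω => ‖1 - R ω * W ω‖) (fun g => ?_) (fun ω => ?_) fun ω g => ?_
  · exact stronglyMeasurable_const.add (R₀.continuous.comp_stronglyMeasurable (hW g))
  · have h := congrArg (fun A : X →L[ℂ] X => A f) ((hR ω).pert_eq_sub' hT)
    change R ω f = R₀ f - R₀ (W ω (R ω f)) at h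
    change R ω f + R₀ (W ω (R ω f)) = R₀ f
    nth_rewrite 1 [h]
    exact sub_add_cancel _ _
  · have h : (1 - R ω * W ω) * (1 + R₀ * W ω) = 1 := by
      have h1 : R ω * W ω = R₀ * W ω - R ω * W ω * (R₀ * W ω) := by
        conv_lhs => rw [(hR ω).pert_eq_sub hT]
        rw [sub_mul, mul_assoc (R ω), mul_assoc (W ω), mul_assoc (R ω)]
      calc (1 - R ω * W ω) * (1 + R₀ * W ω)
          = 1 + (R₀ * W ω - R ω * W ω * (R₀ * W ω)) - R ω * W ω := by noncomm_ring
        _ = 1 := by rw [← h1, add_sub_cancel_right]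
    have h2 := congrArg (fun A : X →L[ℂ] X => A g) h
    change (1 - R ω * W ω) ((1 + R₀ * W ω) g) = g at h2
    conv_lhs => rw [← h2]
    exact ContinuousLinearMap.le_opNorm _ _

end Measurability

/-! ### Diagonal operators and the kinetic energy -/

section Diagonal

variable {X : Type*} [NormedAddCommGroup X] [InnerProductSpace ℂ X]
  {κ : Type*} {v : κ → X}

theorem memℓp_mul_inner (hv : Orthonormal ℂ v) {a : κ → ℂ} {K : ℝ} (ha : ∀ m, ‖a m‖ ≤ K) (f : X) :
    Memℓp (fun m => a m * inner ℂ (v m) f) 2 := by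
  rw [memℓp_gen_iff (by norm_num)]
  have h := (hv.inner_products_summable (x := f)).mul_left (K ^ 2)
  refine Summable.of_nonneg_of_le (fun m => by positivity) (fun m => ?_) h
  simp only [ENNReal.toReal_ofNat, Real.rpow_ofNat, norm_mul, mul_pow]
  gcongr
  exact ha m

/-- The operator with eigenvalues `a m` on the orthonormal family `v`. -/
theorem exists_diagonal [CompleteSpace X] (hv : Orthonormal ℂ v) {a : κ → ℂ} {K : ℝ}
    (ha : ∀ m, ‖a m‖ ≤ K) :
    ∃ A : X →L[ℂ] X, ∀ f, HasSum (fun m => (a m * inner ℂ (v m) f) • v m) (A f) := by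
  rcases isEmpty_or_nonempty κ with hκ | ⟨⟨m₀⟩⟩
  · exact ⟨0, fun f => by simp⟩
  have hK : 0 ≤ K := (norm_nonneg _).trans (ha m₀)
  have hsum : ∀ f, ∃ g, HasSum (fun m => (a m * inner ℂ (v m) f) • v m) g ∧ ‖g‖ ≤ K * ‖f‖ := by
    intro f
    set c : lp (fun _ : κ => ℂ) 2 := ⟨_, memℓp_mul_inner hv ha f⟩ with hc
    refine ⟨hv.orthogonalFamily.linearIsometry c, ?_, ?_⟩
    · have := hv.orthogonalFamily.hasSum_linearIsometry c
      simpa using this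
    · rw [LinearIsometry.norm_map]
      refine lp.norm_le_of_tsum_le (by norm_num) (by positivity) ?_
      simp only [ENNReal.toReal_ofNat, Real.rpow_ofNat, hc, norm_mul, mul_pow]
      have h := (hv.inner_products_summable (x := f)).mul_left (K ^ 2)
      have hle : ∀ m, ‖a m‖ ^ 2 * ‖inner ℂ (v m) f‖ ^ 2 ≤ K ^ 2 * ‖inner ℂ (v m) f‖ ^ 2 := by
        intro m
        gcongr
        exact ha m
      refine (Summable.tsum_le_tsum hle (.of_nonneg_of_le (fun m => by positivity) hle h) h).trans ?_
      rw [tsum_mul_left]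
      exact mul_le_mul_of_nonneg_left (hv.tsum_inner_products_le f) (by positivity)
  choose A hA hAn using hsum
  refine ⟨LinearMap.mkContinuous
    { toFun := A
      map_add' := fun f g => ?_
      map_smul' := fun c f => ?_ } K hAn, hA⟩
  · refine (hA (f + g)).unique ?_
    simpa [inner_add_right, mul_add, add_smul] using (hA f).add (hA g)
  · refine (hA (c • f)).unique ?_
    simpa [inner_smul_right, mul_left_comm, mul_smul] using (hA f).const_smul c

theorem inner_hasSum (hv : Orthonormal ℂ v) {c : κ → ℂ} {f : X}
    (h : HasSum (fun m => c m • v m) f) (m : κ) : inner ℂ (v m) f = c m := by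
  classical
  have h1 : HasSum (fun k => inner ℂ (v m) (c k • v k)) (inner ℂ (v m) f) :=
    (innerSL ℂ (v m)).hasSum h
  refine h1.unique ?_
  have h2 : (fun k => inner ℂ (v m) (c k • v k)) = fun k => if k = m then c m else 0 := by
    funext k
    rw [inner_smul_right, orthonormal_iff_ite.1 hv]
    by_cases h : k = m
    · simp [h]
    · simp [h, Ne.symm h]
  rw [h2]
  exact hasSum_ite_eq m (c m)

end Diagonal

section Kinetic

variable {d : ℕ} {L : ℝ}

theorem energy_nonneg (p : Space d) : 0 ≤ energy p := by
  unfold energy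
  positivity

theorem hasSum_kinetic (f : L2Box d L) (hf : f ∈ (kinetic d L).domain) :
    HasSum (fun m => kineticCoeff L f m • planeWave L m) (kinetic d L ⟨f, hf⟩) :=
  (summable_planeWave L hf).hasSum

theorem inner_hasSum_kinetic (f : L2Box d L) (hf : f ∈ (kinetic d L).domain) (g : L2Box d L) :
    HasSum (fun m => (energy (dualPt L m) : ℂ) * (inner ℂ g (planeWave L m)
      * inner ℂ (planeWave L m) f)) (inner ℂ g (kinetic d L ⟨f, hf⟩)) := by
  have h : HasSum (fun m => inner ℂ g (kineticCoeff L f m • planeWave L m)) _ :=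
    (innerSL ℂ g).hasSum (hasSum_kinetic f hf)
  refine h.congr_fun fun m => ?_
  rw [inner_smul_right, kineticCoeff]
  ring

theorem isFormalAdjoint_kinetic : (kinetic d L).IsFormalAdjoint (kinetic d L) := by
  rintro ⟨f, hf⟩ ⟨g, hg⟩
  have h1 := (inner_hasSum_kinetic f hf g).star
  have h2 := inner_hasSum_kinetic g hg f
  have h3 : star (inner ℂ g (kinetic d L ⟨f, hf⟩)) = inner ℂ (kinetic d L ⟨f, hf⟩) g :=
    inner_conj_symm _ _
  rw [h3] at h1
  refine h1.unique (h2.congr_fun fun m => ?_)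
  simp only [star_mul', Complex.star_def, inner_conj_symm, Complex.conj_ofReal]
  ring

theorem re_inner_kinetic_nonneg (f : L2Box d L) (hf : f ∈ (kinetic d L).domain) :
    0 ≤ (inner ℂ f (kinetic d L ⟨f, hf⟩)).re := by
  refine (Complex.hasSum_re (inner_hasSum_kinetic f hf f)).nonneg fun m => ?_
  have : inner ℂ f (planeWave L m) * inner ℂ (planeWave L m) f
      = ((‖inner ℂ (planeWave L m) f‖ ^ 2 : ℝ) : ℂ) := by
    rw [← inner_conj_symm f, ← Complex.normSq_eq_conj_mul_self, Complex.normSq_eq_norm_sq]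
  rw [this, ← Complex.ofReal_mul, Complex.ofReal_re]
  exact mul_nonneg (energy_nonneg _) (by positivity)

/-- Every `-c < 0` is a resolvent point of the kinetic energy. The plane waves need not be complete
for this: on the complement of their span the kinetic energy vanishes. -/
theorem exists_isResolventAt_kinetic (hL : 0 < L) {c : ℝ} (hc : 0 < c) :
    ∃ R, IsResolventAt (kinetic d L) ((-c : ℝ) : ℂ) R ∧ ‖R‖ ≤ c⁻¹ := by
  have hv := orthonormal_planeWave (d := d) hL
  have hc' : (c : ℂ) ≠ 0 := by exact_mod_cast hc.ne'
  have hνc : ∀ m : Fin d → ℤ, (energy (dualPt L m) + c : ℂ) ≠ 0 := by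
    intro m
    have := energy_nonneg (dualPt (d := d) L m)
    exact_mod_cast (by positivity : energy (dualPt L m) + c ≠ 0)
  set a : (Fin d → ℤ) → ℂ := fun m => (energy (dualPt L m) + c : ℂ)⁻¹ - (c : ℂ)⁻¹ with ha
  have hinv : ∀ m : Fin d → ℤ, ‖(energy (dualPt L m) + c : ℂ)⁻¹‖ ≤ c⁻¹ := by
    intro m
    have := energy_nonneg (dualPt (d := d) L m)
    rw [← Complex.ofReal_add, norm_inv, Complex.norm_real, Real.norm_of_nonneg (by positivity)]
    exact inv_anti₀ hc (by linarith)
  have hab : ∀ m, ‖a m‖ ≤ c⁻¹ + c⁻¹ := by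
    intro m
    refine (norm_sub_le _ _).trans (add_le_add (hinv m) ?_)
    rw [norm_inv, Complex.norm_real, Real.norm_of_nonneg hc.le]
  obtain ⟨A, hA⟩ := exists_diagonal hv hab
  set R : L2Box d L →L[ℂ] L2Box d L := (c : ℂ)⁻¹ • 1 + A with hR
  have hRf : ∀ f, R f = (c : ℂ)⁻¹ • f + A f := fun f => rfl
  have hcoef : ∀ f m, inner ℂ (planeWave L m) (R f)
      = (energy (dualPt L m) + c : ℂ)⁻¹ * inner ℂ (planeWave L m) f := by
    intro f m
    rw [hRf, inner_add_right, inner_smul_right, inner_hasSum hv (hA f)]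
    simp only [ha]
    ring
  have hkin : ∀ f, kineticCoeff L (R f) = fun m =>
      (1 - c * (energy (dualPt L m) + c : ℂ)⁻¹) * inner ℂ (planeWave L m) f := by
    intro f
    funext m
    rw [kineticCoeff, hcoef]
    have := hνc m
    field_simp
    ring
  have hres : IsResolventAt (kinetic d L) ((-c : ℝ) : ℂ) R := by
    refine isResolventAt_iff.2 ⟨fun f => ?_, fun f hf => ?_⟩
    · have hmem : R f ∈ (kinetic d L).domain := by
        change Memℓp (kineticCoeff L (R f)) 2
        rw [hkin]
        refine memℓp_mul_inner hv (K := 1 + c * c⁻¹) (fun m => ?_) f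
        refine (norm_sub_le _ _).trans ?_
        rw [norm_one, norm_mul, Complex.norm_real, Real.norm_of_nonneg hc.le]
        gcongr
        exact hinv m
      refine ⟨hmem, (hasSum_kinetic (R f) hmem).unique ?_⟩
      have h1 := (hA f).const_smul (-(c : ℂ))
      have h2 : -(c : ℂ) • A f = f + ((-c : ℝ) : ℂ) • R f := by
        rw [hRf, smul_add, smul_smul, Complex.ofReal_neg, neg_mul, mul_inv_cancel₀ hc']
        simp
      rw [h2] at h1
      refine h1.congr_fun fun m => ?_
      rw [hkin, smul_smul]
      congr 1
      simp only [ha]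
      field_simp
      ring
    · have h1 : A (kinetic d L ⟨f, hf⟩) = -(c : ℂ) • A f - (c : ℂ)⁻¹ • kinetic d L ⟨f, hf⟩ := by
        refine (hA _).unique ?_
        refine (((hA f).const_smul (-(c : ℂ))).sub
          ((hasSum_kinetic f hf).const_smul (c : ℂ)⁻¹)).congr_fun fun m => ?_
        rw [inner_hasSum hv (hasSum_kinetic f hf), smul_smul, smul_smul, ← sub_smul]
        congr 1
        have := hνc m
        simp only [ha, kineticCoeff]
        field_simp
        ring
      rw [hRf, h1, hRf, smul_add, smul_smul, Complex.ofReal_neg, neg_mul, mul_inv_cancel₀ hc']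
      simp
  refine ⟨R, hres, R.opNorm_le_bound (by positivity) fun f => ?_⟩
  obtain ⟨hmem, hf⟩ := hres.map_eq f
  have h1 := re_inner_kinetic_nonneg (R f) hmem
  rw [hf, inner_add_right, inner_smul_right, inner_self_eq_norm_sq_to_K] at h1
  have h2 : (inner ℂ (R f) f).re ≤ ‖R f‖ * ‖f‖ :=
    (Complex.re_le_norm _).trans (norm_inner_le_norm _ _)
  have h3 : c * ‖R f‖ ^ 2 ≤ ‖R f‖ * ‖f‖ := by
    simp [← Complex.ofReal_pow] at h1
    linarith
  rw [inv_mul_eq_div, le_div_iff₀ hc]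
  rcases (norm_nonneg (R f)).eq_or_lt with h0 | h0
  · rw [← h0, zero_mul]
    exact norm_nonneg _
  · refine le_of_mul_le_mul_left ?_ h0
    calc ‖R f‖ * (‖R f‖ * c) = c * ‖R f‖ ^ 2 := by ring
      _ ≤ _ := h3

theorem hasRealResolvent_kinetic (hL : 0 < L) : HasRealResolvent (kinetic d L) := by
  obtain ⟨R, hR, -⟩ := exists_isResolventAt_kinetic (d := d) hL one_pos
  exact ⟨isFormalAdjoint_kinetic, -1, R, hR⟩

theorem hasRealResolvent_pert_kinetic (hL : 0 < L) {W : L2Box d L →L[ℂ] L2Box d L}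
    (hW : ∀ f g, inner ℂ (W f) g = inner ℂ f (W g)) : HasRealResolvent (pert (kinetic d L) W) := by
  obtain ⟨R, hR, hn⟩ := exists_isResolventAt_kinetic (d := d) hL
    (by positivity : 0 < ‖W‖ + 1)
  have h : ‖W * R‖ < 1 := by
    refine (norm_mul_le _ _).trans_lt ?_
    calc ‖W‖ * ‖R‖ ≤ ‖W‖ * (‖W‖ + 1)⁻¹ := mul_le_mul_of_nonneg_left hn (norm_nonneg _)
      _ < 1 := by
        rw [← div_eq_mul_inv, div_lt_one (by positivity)]
        linarith
  obtain ⟨S, hS⟩ := hR.exists_pert h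
  exact ⟨isFormalAdjoint_pert isFormalAdjoint_kinetic hW, _, S, hS⟩

theorem resolventOp_kinetic_planeWave (hL : 0 < L) {z : ℂ} (hz : z.im ≠ 0) (m : Fin d → ℤ) :
    resolventOp (kinetic d L) z (planeWave L m)
      = ((energy (dualPt L m) : ℂ) - z)⁻¹ • planeWave L m := by
  classical
  have hv := orthonormal_planeWave (d := d) hL
  have hR := (hasRealResolvent_kinetic (d := d) hL).isResolventAt hz
  have hk : kineticCoeff L (planeWave (d := d) L m)
      = fun k => if k = m then (energy (dualPt L m) : ℂ) else 0 := by
    funext k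
    rw [kineticCoeff, orthonormal_iff_ite.1 hv]
    by_cases h : k = m
    · simp [h]
    · simp [h]
  have hmem : planeWave (d := d) L m ∈ (kinetic d L).domain := by
    change Memℓp (kineticCoeff L (planeWave (d := d) L m)) 2
    rw [hk, memℓp_gen_iff (by norm_num)]
    refine summable_of_ne_finset_zero (s := {m}) fun k hkm => ?_
    simp only [Finset.mem_singleton] at hkm
    simp [hkm]
  have hD : kinetic d L ⟨_, hmem⟩ = (energy (dualPt L m) : ℂ) • planeWave L m := by
    refine (hasSum_kinetic _ hmem).unique ?_
    rw [hk]
    have := hasSum_ite_eq m ((energy (dualPt L m) : ℂ) • planeWave L m)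
    refine this.congr_fun fun k => ?_
    by_cases h : k = m
    · simp [h]
    · simp [h]
  have h1 := hR.apply_map hmem
  rw [hD, map_smul, ← sub_eq_iff_eq_add, ← sub_smul] at h1
  have h2 : (energy (dualPt L m) : ℂ) - z ≠ 0 := by
    intro h0
    have := congrArg Complex.im h0
    simp at this
    exact hz this
  rw [eq_inv_smul_iff₀ h2, h1]

end Kinetic

/-! ### Translations of the torus -/

section Wrap

/-- The representative of `t` modulo `L` in `[-L/2, L/2)`. -/
def wrapReal (L t : ℝ) : ℝ := t - L * (⌊t / L + 1 / 2⌋ : ℤ)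

theorem measurable_wrapReal (L : ℝ) : Measurable (wrapReal L) := by
  unfold wrapReal
  have hf : Measurable fun t : ℝ => ((⌊t / L + 1 / 2⌋ : ℤ) : ℝ) :=
    measurable_from_top.comp (Int.measurable_floor.comp ((measurable_id.div_const L).add_const _))
  exact measurable_id.sub (hf.const_mul L)

theorem wrapReal_add_zsmul {L : ℝ} (hL : 0 < L) (n : ℤ) (t : ℝ) :
    wrapReal L (n • L + t) = wrapReal L t := by
  have h : (n • L + t) / L + 1 / 2 = (t / L + 1 / 2) + n := by
    rw [zsmul_eq_mul]
    field_simp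
    ring
  rw [wrapReal, wrapReal, h, Int.floor_add_intCast, zsmul_eq_mul]
  push_cast
  ring

theorem wrapReal_of_mem {L t : ℝ} (hL : 0 < L) (ht : t ∈ Set.Ico (-(L / 2)) (L / 2)) :
    wrapReal L t = t := by
  have h : ⌊t / L + 1 / 2⌋ = 0 := by
    rw [Int.floor_eq_zero_iff]
    obtain ⟨h1, h2⟩ := ht
    constructor
    · have : -(1 / 2) ≤ t / L := by
        rw [le_div_iff₀ hL]
        linarith
      linarith
    · have : t / L < 1 / 2 := by
        rw [div_lt_iff₀ hL]
        linarith
      linarith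
  rw [wrapReal, h]
  simp

/-- The reflected translation `s ↦ u - s` of the circle of length `L` preserves the measure. -/
theorem measurePreserving_wrapReal {L : ℝ} (hL : 0 < L) (u : ℝ) :
    MeasurePreserving (fun s => wrapReal L (u - s))
      (volume.restrict (Set.Ico (-(L / 2)) (L / 2)))
      (volume.restrict (Set.Ico (-(L / 2)) (L / 2))) := by
  have hm : Measurable fun s : ℝ => wrapReal L (u - s) :=
    (measurable_wrapReal L).comp (measurable_id.const_sub u)
  refine ⟨hm, Measure.ext fun A hA => ?_⟩
  set g : ℝ → ℝ≥0∞ := fun t => A.indicator 1 (wrapReal L t) with hg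
  have hgp : ∀ (n : AddSubgroup.zmultiples L) (t : ℝ), g (n +ᵥ t) = g t := by
    rintro ⟨_, n, rfl⟩ t
    change g (n • L + t) = g t
    rw [hg]
    simp only
    rw [wrapReal_add_zsmul hL]
  have hIoc : ∀ a : ℝ, ∫⁻ t in Set.Ioc a (a + L), g t = ∫⁻ t in Set.Ioc (-(L / 2)) (-(L / 2) + L), g t :=
    fun a => (isAddFundamentalDomain_Ioc hL a).setLIntegral_eq
      (isAddFundamentalDomain_Ioc hL (-(L / 2))) g hgp
  rw [Measure.map_apply hm hA]
  have h1 : volume.restrict (Set.Ico (-(L / 2)) (L / 2)) ((fun s => wrapReal L (u - s)) ⁻¹' A)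
      = ∫⁻ s in Set.Ico (-(L / 2)) (L / 2), g (u - s) := by
    rw [← lintegral_indicator_one (hm hA)]
    rfl
  have h2 : ∫⁻ s in Set.Ico (-(L / 2)) (L / 2), g (u - s)
      = ∫⁻ t in Set.Ioc (u - L / 2) (u - L / 2 + L), g t := by
    have hp := ((volume : Measure ℝ).measurePreserving_sub_left u).setLIntegral_comp_preimage_emb
      (MeasurableEquiv.subLeft u).measurableEmbedding g (Set.Ioc (u - L / 2) (u - L / 2 + L))
    rw [← hp]
    congr 2
    ext s
    simp only [Set.mem_Ico, Set.mem_preimage, Set.mem_Ioc]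
    constructor <;> rintro ⟨h3, h4⟩ <;> constructor <;> linarith
  rw [h1, h2, hIoc, show -(L / 2) + L = L / 2 by ring,
    ← setLIntegral_congr (Ico_ae_eq_Ioc (a := -(L / 2)) (b := L / 2)),
    ← lintegral_indicator_one hA]
  refine setLIntegral_congr_fun measurableSet_Ico fun t ht => ?_
  simp only [hg, wrapReal_of_mem hL ht]

theorem measurePreserving_wrap {d : ℕ} {L : ℝ} (hL : 0 < L) (u : Space d) :
    MeasurePreserving (fun s => wrap L (u - s)) (boxMeasure d L) (boxMeasure d L) := by
  have h1 : MeasurePreserving (MeasurableEquiv.toLp 2 (Fin d → ℝ)).symm (boxMeasure d L)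
      (Measure.pi fun _ => volume.restrict (Set.Ico (-(L / 2)) (L / 2))) := by
    have h := (EuclideanSpace.volume_preserving_symm_measurableEquiv_toLp
      (Fin d)).restrict_preimage_emb (MeasurableEquiv.measurableEmbedding _)
      (Set.univ.pi fun _ => Set.Ico (-(L / 2)) (L / 2))
    rw [← box_eq, volume_pi, Measure.restrict_pi_pi] at h
    exact h
  have h2 := measurePreserving_pi (fun _ : Fin d => volume.restrict (Set.Ico (-(L / 2)) (L / 2)))
    (fun _ : Fin d => volume.restrict (Set.Ico (-(L / 2)) (L / 2)))
    (f := fun j s => wrapReal L (u j - s)) fun j => measurePreserving_wrapReal hL (u j)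
  exact (h1.symm _).comp (h2.comp h1)

end Wrap

/-! ### The potential as a sum of sparse operators -/

section Potential

variable {d : ℕ} {L : ℝ} {B : 𝓢(Space d, ℝ)}

/-- A bound for the supremum and for the `L¹` norm of the single-site profile. -/
def profileBound (B : 𝓢(Space d, ℝ)) : ℝ := SchwartzMap.seminorm ℝ 0 0 B + (∫ x, ‖B x‖) + 1

theorem seminorm_le_profileBound : SchwartzMap.seminorm ℝ 0 0 B ≤ profileBound B := by
  have : 0 ≤ ∫ x, ‖B x‖ := integral_nonneg fun x => norm_nonneg _
  unfold profileBound
  linarith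

theorem integral_le_profileBound : ∫ x, ‖B x‖ ≤ profileBound B := by
  have : 0 ≤ SchwartzMap.seminorm ℝ 0 0 B := apply_nonneg _ _
  unfold profileBound
  linarith

theorem profileBound_pos : 0 < profileBound B := by
  have h1 : 0 ≤ ∫ x, ‖B x‖ := integral_nonneg fun x => norm_nonneg _
  have h2 : 0 ≤ SchwartzMap.seminorm ℝ 0 0 B := apply_nonneg _ _
  unfold profileBound
  linarith

theorem abs_periodize_le (x : Space d) : |periodize L B x| ≤ profileBound B :=
  (B.norm_le_seminorm ℝ _).trans seminorm_le_profileBound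

theorem measurable_periodize : Measurable (periodize L B) :=
  B.continuous.measurable.comp (measurable_wrap L)

theorem measurable_periodize_sub :
    Measurable fun p : Space d × Space d => periodize L B (p.2 - p.1) :=
  measurable_periodize.comp (measurable_snd.sub measurable_fst)

theorem coeFn_potentialOp (ω : Config d) (f : L2Box d L) :
    potentialOp L B ω f =ᵐ[boxMeasure d L] fun x => (potential L B ω x : ℂ) * f x := by
  have h := (ContinuousLinearMap.mul ℂ ℂ).coeFn_holder (r := 2) (memLp_potential L B ω).toLp f
  filter_upwards [h, (memLp_potential L B ω).coeFn_toLp] with x h1 h2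
  rw [h2] at h1
  exact h1

/-- The multiplication by the potential of a single impurity of unit weight at `s`. -/
def siteOp (L : ℝ) (B : 𝓢(Space d, ℝ)) (s : Space d) : L2Box d L →L[ℂ] L2Box d L :=
  potentialOp L B ⟨1, fun _ => s, fun _ => 1⟩

theorem coeFn_siteOp (s : Space d) (f : L2Box d L) :
    siteOp L B s f =ᵐ[boxMeasure d L] fun x => (periodize L B (x - s) : ℂ) * f x := by
  filter_upwards [coeFn_potentialOp ⟨1, fun _ => s, fun _ => 1⟩ f] with x hx
  rw [siteOp, hx]
  simp [potential]

theorem potentialOp_eq_sum (ω : Config d) :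
    potentialOp L B ω = ∑ γ, (ω.2.2 γ : ℂ) • siteOp L B (ω.2.1 γ) := by
  ext1 f
  rw [sum_apply]
  refine Lp.ext ?_
  have h1 : ∀ γ, ((ω.2.2 γ : ℂ) • siteOp L B (ω.2.1 γ) : L2Box d L →L[ℂ] L2Box d L) f
      =ᵐ[boxMeasure d L] fun x => (ω.2.2 γ : ℂ) * ((periodize L B (x - ω.2.1 γ) : ℂ) * f x) := by
    intro γ
    filter_upwards [coeFn_siteOp (L := L) (B := B) (ω.2.1 γ) f,
      Lp.coeFn_smul (ω.2.2 γ : ℂ) (siteOp L B (ω.2.1 γ) f)] with x hx hx2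
    change ((ω.2.2 γ : ℂ) • siteOp L B (ω.2.1 γ) f : L2Box d L) x = _
    rw [hx2, Pi.smul_apply, hx, smul_eq_mul]
  have h2 := ae_all_iff.2 h1
  filter_upwards [coeFn_potentialOp ω f, h2, Lp.coeFn_fun_finsetSum (s := Finset.univ)
    (f := fun γ => ((ω.2.2 γ : ℂ) • siteOp L B (ω.2.1 γ) : L2Box d L →L[ℂ] L2Box d L) f)]
    with x hx1 hx2 hx3
  rw [hx1, hx3, Finset.sum_congr rfl fun γ _ => hx2 γ, potential]
  push_cast
  rw [Finset.sum_mul]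
  exact Finset.sum_congr rfl fun γ _ => by ring

theorem inner_potentialOp (ω : Config d) (f g : L2Box d L) :
    inner ℂ (potentialOp L B ω f) g = inner ℂ f (potentialOp L B ω g) := by
  rw [L2.inner_def, L2.inner_def]
  refine integral_congr_ae ?_
  filter_upwards [coeFn_potentialOp ω f, coeFn_potentialOp ω g] with x h1 h2
  rw [h1, h2]
  simp only [RCLike.inner_apply, map_mul, Complex.conj_ofReal]
  ring

theorem norm_siteOp_le (s : Space d) : ‖siteOp L B s‖ ≤ profileBound B := by
  refine ContinuousLinearMap.opNorm_le_bound _ profileBound_pos.le fun f => ?_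
  refine Lp.norm_le_mul_norm_of_ae_le_mul ?_
  filter_upwards [coeFn_siteOp (L := L) (B := B) s f] with x hx
  rw [hx, norm_mul, Complex.norm_real]
  exact mul_le_mul_of_nonneg_right (abs_periodize_le _) (norm_nonneg _)

theorem norm_potentialOp_le {ω : Config d} (hω : ∀ γ, |ω.2.2 γ| ≤ 1) :
    ‖potentialOp L B ω‖ ≤ profileBound B * ω.1 := by
  rw [potentialOp_eq_sum]
  refine (norm_sum_le _ _).trans ?_
  have h : ∀ γ ∈ (Finset.univ : Finset (Fin ω.1)),
      ‖(ω.2.2 γ : ℂ) • siteOp L B (ω.2.1 γ)‖ ≤ profileBound B := by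
    intro γ _
    rw [norm_smul, Complex.norm_real]
    calc ‖ω.2.2 γ‖ * ‖siteOp L B (ω.2.1 γ)‖ ≤ 1 * profileBound B :=
          mul_le_mul (hω γ) (norm_siteOp_le _) (norm_nonneg _) zero_le_one
      _ = _ := one_mul _
  refine (Finset.sum_le_card_nsmul _ _ _ h).trans (le_of_eq ?_)
  rw [Finset.card_univ, Fintype.card_fin, nsmul_eq_mul, mul_comm]

theorem norm_sq_eq_integral {μ : Measure (Space d)} (f : Lp ℂ 2 μ) :
    ‖f‖ ^ 2 = ∫ x, ‖f x‖ ^ 2 ∂μ := by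
  have h : inner ℂ f f = ((∫ x, ‖f x‖ ^ 2 ∂μ : ℝ) : ℂ) := by
    rw [L2.inner_def, ← integral_complex_ofReal]
    refine integral_congr_ae (.of_forall fun x => ?_)
    simp only
    rw [inner_self_eq_norm_sq_to_K]
    push_cast
    rfl
  rw [inner_self_eq_norm_sq_to_K] at h
  refine Complex.ofReal_injective ?_
  rw [← h]
  push_cast
  rfl

theorem integrable_norm_sq {μ : Measure (Space d)} (f : Lp ℂ 2 μ) :
    Integrable (fun x => ‖f x‖ ^ 2) μ := (Lp.memLp f).norm.integrable_sq

instance instSecondCountableL2Box (d : ℕ) (L : ℝ) : SecondCountableTopology (L2Box d L) :=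
  haveI : Fact ((2 : ℝ≥0∞) ≠ ⊤) := ⟨ENNReal.ofNat_ne_top⟩
  Lp.SecondCountableTopology

/-- A map into a separable metric space is measurable if all distances to it are. -/
theorem stronglyMeasurable_of_dist {Ω E : Type*} [MeasurableSpace Ω] [MetricSpace E]
    [SecondCountableTopology E] {F : Ω → E} (h : ∀ g, Measurable fun ω => dist (F ω) g) :
    StronglyMeasurable F := by
  borelize E
  refine Measurable.stronglyMeasurable (measurable_of_isOpen fun U hU => ?_)
  choose! r hr hrU using fun x (hx : x ∈ U) => Metric.isOpen_iff.1 hU x hx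
  obtain ⟨T, hT, hTU⟩ := TopologicalSpace.isOpen_iUnion_countable
    (fun x : U => Metric.ball (x : E) (r x)) fun x => Metric.isOpen_ball
  have h1 : U = ⋃ x ∈ T, Metric.ball (x : E) (r x) := by
    rw [hTU]
    refine Set.Subset.antisymm (fun x hx => Set.mem_iUnion.2 ⟨⟨x, hx⟩, Metric.mem_ball_self (hr x hx)⟩)
      (Set.iUnion_subset fun x => hrU x x.2)
  rw [h1, Set.preimage_iUnion₂]
  exact MeasurableSet.biUnion hT fun x _ => h x measurableSet_Iio

theorem stronglyMeasurable_siteOp (f : L2Box d L) :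
    StronglyMeasurable fun s => siteOp L B s f := by
  refine stronglyMeasurable_of_dist fun g => ?_
  have h1 : ∀ s, dist (siteOp L B s f) g
      = Real.sqrt (∫ x, ‖(periodize L B (x - s) : ℂ) * f x - g x‖ ^ 2 ∂(boxMeasure d L)) := by
    intro s
    rw [dist_eq_norm, ← Real.sqrt_sq (norm_nonneg (siteOp L B s f - g)), norm_sq_eq_integral]
    congr 1
    refine integral_congr_ae ?_
    filter_upwards [coeFn_siteOp (L := L) (B := B) s f, Lp.coeFn_sub (siteOp L B s f) g] with x h1 h2
    rw [h2, Pi.sub_apply, h1]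
  simp_rw [h1]
  refine Real.continuous_sqrt.measurable.comp (StronglyMeasurable.measurable ?_)
  refine StronglyMeasurable.integral_prod_right' (f := fun p : Space d × Space d =>
    ‖(periodize L B (p.2 - p.1) : ℂ) * f p.2 - g p.2‖ ^ 2) ?_
  have hk : StronglyMeasurable fun p : Space d × Space d => (periodize L B (p.2 - p.1) : ℂ) :=
    (Complex.measurable_ofReal.comp measurable_periodize_sub).stronglyMeasurable
  exact ((hk.mul ((Lp.stronglyMeasurable f).comp_measurable measurable_snd)).sub
    ((Lp.stronglyMeasurable g).comp_measurable measurable_snd)).norm.pow 2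

theorem volume_box (hL : 0 < L) : volume (box d L) = ENNReal.ofReal (L ^ d) := by
  rw [box_eq, (EuclideanSpace.volume_preserving_symm_measurableEquiv_toLp (Fin d)).measure_preimage
    (MeasurableSet.univ_pi fun _ => measurableSet_Ico).nullMeasurableSet, Real.volume_pi_Ico]
  simp [ENNReal.ofReal_pow hL.le]

/-- The uniform distribution on the box. -/
abbrev uniformBox (d : ℕ) (L : ℝ) : Measure (Space d) := ProbabilityTheory.cond volume (box d L)

theorem isProbabilityMeasure_uniformBox (hL : 0 < L) : IsProbabilityMeasure (uniformBox d L) := by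
  refine ProbabilityTheory.cond_isProbabilityMeasure_of_finite ?_ (volume_box_lt_top d L).ne
  rw [volume_box hL]
  simp [hL]

theorem integral_uniformBox (hL : 0 < L) (F : Space d → ℝ) :
    ∫ s, F s ∂(uniformBox d L) = (L ^ d)⁻¹ * ∫ s, F s ∂(boxMeasure d L) := by
  rw [uniformBox, ProbabilityTheory.cond, integral_smul_measure, volume_box hL]
  simp [hL.le]

/-- The average over all positions of a function of the periodized profile. -/
theorem integral_abs_periodize_le (hL : 0 < L) (x : Space d) :
    ∫ s, |periodize L B (x - s)| ∂(uniformBox d L) ≤ (L ^ d)⁻¹ * ∫ y, ‖B y‖ := by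
  rw [integral_uniformBox hL]
  refine mul_le_mul_of_nonneg_left ?_ (by positivity)
  have h := measurePreserving_wrap (d := d) hL x
  have h2 : ∫ s, |periodize L B (x - s)| ∂(boxMeasure d L) = ∫ y, ‖B y‖ ∂(boxMeasure d L) := by
    conv_rhs => rw [← h.map_eq]
    exact (integral_map h.measurable.aemeasurable
      B.continuous.norm.aestronglyMeasurable).symm
  rw [h2]
  exact setIntegral_le_integral B.integrable.norm (.of_forall fun y => norm_nonneg _)

theorem integral_integral_profile_le (hL : 0 < L) {k : ℝ → ℝ} {K : ℝ} (hk : Measurable k)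
    (hk0 : ∀ t, 0 ≤ k t) (hK : ∀ x s : Space d, k (periodize L B (x - s))
      ≤ K * |periodize L B (x - s)|) (hK0 : 0 ≤ K) {p : Space d → ℝ}
    (hp : Integrable p (boxMeasure d L)) (hp0 : ∀ x, 0 ≤ p x) :
    ∫ s, ∫ x, k (periodize L B (x - s)) * p x ∂(boxMeasure d L) ∂(uniformBox d L)
      ≤ (L ^ d)⁻¹ * (K * profileBound B) * ∫ x, p x ∂(boxMeasure d L) := by
  have := isProbabilityMeasure_uniformBox (d := d) hL
  have hkm : Measurable fun q : Space d × Space d => k (periodize L B (q.2 - q.1)) :=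
    hk.comp measurable_periodize_sub
  have hkb : ∀ x s : Space d, k (periodize L B (x - s)) ≤ K * profileBound B := fun x s =>
    (hK x s).trans (mul_le_mul_of_nonneg_left (abs_periodize_le _) hK0)
  have hi : Integrable (fun q : Space d × Space d => k (periodize L B (q.2 - q.1)) * p q.2)
      ((uniformBox d L).prod (boxMeasure d L)) := by
    refine (hp.comp_snd (uniformBox d L)).bdd_mul (c := K * profileBound B)
      hkm.aestronglyMeasurable (.of_forall fun q => ?_)
    rw [Real.norm_of_nonneg (hk0 _)]
    exact hkb _ _
  rw [integral_integral_swap hi, ← integral_const_mul]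
  refine integral_mono_of_nonneg (.of_forall fun x => integral_nonneg fun s =>
    mul_nonneg (hk0 _) (hp0 x)) (hp.const_mul _) (.of_forall fun x => ?_)
  simp only
  rw [integral_mul_const]
  refine mul_le_mul_of_nonneg_right ?_ (hp0 x)
  have hpm : Measurable fun s : Space d => |periodize L B (x - s)| :=
    (measurable_periodize.comp (measurable_id.const_sub x)).abs
  calc ∫ s, k (periodize L B (x - s)) ∂(uniformBox d L)
      ≤ ∫ s, K * |periodize L B (x - s)| ∂(uniformBox d L) := by
        refine integral_mono_of_nonneg (.of_forall fun s => hk0 _) ?_ (.of_forall fun s => hK x s)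
        refine Integrable.const_mul (Integrable.of_bound hpm.aestronglyMeasurable
          (profileBound B) (.of_forall fun s => ?_)) K
        rw [Real.norm_of_nonneg (abs_nonneg _)]
        exact abs_periodize_le _
    _ ≤ K * ((L ^ d)⁻¹ * profileBound B) := by
        rw [integral_const_mul]
        refine mul_le_mul_of_nonneg_left ((integral_abs_periodize_le hL x).trans ?_) hK0
        exact mul_le_mul_of_nonneg_left integral_le_profileBound (by positivity)
    _ = _ := by ring

theorem integral_norm_mul_norm_le {μ : Measure (Space d)} (f g : Lp ℂ 2 μ) :
    ∫ x, ‖f x‖ * ‖g x‖ ∂μ ≤ ‖f‖ * ‖g‖ := by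
  have h := integral_mul_norm_le_Lp_mul_Lq Real.HolderConjugate.two_two
    (by simpa using Lp.memLp f) (by simpa using Lp.memLp g)
  simp only [Real.rpow_ofNat] at h
  rw [← norm_sq_eq_integral, ← norm_sq_eq_integral, ← Real.sqrt_eq_rpow,
    ← Real.sqrt_eq_rpow, Real.sqrt_sq (norm_nonneg _), Real.sqrt_sq (norm_nonneg _)] at h
  exact h

/-- A single impurity at a uniformly distributed position is a sparse operator, uniformly in the
size of the box. -/
theorem isSparse_siteOp (hL : 0 < L) :
    IsSparse (uniformBox d L) (siteOp L B) (L ^ d)⁻¹ (profileBound B) where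
  x_pos := by positivity
  β_pos := profileBound_pos
  measurable := stronglyMeasurable_siteOp
  symm s f g := inner_potentialOp _ f g
  norm_le := norm_siteOp_le
  sq_le f := by
    have h : ∀ s, ‖siteOp L B s f‖ ^ 2
        = ∫ x, (periodize L B (x - s)) ^ 2 * ‖f x‖ ^ 2 ∂(boxMeasure d L) := by
      intro s
      rw [norm_sq_eq_integral]
      refine integral_congr_ae ?_
      filter_upwards [coeFn_siteOp (L := L) (B := B) s f] with x hx
      rw [hx, norm_mul, mul_pow, Complex.norm_real, Real.norm_eq_abs, sq_abs]
    simp_rw [h]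
    refine (integral_integral_profile_le hL (k := fun t => t ^ 2) (K := profileBound B)
      (by fun_prop) (fun t => sq_nonneg t) (fun x s => ?_) profileBound_pos.le
      (integrable_norm_sq f) fun x => by positivity).trans (le_of_eq ?_)
    · rw [← sq_abs, pow_two]
      exact mul_le_mul_of_nonneg_right (abs_periodize_le _) (abs_nonneg _)
    · rw [← norm_sq_eq_integral]
      ring
  mean_le f g := by
    have := isProbabilityMeasure_uniformBox (d := d) hL
    have hfg : Integrable (fun x => ‖f x‖ * ‖g x‖) (boxMeasure d L) :=
      (Lp.memLp f).norm.integrable_mul (Lp.memLp g).norm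
    have hpm : Measurable fun q : Space d × Space d => |periodize L B (q.2 - q.1)| :=
      measurable_periodize_sub.abs
    have h : ∀ s, ‖inner ℂ f (siteOp L B s g)‖
        ≤ ∫ x, |periodize L B (x - s)| * (‖f x‖ * ‖g x‖) ∂(boxMeasure d L) := by
      intro s
      rw [L2.inner_def]
      refine (norm_integral_le_integral_norm _).trans (le_of_eq (integral_congr_ae ?_))
      filter_upwards [coeFn_siteOp (L := L) (B := B) s g] with x hx
      rw [hx]
      simp only [RCLike.inner_apply, norm_mul, RCLike.norm_conj, Complex.norm_real,
        Real.norm_eq_abs]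
      ring
    have hi : Integrable (fun q : Space d × Space d =>
        |periodize L B (q.2 - q.1)| * (‖f q.2‖ * ‖g q.2‖))
        ((uniformBox d L).prod (boxMeasure d L)) := by
      refine (hfg.comp_snd (uniformBox d L)).bdd_mul (c := profileBound B)
        hpm.aestronglyMeasurable (.of_forall fun q => ?_)
      rw [Real.norm_of_nonneg (abs_nonneg _)]
      exact abs_periodize_le _
    refine (integral_mono_of_nonneg (.of_forall fun s => norm_nonneg _) hi.integral_prod_left
      (.of_forall h)).trans ?_
    refine (integral_integral_profile_le hL (k := fun t => |t|) (K := 1)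
      measurable_id.abs (fun t => abs_nonneg t) (fun x s => (one_mul _).ge) zero_le_one
      hfg fun x => by positivity).trans ?_
    rw [one_mul, mul_assoc _ ‖f‖]
    have := profileBound_pos (B := B)
    exact mul_le_mul_of_nonneg_left (integral_norm_mul_norm_le f g) (by positivity)

end Potential

/-! ### The law of the impurities -/

section Config

variable {d : ℕ} {L : ℝ} {μ : Measure ℝ}

theorem measurable_sigmaMk (M : ℕ) :
    Measurable fun p : (Fin M → Space d) × (Fin M → ℝ) => (⟨M, p⟩ : Config d) :=
  fun _ hs => MeasurableSpace.measurableSet_iInf.1 hs M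

theorem measurable_config {E : Type*} [MeasurableSpace E] {F : Config d → E}
    (hF : ∀ M, Measurable fun p => F (Sigma.mk M p)) : Measurable F :=
  fun _ hs => MeasurableSpace.measurableSet_iInf.2 fun M => hF M hs

theorem stronglyMeasurable_config {E : Type*} [TopologicalSpace E]
    [TopologicalSpace.PseudoMetrizableSpace E] [SecondCountableTopology E] {F : Config d → E}
    (hF : ∀ M, StronglyMeasurable fun p => F (Sigma.mk M p)) : StronglyMeasurable F := by
  borelize E
  exact (measurable_config fun M => (hF M).measurable).stronglyMeasurable

theorem measurable_config_fst : Measurable (Sigma.fst : Config d → ℕ) :=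
  measurable_config fun _ => measurable_const

theorem stronglyMeasurable_potentialOp {B : 𝓢(Space d, ℝ)} (f : L2Box d L) :
    StronglyMeasurable fun ω : Config d => potentialOp L B ω f := by
  refine stronglyMeasurable_config fun M => ?_
  simp_rw [potentialOp_eq_sum]
  change StronglyMeasurable fun p : (Fin M → Space d) × (Fin M → ℝ) =>
    (∑ γ : Fin M, (p.2 γ : ℂ) • siteOp L B (p.1 γ) : L2Box d L →L[ℂ] L2Box d L) f
  simp_rw [sum_apply]
  refine Finset.stronglyMeasurable_fun_sum _ fun γ _ => ?_
  have h1 : Measurable fun p : (Fin M → Space d) × (Fin M → ℝ) => (p.2 γ : ℂ) :=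
    Complex.measurable_ofReal.comp ((measurable_pi_apply γ).comp measurable_snd)
  exact h1.stronglyMeasurable.smul ((stronglyMeasurable_siteOp f).comp_measurable
    ((measurable_pi_apply γ).comp measurable_fst))

/-- Bounded absolute moments of all orders force the weights to be at most `1` in absolute value. -/
theorem BoundedMoments.ae_abs_le_one [IsProbabilityMeasure μ] (hμ : BoundedMoments μ) :
    ∀ᵐ v ∂μ, |v| ≤ 1 := by
  obtain ⟨C, hC⟩ := hμ
  have h : ∀ k : ℕ, ∀ᵐ v ∂μ, |v| < 1 + 1 / ((k : ℝ) + 1) := by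
    intro k
    have hk : (0 : ℝ) < 1 / ((k : ℝ) + 1) := by positivity
    set c : ℝ := 1 + 1 / ((k : ℝ) + 1) with hc
    set p : ℝ := μ.real {v | c ≤ |v|} with hp
    have hp0 : 0 ≤ p := measureReal_nonneg
    have hle : ∀ n : ℕ, c ^ n * p ≤ C := by
      intro n
      have h1 := mul_meas_ge_le_integral_of_nonneg (f := fun v : ℝ => |v| ^ n)
        (Filter.Eventually.of_forall fun v => pow_nonneg (abs_nonneg v) n) (hC n).1 (c ^ n)
      refine (mul_le_mul_of_nonneg_left ?_ (by positivity)).trans (h1.trans (hC n).2)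
      refine measureReal_mono fun v hv => ?_
      exact pow_le_pow_left₀ (by positivity : (0 : ℝ) ≤ c) hv n
    have hp1 : p = 0 := by
      by_contra hne
      have hpos : 0 < p := lt_of_le_of_ne hp0 (Ne.symm hne)
      obtain ⟨n, hn⟩ := pow_unbounded_of_one_lt (C / p) (by linarith : 1 < c)
      rw [div_lt_iff₀ hpos] at hn
      exact absurd (hle n) (not_le.2 hn)
    rw [ae_iff]
    simp only [not_lt]
    exact (measureReal_eq_zero_iff).1 hp1
  have h2 := ae_all_iff.2 h
  filter_upwards [h2] with v hv
  refine le_of_forall_pos_lt_add fun e he => ?_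
  obtain ⟨k, hk⟩ := exists_nat_one_div_lt he
  exact (hv k).trans (by linarith)

theorem map_fst_configLaw [IsProbabilityMeasure μ] (hL : 0 < L) :
    (configLaw d L μ).map Sigma.fst = ProbabilityTheory.poissonMeasure (L ^ d).toNNReal := by
  have := isProbabilityMeasure_uniformBox (d := d) hL
  rw [configLaw, Measure.map_sum measurable_config_fst.aemeasurable]
  conv_rhs => rw [← Measure.sum_smul_dirac (ProbabilityTheory.poissonMeasure (L ^ d).toNNReal)]
  congr 1
  funext M
  rw [Measure.map_smul, Measure.map_map measurable_config_fst (measurable_sigmaMk M)]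
  congr 1
  change Measure.map (fun _ => M) _ = _
  rw [Measure.map_const]
  simp

theorem isProbabilityMeasure_configLaw [IsProbabilityMeasure μ] (hL : 0 < L) :
    IsProbabilityMeasure (configLaw d L μ) := by
  have h := map_fst_configLaw (d := d) (μ := μ) hL
  refine ⟨?_⟩
  have h2 := congrArg (fun ν => ν Set.univ) h
  simpa [Measure.map_apply measurable_config_fst] using h2

theorem integrable_exp_configLaw [IsProbabilityMeasure μ] (hL : 0 < L) (s : ℝ) :
    Integrable (fun ω : Config d => Real.exp (s * ω.1)) (configLaw d L μ) := by
  have h : Integrable (fun M : ℕ => Real.exp (s * M))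
      ((configLaw d L μ).map Sigma.fst) := by
    rw [map_fst_configLaw hL, ProbabilityTheory.integrable_poissonMeasure_iff]
    have h1 := (Real.summable_pow_div_factorial (((L ^ d).toNNReal : ℝ) * Real.exp s)).mul_left
      (Real.exp (-((L ^ d).toNNReal : ℝ)))
    refine h1.congr fun M => ?_
    rw [mul_pow, ← Real.exp_nat_mul, Real.norm_of_nonneg (Real.exp_pos _).le, mul_comm (M : ℝ) s]
    ring
  exact h.comp_measurable measurable_config_fst

theorem ae_configLaw_weights [IsProbabilityMeasure μ] (hL : 0 < L) (hμ : ∀ᵐ v ∂μ, |v| ≤ 1) :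
    ∀ᵐ ω ∂(configLaw d L μ), ∀ γ, |ω.2.2 γ| ≤ 1 := by
  have := isProbabilityMeasure_uniformBox (d := d) hL
  rw [configLaw, Measure.ae_sum_iff]
  intro M
  refine Measure.ae_smul_measure ?_ _
  have hs : MeasurableSet {ω : Config d | ∀ γ, |ω.2.2 γ| ≤ 1} := by
    refine MeasurableSpace.measurableSet_iInf.2 fun K => ?_
    change MeasurableSet {p : (Fin K → Space d) × (Fin K → ℝ) | ∀ γ, |p.2 γ| ≤ 1}
    simp only [Set.ofPred_forall]
    exact MeasurableSet.iInter fun γ => measurableSet_le (by fun_prop) measurable_const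
  rw [ae_map_iff (measurable_sigmaMk M).aemeasurable hs]
  have hv : ∀ᵐ v ∂(Measure.pi fun _ : Fin M => μ), ∀ γ, |v γ| ≤ 1 :=
    ae_all_iff.2 fun γ => (Measure.quasiMeasurePreserving_eval (fun _ : Fin M => μ) γ).ae hμ
  exact (Measure.quasiMeasurePreserving_snd (μ := Measure.pi fun _ : Fin M => uniformBox d L)).ae hv

/-- Averaging first over the positions, then over the weights, and finally over the Poisson
distributed number of impurities. -/
theorem norm_integral_configLaw_le [IsProbabilityMeasure μ] (hL : 0 < L)
    (hμ : ∀ᵐ v ∂μ, |v| ≤ 1) {F : Config d → ℂ}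
    (hF : Integrable F (configLaw d L μ)) {K y : ℝ} (hFm : StronglyMeasurable F)
    (h : ∀ M (v : Fin M → ℝ), (∀ γ, |v γ| ≤ 1) →
      ‖∫ s, F ⟨M, s, v⟩ ∂(Measure.pi fun _ : Fin M => uniformBox d L)‖ ≤ K * y ^ M) :
    ‖∫ ω, F ω ∂(configLaw d L μ)‖ ≤ K * Real.exp (L ^ d * (y - 1)) := by
  have := isProbabilityMeasure_uniformBox (d := d) hL
  have hm : (0 : ℝ) < L ^ d := by positivity
  have hmr : ((L ^ d).toNNReal : ℝ) = L ^ d := Real.coe_toNNReal _ hm.le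
  have hsum := hasSum_integral_measure hF
  have hterm : ∀ M : ℕ, ‖∫ ω, F ω ∂((ProbabilityTheory.poissonMeasure (L ^ d).toNNReal {M}) •
      (((Measure.pi fun _ : Fin M => uniformBox d L).prod
        (Measure.pi fun _ : Fin M => μ)).map (Sigma.mk M)))‖
      ≤ Real.exp (-(L ^ d)) * (K * ((L ^ d * y) ^ M / M.factorial)) := by
    intro M
    have hw : (ProbabilityTheory.poissonMeasure (L ^ d).toNNReal {M}).toReal
        = Real.exp (-(L ^ d)) * (L ^ d) ^ M / M.factorial := by
      have h1 := ProbabilityTheory.poissonMeasure_real_singleton (L ^ d).toNNReal M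
      rw [hmr] at h1
      exact h1
    have hw0 : ProbabilityTheory.poissonMeasure (L ^ d).toNNReal {M} ≠ 0 := by
      intro h0
      rw [h0, ENNReal.toReal_zero] at hw
      have : 0 < Real.exp (-(L ^ d)) * (L ^ d) ^ M / M.factorial := by positivity
      exact this.ne hw
    have hi : Integrable F (((Measure.pi fun _ : Fin M => uniformBox d L).prod
        (Measure.pi fun _ : Fin M => μ)).map (Sigma.mk M)) := by
      rw [← integrable_smul_measure hw0 (measure_ne_top _ _)]
      exact hF.mono_measure (Measure.le_sum _ M)
    have hi2 : Integrable (fun p => F ⟨M, p⟩) ((Measure.pi fun _ : Fin M => uniformBox d L).prod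
        (Measure.pi fun _ : Fin M => μ)) := hi.comp_measurable (measurable_sigmaMk M)
    rw [integral_smul_measure, hw, norm_smul, Real.norm_of_nonneg (by positivity),
      integral_map (measurable_sigmaMk M).aemeasurable hFm.aestronglyMeasurable]
    have hb : ‖∫ p, F (Sigma.mk M p) ∂((Measure.pi fun _ : Fin M => uniformBox d L).prod
        (Measure.pi fun _ : Fin M => μ))‖ ≤ K * y ^ M := by
      rw [integral_prod_symm _ hi2]
      refine (norm_integral_le_of_norm_le_const (C := K * y ^ M) ?_).trans (le_of_eq ?_)
      · have hv : ∀ᵐ v ∂(Measure.pi fun _ : Fin M => μ), ∀ γ, |v γ| ≤ 1 :=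
          ae_all_iff.2 fun γ => (Measure.quasiMeasurePreserving_eval (fun _ : Fin M => μ) γ).ae hμ
        filter_upwards [hv] with v hv
        exact h M v hv
      · simp
    refine (mul_le_mul_of_nonneg_left hb (by positivity)).trans (le_of_eq ?_)
    rw [mul_pow]
    ring
  have hexp : HasSum (fun M : ℕ => Real.exp (-(L ^ d)) * (K * ((L ^ d * y) ^ M / M.factorial)))
      (Real.exp (-(L ^ d)) * (K * Real.exp (L ^ d * y))) := by
    refine ((?_ : HasSum (fun M : ℕ => (L ^ d * y) ^ M / M.factorial)
      (Real.exp (L ^ d * y))).mul_left K).mul_left _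
    rw [Real.exp_eq_exp_ℝ]
    exact NormedSpace.expSeries_div_hasSum_exp (L ^ d * y)
  refine (hsum.norm_le_of_bounded hexp hterm).trans (le_of_eq ?_)
  rw [mul_left_comm, ← Real.exp_add]
  congr 2
  ring

variable {B : 𝓢(Space d, ℝ)}

theorem norm_mul_pow_apply_le {X : Type*} [NormedAddCommGroup X] [NormedSpace ℂ X]
    {R W : X →L[ℂ] X} {ρ w : ℝ} (hR : ‖R‖ ≤ ρ) (hW : ‖W‖ ≤ w) (n : ℕ) :
    ‖R * (W * R) ^ n‖ ≤ ρ ^ (n + 1) * w ^ n := by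
  have hρ : 0 ≤ ρ := (norm_nonneg _).trans hR
  have hw : 0 ≤ w := (norm_nonneg _).trans hW
  induction n with
  | zero => simpa using hR
  | succ n ih =>
    rw [pow_succ, ← mul_assoc]
    refine (norm_mul_le _ _).trans ((mul_le_mul ih ((norm_mul_le _ _).trans
      (mul_le_mul hW hR (norm_nonneg _) hw)) (norm_nonneg _) (by positivity)).trans (le_of_eq ?_))
    ring

theorem pow_le_factorial_mul_exp {w : ℝ} (hw : 0 ≤ w) (n : ℕ) :
    w ^ n ≤ n.factorial * Real.exp w := by
  have h := Real.pow_div_factorial_le_exp w hw n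
  rwa [div_le_iff₀ (by positivity), mul_comm] at h

theorem stronglyMeasurable_power (R : L2Box d L →L[ℂ] L2Box d L) (n : ℕ) (f : L2Box d L) :
    StronglyMeasurable fun ω : Config d => (R * (potentialOp L B ω * R) ^ n) f := by
  have h : ∀ n, StronglyMeasurable fun ω : Config d => ((potentialOp L B ω * R) ^ n) f := by
    intro n
    induction n with
    | zero => exact stronglyMeasurable_const
    | succ n ih =>
      simp_rw [pow_succ']
      exact stronglyMeasurable_clm_apply stronglyMeasurable_potentialOp
        (R.continuous.comp_stronglyMeasurable ih)
  exact R.continuous.comp_stronglyMeasurable (h n)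

theorem norm_inner_power_le {ω : Config d} (hω : ∀ γ, |ω.2.2 γ| ≤ 1)
    {R : L2Box d L →L[ℂ] L2Box d L} {ρ : ℝ} (hR : ‖R‖ ≤ ρ) {φ : L2Box d L} (hφ : ‖φ‖ = 1) (n : ℕ) :
    ‖inner ℂ φ ((R * (potentialOp L B ω * R) ^ n) φ)‖
      ≤ ρ ^ (n + 1) * n.factorial * Real.exp (profileBound B * ω.1) := by
  have hρ : 0 ≤ ρ := (norm_nonneg _).trans hR
  have hβ := profileBound_pos (B := B)
  refine (norm_inner_le_norm _ _).trans ?_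
  rw [hφ, one_mul]
  refine (ContinuousLinearMap.le_opNorm _ _).trans ?_
  rw [hφ, mul_one]
  refine (norm_mul_pow_apply_le hR (norm_potentialOp_le hω) n).trans ?_
  rw [mul_assoc]
  exact mul_le_mul_of_nonneg_left (pow_le_factorial_mul_exp (by positivity) n) (by positivity)

theorem integrable_inner_power [IsProbabilityMeasure μ] (hL : 0 < L) (hμ : ∀ᵐ v ∂μ, |v| ≤ 1)
    (R : L2Box d L →L[ℂ] L2Box d L) {φ : L2Box d L} (hφ : ‖φ‖ = 1) (n : ℕ) :
    Integrable (fun ω => inner ℂ φ ((R * (potentialOp L B ω * R) ^ n) φ)) (configLaw d L μ) := by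
  refine Integrable.mono' (((integrable_exp_configLaw hL (profileBound B)).const_mul
    (‖R‖ ^ (n + 1) * n.factorial))) ?_ ?_
  · exact (stronglyMeasurable_const.inner (stronglyMeasurable_power R n φ)).aestronglyMeasurable
  · filter_upwards [ae_configLaw_weights hL hμ] with ω hω
    exact norm_inner_power_le hω le_rfl hφ n

/-- The Born terms are bounded uniformly in the volume: up to the factor `n!`, which is beaten by
the regularization, they grow geometrically. -/
theorem norm_integral_inner_power_le [IsProbabilityMeasure μ] (hL : 1 ≤ L)
    (hμ : ∀ᵐ v ∂μ, |v| ≤ 1) (R : L2Box d L →L[ℂ] L2Box d L) {ρ : ℝ} (hR : ‖R‖ ≤ ρ)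
    {φ : L2Box d L} (hφ : ‖φ‖ = 1) {t : ℝ} (ht : 0 < t) (n : ℕ) :
    ‖∫ ω, inner ℂ φ ((R * (potentialOp L B ω * R) ^ n) φ) ∂(configLaw d L μ)‖
      ≤ ρ ^ (n + 1) * profileBound B ^ n * (n.factorial * t⁻¹ ^ n)
        * Real.exp (Real.exp t - 1) := by
  have hL0 : 0 < L := by linarith
  have := isProbabilityMeasure_uniformBox (d := d) hL0
  have hx1 : (L ^ d)⁻¹ ≤ 1 := inv_le_one_of_one_le₀ (one_le_pow₀ hL)
  refine (norm_integral_configLaw_le hL0 hμ (integrable_inner_power hL0 hμ R hφ n)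
    (K := ρ ^ (n + 1) * profileBound B ^ n * (n.factorial * t⁻¹ ^ n))
    (y := 1 + (L ^ d)⁻¹ * (Real.exp t - 1))
    (stronglyMeasurable_const.inner (stronglyMeasurable_power R n φ)) fun M v hv => ?_).trans
    (le_of_eq ?_)
  · have h := (isSparse_siteOp (B := B) hL0).norm_integral_power_le hx1 R hR hφ hv ht n
    rw [Fintype.card_fin] at h
    refine le_trans (le_of_eq ?_) h
    congr 1
    refine integral_congr_ae (.of_forall fun s => ?_)
    simp only
    rw [potentialOp_eq_sum]
  · congr 2
    have : (L : ℝ) ^ d ≠ 0 := by positivity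
    field_simp
    ring

theorem integrable_norm_potentialOp_sq [IsProbabilityMeasure μ] (hL : 0 < L)
    (hμ : ∀ᵐ v ∂μ, |v| ≤ 1) {φ : L2Box d L} (hφ : ‖φ‖ = 1) :
    Integrable (fun ω => ‖potentialOp L B ω φ‖ ^ 2) (configLaw d L μ) := by
  refine Integrable.mono' ((integrable_exp_configLaw hL (2 * profileBound B))) ?_ ?_
  · exact ((stronglyMeasurable_potentialOp φ).norm.pow 2).aestronglyMeasurable
  · filter_upwards [ae_configLaw_weights hL hμ] with ω hω
    have hβ := profileBound_pos (B := B)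
    have h1 : ‖potentialOp L B ω φ‖ ≤ Real.exp (profileBound B * ω.1) := by
      refine (ContinuousLinearMap.le_opNorm _ _).trans ?_
      rw [hφ, mul_one]
      refine (norm_potentialOp_le hω).trans ?_
      have := Real.add_one_le_exp (profileBound B * ω.1)
      linarith
    rw [Real.norm_of_nonneg (by positivity), show 2 * profileBound B * (ω.1 : ℝ)
      = profileBound B * ω.1 + profileBound B * ω.1 by ring, Real.exp_add, ← pow_two]
    exact pow_le_pow_left₀ (norm_nonneg _) h1 2

/-- The volume-uniform bound for the second moment of `‖V φ‖` is the case `n = 2`, `R = 1`, `t = 1`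
of the bound for the Born terms. -/
theorem integral_norm_potentialOp_sq_le [IsProbabilityMeasure μ] (hL : 1 ≤ L)
    (hμ : ∀ᵐ v ∂μ, |v| ≤ 1) {φ : L2Box d L} (hφ : ‖φ‖ = 1) :
    ∫ ω, ‖potentialOp L B ω φ‖ ^ 2 ∂(configLaw d L μ)
      ≤ 2 * profileBound B ^ 2 * Real.exp (Real.exp 1 - 1) := by
  have h := norm_integral_inner_power_le (B := B) hL hμ (1 : L2Box d L →L[ℂ] L2Box d L)
    (ρ := 1) ContinuousLinearMap.norm_id_le hφ one_pos 2
  have h2 : ∀ ω : Config d, inner ℂ φ (((1 : L2Box d L →L[ℂ] L2Box d L) *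
      (potentialOp L B ω * (1 : L2Box d L →L[ℂ] L2Box d L)) ^ 2 : L2Box d L →L[ℂ] L2Box d L) φ)
        = ((‖potentialOp L B ω φ‖ ^ 2 : ℝ) : ℂ) := by
    intro ω
    rw [one_mul, mul_one, pow_two]
    change inner ℂ φ (potentialOp L B ω (potentialOp L B ω φ)) = _
    rw [← inner_potentialOp, inner_self_eq_norm_sq_to_K]
    push_cast
    rfl
  simp_rw [h2] at h
  rw [integral_complex_ofReal, Complex.norm_real] at h
  refine ((le_abs_self _).trans h).trans (le_of_eq ?_)
  norm_num
  ring

end Config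

/-! ### The disorder-averaged Born series -/

theorem integrable_mul_prod_of_continuous {Ω : Type*} [MeasurableSpace Ω] {P : Measure Ω}
    [SFinite P] {f : ℝ → ℂ} {g : ℝ → Ω → ℂ} {F : ℝ → ℝ} {G : Ω → ℝ} (hf : Continuous f)
    (hF : Integrable F) (hfF : ∀ α, ‖f α‖ ≤ F α) (hgc : ∀ ω, Continuous fun α => g α ω)
    (hgm : ∀ α, StronglyMeasurable (g α)) (hG : Integrable G P)
    (hgG : ∀ᵐ ω ∂P, ∀ α, ‖g α ω‖ ≤ G ω) :
    Integrable (fun p : Ω × ℝ => f p.2 * g p.2 p.1) (P.prod volume) := by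
  have hg : StronglyMeasurable fun p : Ω × ℝ => g p.2 p.1 :=
    (stronglyMeasurable_uncurry_of_continuous_of_stronglyMeasurable (u := g) hgc
      hgm).comp_measurable measurable_swap
  refine (hG.mul_prod hF).mono' ((hf.measurable.comp measurable_snd).aestronglyMeasurable.mul
    hg.aestronglyMeasurable) ?_
  have hae : ∀ᵐ p ∂(P.prod (volume : Measure ℝ)), ∀ α, ‖g α p.1‖ ≤ G p.1 :=
    Measure.quasiMeasurePreserving_fst.ae hgG
  filter_upwards [hae] with p hp
  rw [norm_mul, mul_comm]
  exact mul_le_mul (hp _) (hfF _) (norm_nonneg _) ((norm_nonneg _).trans (hp 0))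

section Average

variable {d : ℕ} {L : ℝ} {B : 𝓢(Space d, ℝ)} {μ : Measure ℝ}

theorem hamiltonian_eq_pert (lam : ℝ) (ω : Config d) :
    hamiltonian L B lam ω = pert (kinetic d L) ((lam : ℂ) • potentialOp L B ω) := rfl

theorem hasRealResolvent_hamiltonian (hL : 0 < L) (lam : ℝ) (ω : Config d) :
    HasRealResolvent (hamiltonian L B lam ω) := by
  rw [hamiltonian_eq_pert]
  refine hasRealResolvent_pert_kinetic hL fun f g => ?_
  change inner ℂ ((lam : ℂ) • potentialOp L B ω f) g = inner ℂ f ((lam : ℂ) • potentialOp L B ω g)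
  rw [inner_smul_left, inner_smul_right, Complex.conj_ofReal, inner_potentialOp]

theorem bornTerm_smul (T : L2Box d L →ₗ.[ℂ] L2Box d L) (W : L2Box d L →L[ℂ] L2Box d L) (c : ℂ)
    (n : ℕ) (z : ℂ) : bornTerm T (c • W) n z = c ^ n • bornTerm T W n z := by
  rw [bornTerm, bornTerm, smul_mul_assoc, smul_pow, mul_smul_comm]

theorem coeffT_eq (n : ℕ) (z : ℂ) (φ : L2Box d L) : coeffT L B μ n z φ φ
    = ∫ ω, expectation φ (bornTerm (kinetic d L) (potentialOp L B ω) n z) ∂(configLaw d L μ) := rfl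

variable [IsProbabilityMeasure μ]

theorem norm_coeffT_le (hL : 1 ≤ L) (hμ : ∀ᵐ v ∂μ, |v| ≤ 1) {φ : L2Box d L} (hφ : ‖φ‖ = 1)
    {t : ℝ} (ht : 0 < t) (n : ℕ) {z : ℂ} {y : ℝ} (hy : 0 < y) (hz : y ≤ z.im) :
    ‖coeffT L B μ n z φ φ‖ ≤ y⁻¹ ^ (n + 1) * profileBound B ^ n * (n.factorial * t⁻¹ ^ n)
        * Real.exp (Real.exp t - 1) := by
  refine norm_integral_inner_power_le hL hμ _ ?_ hφ ht n
  have hz0 : 0 < z.im := hy.trans_le hz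
  refine ((hasRealResolvent_kinetic (by linarith : 0 < L)).norm_resolventOp_le hz0.ne').trans ?_
  rw [abs_of_pos hz0]
  exact inv_anti₀ hy hz

variable {u : ℝ → ℂ} {r : ℝ}

/-- Averaging over the disorder commutes with the smoothing in the spectral parameter. -/
theorem integrable_laplaceFourier_mul_bornTerm (hL : 0 < L) (hμ : ∀ᵐ v ∂μ, |v| ≤ 1)
    (hu : ContDiff ℝ 2 u) (hs : ∀ t, r < |t| → u t = 0) {φ : L2Box d L} (hφ : ‖φ‖ = 1) (n : ℕ)
    {z : ℂ} (hz : 0 < z.im) {β : ℝ} (hβ : 0 ≤ β) :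
    Integrable (fun p : Config d × ℝ => laplaceFourier u (p.2 + β * I) *
      expectation φ (bornTerm (kinetic d L) (potentialOp L B p.1) n
        (z + 2 * Real.pi * (p.2 + β * I)))) ((configLaw d L μ).prod volume) := by
  have := isProbabilityMeasure_configLaw (d := d) (μ := μ) hL
  obtain ⟨C, hC0, hC⟩ := exists_norm_laplaceFourier_le hu hs
  have hT := hasRealResolvent_kinetic (d := d) hL
  have him : ∀ α : ℝ, z.im ≤ (z + 2 * Real.pi * (α + β * I) : ℂ).im := by
    intro α
    have : 0 ≤ 2 * Real.pi * β := by positivity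
    simpa using this
  have hshift : ∀ α : ℝ, (z + 2 * Real.pi * (α + β * I) : ℂ)
      = (z + 2 * Real.pi * (β * I)) + 2 * Real.pi * α := fun α => by ring
  refine integrable_mul_prod_of_continuous
    (g := fun (α : ℝ) (ω : Config d) => expectation φ (bornTerm (kinetic d L)
        (potentialOp L B ω) n (z + 2 * Real.pi * (α + β * I))))
    (f := fun α : ℝ => laplaceFourier u (α + β * I))
    (G := fun ω => z.im⁻¹ ^ (n + 1) * n.factorial * Real.exp (profileBound B * ω.1))
    (F := fun α : ℝ => C * Real.exp (2 * Real.pi * r * |β|) * (1 + α ^ 2)⁻¹)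
    ?_ (integrable_inv_one_add_sq.const_mul _) (fun α => ?_) (fun ω => ?_) (fun α => ?_)
    ((integrable_exp_configLaw hL (profileBound B)).const_mul _) ?_
  · have := (differentiable_laplaceFourier hu.continuous hs).continuous
    fun_prop
  · have h1 := hC (α + β * I)
    simpa only [add_im, ofReal_im, mul_im, ofReal_re, I_im, mul_one, I_re, mul_zero, add_zero,
      zero_add, add_re, mul_re, sub_self] using h1
  · simp_rw [hshift]
    refine (expectation φ).continuous.comp (hT.continuous_bornTerm ?_ n)
    have := him 0
    simp only [ofReal_zero, zero_add] at this
    exact (hz.trans_le this).ne'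
  · exact stronglyMeasurable_const.inner (stronglyMeasurable_power _ n φ)
  · filter_upwards [ae_configLaw_weights hL hμ] with ω hω α
    refine norm_inner_power_le hω ?_ hφ n
    have h2 := him α
    have h3 : 0 < (z + 2 * Real.pi * (α + β * I) : ℂ).im := hz.trans_le h2
    refine (hT.norm_resolventOp_le h3.ne').trans ?_
    rw [abs_of_pos h3]
    exact inv_anti₀ hz h2

theorem integral_integral_laplaceFourier_bornTerm (hL : 0 < L) (hμ : ∀ᵐ v ∂μ, |v| ≤ 1)
    (hu : ContDiff ℝ 2 u) (hs : ∀ t, r < |t| → u t = 0) {φ : L2Box d L} (hφ : ‖φ‖ = 1) (n : ℕ)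
    {z : ℂ} (hz : 0 < z.im) {β : ℝ} (hβ : 0 ≤ β) :
    ∫ ω, (∫ α : ℝ, laplaceFourier u (α + β * I) * expectation φ (bornTerm (kinetic d L)
        (potentialOp L B ω) n (z + 2 * Real.pi * (α + β * I)))) ∂(configLaw d L μ)
      = ∫ α : ℝ, laplaceFourier u (α + β * I) *
          coeffT L B μ n (z + 2 * Real.pi * (α + β * I)) φ φ := by
  have := isProbabilityMeasure_configLaw (d := d) (μ := μ) hL
  rw [integral_integral_swap (integrable_laplaceFourier_mul_bornTerm hL hμ hu hs hφ n hz hβ)]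
  simp_rw [integral_const_mul, coeffT_eq]

theorem integral_laplaceFourier_bornTerm_shift (hL : 0 < L) (hu : ContDiff ℝ 2 u)
    (hs : ∀ t, r < |t| → u t = 0) (hr : 0 ≤ r) {φ : L2Box d L} (hφ : ‖φ‖ = 1) (n : ℕ)
    {z : ℂ} (hz : 0 < z.im) {β : ℝ} (hβ : 0 ≤ β) (W : L2Box d L →L[ℂ] L2Box d L) :
    ∫ α : ℝ, laplaceFourier u α * expectation φ (bornTerm (kinetic d L) W n (z + 2 * Real.pi * α))
      = ∫ α : ℝ, laplaceFourier u (α + β * I) * expectation φ (bornTerm (kinetic d L) W n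
          (z + 2 * Real.pi * (α + β * I))) := by
  have hT := hasRealResolvent_kinetic (d := d) hL
  refine integral_laplaceFourier_mul_shift hu hs hr
    (h := fun w => expectation φ (bornTerm (kinetic d L) W n w)) (z := z)
    (K := ‖W‖ ^ n * z.im⁻¹ ^ (n + 1)) (fun w hw => ?_) (fun w hw => ?_) hβ
  · exact (expectation φ).differentiableAt.comp w
      (hT.differentiableAt_bornTerm (hz.trans_le hw).ne' n)
  · refine (norm_expectation_le hφ _).trans ((hT.norm_bornTerm_le (hz.trans_le hw) n).trans ?_)
    have h1 : 0 < w.im := hz.trans_le hw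
    gcongr

/-- The smoothed averaged Born term, as an average of smoothed Born terms. -/
theorem integral_laplaceFourier_coeffT_eq (hL : 0 < L) (hμ : ∀ᵐ v ∂μ, |v| ≤ 1)
    (hu : ContDiff ℝ 2 u) (hs : ∀ t, r < |t| → u t = 0) {φ : L2Box d L} (hφ : ‖φ‖ = 1) (n : ℕ)
    {z : ℂ} (hz : 0 < z.im) :
    ∫ α : ℝ, laplaceFourier u α * coeffT L B μ n (z + 2 * Real.pi * α) φ φ
      = ∫ ω, (∫ α : ℝ, laplaceFourier u α * expectation φ (bornTerm (kinetic d L)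
        (potentialOp L B ω) n (z + 2 * Real.pi * α))) ∂(configLaw d L μ) := by
  have h := integral_integral_laplaceFourier_bornTerm (B := B) hL hμ hu hs hφ n hz le_rfl
  simp only [ofReal_zero, zero_mul, add_zero] at h
  exact h.symm

/-- Moving the contour of the smoothing up to height `n + 1` gains the factor `1 / n!` that
compensates the growth of the averaged Born terms. -/
theorem norm_integral_laplaceFourier_coeffT_le (hL : 1 ≤ L) (hμ : ∀ᵐ v ∂μ, |v| ≤ 1)
    (hu : ContDiff ℝ 2 u) (hs : ∀ t, r < |t| → u t = 0) (hr : 0 ≤ r)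
    {C : ℝ} (hC0 : 0 ≤ C) (hC : ∀ w : ℂ, ‖laplaceFourier u w‖
      ≤ C * Real.exp (2 * Real.pi * r * |w.im|) * (1 + w.re ^ 2)⁻¹)
    {φ : L2Box d L} (hφ : ‖φ‖ = 1) {t : ℝ} (ht : 0 < t) (n : ℕ) {z : ℂ} (hz : 0 < z.im) :
    ‖∫ α : ℝ, laplaceFourier u α * coeffT L B μ n (z + 2 * Real.pi * α) φ φ‖
      ≤ Real.pi * C * Real.exp (2 * Real.pi * r) * Real.exp (Real.exp t - 1)
        * (Real.exp (2 * Real.pi * r) * profileBound B * t⁻¹) ^ n := by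
  have hL0 : 0 < L := by linarith
  have hβ : (0 : ℝ) ≤ (n : ℝ) + 1 := by positivity
  have hB := profileBound_pos (B := B)
  have hpi := Real.pi_gt_three
  rw [integral_laplaceFourier_coeffT_eq hL0 hμ hu hs hφ n hz]
  simp_rw [integral_laplaceFourier_bornTerm_shift hL0 hu hs hr hφ n hz hβ]
  rw [integral_integral_laplaceFourier_bornTerm hL0 hμ hu hs hφ n hz hβ]
  have hfac : ((n : ℝ) + 1)⁻¹ ^ (n + 1) * n.factorial ≤ 1 := by
    have h1 : (n.factorial : ℝ) ≤ ((n : ℝ) + 1) ^ (n + 1) := by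
      have h2 : (n + 1).factorial ≤ (n + 1) ^ (n + 1) := Nat.factorial_le_pow (n + 1)
      have h3 : n.factorial ≤ (n + 1) ^ (n + 1) := (Nat.factorial_le (Nat.le_succ n)).trans h2
      exact_mod_cast h3
    rw [inv_pow, inv_mul_le_iff₀ (by positivity), mul_one]
    exact h1
  refine (norm_integral_laplaceFourier_mul_le hC0 hC hβ (K := profileBound B ^ n * t⁻¹ ^ n
      * Real.exp (Real.exp t - 1)) fun α => ?_).trans (le_of_eq ?_)
  · refine (norm_coeffT_le hL hμ hφ ht n (y := (n : ℝ) + 1) (by positivity) ?_).trans ?_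
    · have h1 : (n : ℝ) + 1 ≤ 2 * Real.pi * ((n : ℝ) + 1) := by nlinarith
      have h2 : (z + 2 * Real.pi * (α + ((n : ℝ) + 1 : ℝ) * I) : ℂ).im
          = z.im + 2 * Real.pi * ((n : ℝ) + 1) := by simp
      rw [h2]
      linarith
    · have h0 : 0 ≤ profileBound B ^ n * t⁻¹ ^ n * Real.exp (Real.exp t - 1) := by positivity
      calc _ = (((n : ℝ) + 1)⁻¹ ^ (n + 1) * n.factorial)
            * (profileBound B ^ n * t⁻¹ ^ n * Real.exp (Real.exp t - 1)) := by ring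
        _ ≤ _ := mul_le_of_le_one_left h0 hfac
  · rw [mul_pow, mul_pow, ← Real.exp_nat_mul, show 2 * Real.pi * r * ((n : ℝ) + 1)
      = n * (2 * Real.pi * r) + 2 * Real.pi * r by ring, Real.exp_add]
    ring

theorem stronglyMeasurable_resolventOp_hamiltonian (hL : 0 < L) (lam : ℝ) {z : ℂ} (hz : z.im ≠ 0)
    (f : L2Box d L) :
    StronglyMeasurable fun ω : Config d => resolventOp (hamiltonian L B lam ω) z f :=
  stronglyMeasurable_resolventOp_pert ((hasRealResolvent_kinetic hL).isResolventAt hz)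
    (fun ω => (hasRealResolvent_hamiltonian hL lam ω).isResolventAt hz)
    (fun g => (stronglyMeasurable_potentialOp g).const_smul (lam : ℂ)) f

theorem integrable_expectation_resolventOp (hL : 0 < L) (lam : ℝ) {z : ℂ} (hz : z.im ≠ 0)
    {φ : L2Box d L} (hφ : ‖φ‖ = 1) :
    Integrable (fun ω => expectation φ (resolventOp (hamiltonian L B lam ω) z))
      (configLaw d L μ) := by
  have := isProbabilityMeasure_configLaw (d := d) (μ := μ) hL
  refine Integrable.of_bound (C := |z.im|⁻¹) ?_ (.of_forall fun ω => ?_)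
  · exact (stronglyMeasurable_const.inner
      (stronglyMeasurable_resolventOp_hamiltonian hL lam hz φ)).aestronglyMeasurable
  · exact (norm_expectation_le hφ _).trans
      ((hasRealResolvent_hamiltonian hL lam ω).norm_resolventOp_le hz)

/-- For a fixed volume the averaged regularized Born series converges: the remainder is estimated
pointwise in the disorder at height `N`, where the number of impurities enters only through an
exponential moment. -/
theorem norm_integral_expectation_sub_sum_le (hL : 0 < L) (hμ : ∀ᵐ v ∂μ, |v| ≤ 1)
    {lam lam₀ : ℝ} (hlam : lam ∈ Set.Icc 0 lam₀) {a : ℝ} (ha : 0 < a) (hr : 0 ≤ r)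
    (hu : ContDiff ℝ 2 u) (hs : ∀ t, r < |t| → u t = 0)
    (hu1 : ∀ t, ‖1 - u t‖ ≤ 1) (hu2 : ∀ t, |t| ≤ a⁻¹ → u t = 1)
    {C : ℝ} (hC0 : 0 ≤ C) (hC : ∀ w : ℂ, ‖laplaceFourier u w‖
      ≤ C * Real.exp (2 * Real.pi * r * |w.im|) * (1 + w.re ^ 2)⁻¹)
    {φ : L2Box d L} (hφ : ‖φ‖ = 1) {z : ℂ} (hz : 0 < z.im) {N : ℕ} (hN : 0 < N) :
    ‖(∫ ω, expectation φ (resolventOp (hamiltonian L B lam ω) z) ∂(configLaw d L μ))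
        - ∑ n ∈ Finset.range N, (lam : ℂ) ^ n * ((-1) ^ n *
          ∫ α : ℝ, laplaceFourier u α * coeffT L B μ n (z + 2 * Real.pi * α) φ φ)‖
      ≤ Real.exp (-(z.im / a)) / z.im + Real.pi * C * (1 / 2) ^ N *
        ∫ ω, Real.exp ((2 * Real.exp (2 * Real.pi * r) * (lam₀ * profileBound B)) * ω.1)
          ∂(configLaw d L μ) := by
  have := isProbabilityMeasure_configLaw (d := d) (μ := μ) hL
  have hB := profileBound_pos (B := B)
  have hlam0 : 0 ≤ lam₀ := hlam.1.trans hlam.2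
  set P := configLaw d L μ with hP
  set s : ℝ := 2 * Real.exp (2 * Real.pi * r) * (lam₀ * profileBound B) with hsdef
  set g : ℕ → Config d → ℂ := fun n ω => ∫ α : ℝ, laplaceFourier u α *
    expectation φ (bornTerm (kinetic d L) (potentialOp L B ω) n (z + 2 * Real.pi * α)) with hg
  have hgi : ∀ n, Integrable (g n) P := by
    intro n
    have h := (integrable_laplaceFourier_mul_bornTerm (B := B) (μ := μ) hL hμ hu hs hφ n hz
      le_rfl).integral_prod_left
    simp only [ofReal_zero, zero_mul, add_zero] at h
    exact h
  have hsum : ∑ n ∈ Finset.range N, (lam : ℂ) ^ n * ((-1) ^ n *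
      ∫ α : ℝ, laplaceFourier u α * coeffT L B μ n (z + 2 * Real.pi * α) φ φ)
      = ∫ ω, ∑ n ∈ Finset.range N, (lam : ℂ) ^ n * ((-1) ^ n * g n ω) ∂P := by
    rw [integral_finsetSum _ fun n _ => ((hgi n).const_mul _).const_mul _]
    refine Finset.sum_congr rfl fun n _ => ?_
    rw [integral_const_mul, integral_const_mul,
      integral_laplaceFourier_coeffT_eq hL hμ hu hs hφ n hz]
  have hi := integrable_expectation_resolventOp (B := B) (μ := μ) hL lam hz.ne' hφ
  have hexp := integrable_exp_configLaw (d := d) (μ := μ) hL s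
  rw [hsum, ← integral_sub hi (integrable_finsetSum _ fun n _ =>
    ((hgi n).const_mul _).const_mul _)]
  refine (norm_integral_le_of_norm_le (g := fun ω : Config d => Real.exp (-(z.im / a)) / z.im
    + Real.pi * C * (1 / 2) ^ N * Real.exp (s * ω.1)) ((integrable_const _).add
      (hexp.const_mul _)) ?_).trans (le_of_eq ?_)
  · filter_upwards [ae_configLaw_weights hL hμ] with ω hω
    have h := (hasRealResolvent_kinetic (d := d) hL).norm_expectation_sub_sum_le
      (W := (lam : ℂ) • potentialOp L B ω)
      (hasRealResolvent_hamiltonian (B := B) hL lam ω) hφ ha hr hu hs hu1 hu2 hC0 hC hz N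
      (β := N) (by exact_mod_cast hN)
    have hterm : ∀ n ∈ Finset.range N, (-1) ^ n * ∫ α : ℝ, laplaceFourier u α *
        expectation φ (bornTerm (kinetic d L) ((lam : ℂ) • potentialOp L B ω) n
          (z + 2 * Real.pi * α)) = (lam : ℂ) ^ n * ((-1) ^ n * g n ω) := by
      intro n _
      simp_rw [bornTerm_smul, map_smul, smul_eq_mul, mul_left_comm _ ((lam : ℂ) ^ n)]
      rw [integral_const_mul]
      ring
    rw [Finset.sum_congr rfl hterm] at h
    refine h.trans (add_le_add le_rfl ?_)
    rw [mul_assoc (Real.pi * C), mul_assoc (Real.pi * C)]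
    refine mul_le_mul_of_nonneg_left ?_ (by positivity)
    have hW : ‖(lam : ℂ) • potentialOp L B ω‖ ≤ lam₀ * profileBound B * ω.1 := by
      rw [norm_smul, Complex.norm_real, Real.norm_of_nonneg hlam.1, mul_assoc]
      exact mul_le_mul hlam.2 (norm_potentialOp_le hω) (norm_nonneg _) hlam0
    set w : ℝ := lam₀ * profileBound B * ω.1 with hw
    have hw0 : 0 ≤ w := by positivity
    have hN1 : (1 : ℝ) ≤ N := by exact_mod_cast hN
    have hNinv : (N : ℝ)⁻¹ ≤ 1 := inv_le_one_of_one_le₀ hN1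
    have hkey : (2 * Real.exp (2 * Real.pi * r) * w) ^ N * (N : ℝ)⁻¹ ^ N ≤ Real.exp (s * ω.1) := by
      have h1 := pow_le_factorial_mul_exp (w := 2 * Real.exp (2 * Real.pi * r) * w)
        (by positivity) N
      have h2 : (N.factorial : ℝ) ≤ (N : ℝ) ^ N := by exact_mod_cast Nat.factorial_le_pow N
      have h3 : s * ω.1 = 2 * Real.exp (2 * Real.pi * r) * w := by
        rw [hsdef, hw]
        ring
      rw [h3, inv_pow, mul_inv_le_iff₀ (by positivity), mul_comm (Real.exp _)]
      exact h1.trans (mul_le_mul_of_nonneg_right h2 (Real.exp_pos _).le)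
    calc Real.exp (2 * Real.pi * r * N) * (‖(lam : ℂ) • potentialOp L B ω‖ ^ N
          * (N : ℝ)⁻¹ ^ (N + 1))
        ≤ Real.exp (2 * Real.pi * r * N) * (w ^ N * ((N : ℝ)⁻¹ ^ N * 1)) := by
          rw [pow_succ]
          gcongr
      _ = (1 / 2) ^ N * ((2 * Real.exp (2 * Real.pi * r) * w) ^ N * (N : ℝ)⁻¹ ^ N) := by
          have h1 : (1 / 2 : ℝ) ^ N * 2 ^ N = 1 := by
            rw [← mul_pow]
            norm_num
          rw [mul_comm (2 * Real.pi * r) (N : ℝ), Real.exp_nat_mul,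
            mul_pow (2 * Real.exp (2 * Real.pi * r)), mul_pow 2 (Real.exp (2 * Real.pi * r))]
          linear_combination
            (-(Real.exp (2 * Real.pi * r) ^ N * w ^ N * (N : ℝ)⁻¹ ^ N)) * h1
      _ ≤ _ := mul_le_mul_of_nonneg_left hkey (by positivity)
  · rw [integral_add (integrable_const _) (hexp.const_mul _), integral_const_mul]
    simp [hP]

/-- The volume-uniform form of the regularized Born expansion. -/
theorem norm_integral_expectation_sub_sum_le_uniform (hL : 1 ≤ L) (hμ : ∀ᵐ v ∂μ, |v| ≤ 1)
    {lam lam₀ : ℝ} (hlam : lam ∈ Set.Icc 0 lam₀) {a : ℝ} (ha : 0 < a) (hr : 0 ≤ r)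
    (hu : ContDiff ℝ 2 u) (hs : ∀ t, r < |t| → u t = 0)
    (hu1 : ∀ t, ‖1 - u t‖ ≤ 1) (hu2 : ∀ t, |t| ≤ a⁻¹ → u t = 1)
    {C : ℝ} (hC0 : 0 ≤ C) (hC : ∀ w : ℂ, ‖laplaceFourier u w‖
      ≤ C * Real.exp (2 * Real.pi * r * |w.im|) * (1 + w.re ^ 2)⁻¹)
    {φ : L2Box d L} (hφ : ‖φ‖ = 1) {z : ℂ} (hz : 0 < z.im) {t : ℝ} (ht : 0 < t)
    (htl : 2 * (lam₀ * (Real.exp (2 * Real.pi * r) * profileBound B)) ≤ t) (N : ℕ) :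
    ‖(∫ ω, expectation φ (resolventOp (hamiltonian L B lam ω) z) ∂(configLaw d L μ))
        - ∑ n ∈ Finset.range N, (lam : ℂ) ^ n * ((-1) ^ n *
          ∫ α : ℝ, laplaceFourier u α * coeffT L B μ n (z + 2 * Real.pi * α) φ φ)‖
      ≤ Real.exp (-(z.im / a)) / z.im +
        Real.pi * C * Real.exp (2 * Real.pi * r) * Real.exp (Real.exp t - 1) * 2 * (1 / 2) ^ N := by
  have hL0 : 0 < L := by linarith
  have hB := profileBound_pos (B := B)
  have hlam0 : 0 ≤ lam₀ := hlam.1.trans hlam.2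
  set K : ℝ := Real.pi * C * Real.exp (2 * Real.pi * r) * Real.exp (Real.exp t - 1) with hK
  have hK0 : 0 ≤ K := by positivity
  set term : ℕ → ℂ := fun n => (lam : ℂ) ^ n * ((-1) ^ n *
    ∫ α : ℝ, laplaceFourier u α * coeffT L B μ n (z + 2 * Real.pi * α) φ φ) with hterm
  have htb : ∀ n, ‖term n‖ ≤ K * (1 / 2) ^ n := by
    intro n
    have h1 := norm_integral_laplaceFourier_coeffT_le (B := B) hL hμ hu hs hr hC0 hC hφ ht n hz
    rw [hterm]
    simp only [norm_mul, norm_pow, norm_neg, norm_one, one_pow, one_mul, Complex.norm_real,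
      Real.norm_of_nonneg hlam.1]
    refine (mul_le_mul (pow_le_pow_left₀ hlam.1 hlam.2 n) h1 (norm_nonneg _)
      (by positivity)).trans ?_
    rw [mul_left_comm, ← mul_pow]
    refine mul_le_mul_of_nonneg_left (pow_le_pow_left₀ (by positivity) ?_ n) hK0
    rw [← mul_assoc, mul_inv_le_iff₀ ht]
    linarith
  have hmain : ∀ k : ℕ, 0 < k → ‖(∫ ω, expectation φ (resolventOp (hamiltonian L B lam ω) z)
      ∂(configLaw d L μ)) - ∑ n ∈ Finset.range N, term n‖
      ≤ Real.exp (-(z.im / a)) / z.im + K * 2 * (1 / 2) ^ N + Real.pi * C * (1 / 2) ^ (N + k) *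
        ∫ ω, Real.exp ((2 * Real.exp (2 * Real.pi * r) * (lam₀ * profileBound B)) * ω.1)
          ∂(configLaw d L μ) := by
    intro k hk
    have h1 := norm_integral_expectation_sub_sum_le (B := B) hL0 hμ hlam ha hr hu hs hu1 hu2 hC0 hC
      hφ hz (N := N + k) (by omega)
    rw [Finset.sum_range_add] at h1
    have h2 : ‖∑ n ∈ Finset.range k, term (N + n)‖ ≤ K * 2 * (1 / 2) ^ N := by
      refine (norm_sum_le _ _).trans ((Finset.sum_le_sum fun n _ => htb (N + n)).trans ?_)
      simp_rw [pow_add, ← mul_assoc]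
      rw [← Finset.mul_sum]
      have h3 := Summable.sum_le_tsum (Finset.range k) (fun n _ => by positivity)
        summable_geometric_two
      rw [tsum_geometric_two] at h3
      calc _ ≤ K * (1 / 2) ^ N * 2 := mul_le_mul_of_nonneg_left h3 (by positivity)
        _ = _ := by ring
    have h4 : ∀ x y w : ℂ, ‖x - y‖ ≤ ‖x - (y + w)‖ + ‖w‖ := fun x y w => by
      calc ‖x - y‖ = ‖(x - (y + w)) + w‖ := by
            congr 1
            ring
        _ ≤ _ := norm_add_le _ _
    refine (h4 _ _ (∑ n ∈ Finset.range k, term (N + n))).trans ?_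
    linarith
  set J := ∫ ω, Real.exp ((2 * Real.exp (2 * Real.pi * r) * (lam₀ * profileBound B)) * ω.1)
          ∂(configLaw d L μ) with hJ
  have hlim : Filter.Tendsto (fun k : ℕ => Real.exp (-(z.im / a)) / z.im + K * 2 * (1 / 2) ^ N
      + Real.pi * C * (1 / 2) ^ (N + k) * J) Filter.atTop
      (nhds (Real.exp (-(z.im / a)) / z.im + K * 2 * (1 / 2) ^ N + Real.pi * C * 0 * J)) := by
    have h1 : Filter.Tendsto (fun k : ℕ => (1 / 2 : ℝ) ^ (N + k)) Filter.atTop (nhds 0) := by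
      have h2 := tendsto_pow_atTop_nhds_zero_of_lt_one (r := (1 / 2 : ℝ)) (by norm_num) (by norm_num)
      refine (Filter.tendsto_add_atTop_iff_nat N).2 h2 |>.congr fun k => ?_
      rw [add_comm]
    exact ((h1.const_mul _).mul_const J).const_add _
  have hfin := ge_of_tendsto hlim ((Filter.eventually_gt_atTop 0).mono hmain)
  simpa using hfin

end Average

/-! ### The cutoff at scale `a(η, δ)` -/

section Cutoff

theorem scale_pos {η : ℝ} (hη : 0 < η) (δ : ℝ) : 0 < scale η δ := by
  unfold scale
  positivity

theorem exp_neg_div_scale_le {η δ : ℝ} (hη : 0 < η) (hδ : 0 < δ) :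
    Real.exp (-(η / scale η δ)) / η ≤ δ / 2 := by
  have h1 : η / scale η δ = |Real.log (η * δ / 2)| + 1 := by
    have : |Real.log (η * δ / 2)| + 1 ≠ 0 := by positivity
    unfold scale
    field_simp
  rw [h1, div_le_iff₀ hη]
  have h2 : Real.exp (-(|Real.log (η * δ / 2)| + 1)) ≤ Real.exp (Real.log (η * δ / 2)) := by
    refine Real.exp_le_exp.2 ?_
    have := neg_abs_le (Real.log (η * δ / 2))
    linarith
  rw [Real.exp_log (by positivity)] at h2
  linarith

variable {d : ℕ} {B : 𝓢(Space d, ℝ)} {μ : Measure ℝ} [IsProbabilityMeasure μ]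

/-- The order of the expansion can be chosen uniformly in the volume, the energy, the coupling and
the normalized vector. -/
theorem exists_order (B : 𝓢(Space d, ℝ)) (hμ : ∀ᵐ v ∂μ, |v| ≤ 1) {χ : ℝ → ℝ} (hχ : IsCutoff χ)
    {η δ lam₀ : ℝ} (hη : 0 < η) (hδ : 0 < δ) (hlam₀ : 0 < lam₀) :
    ∃ N : ℕ, ∀ lam ∈ Set.Icc 0 lam₀, ∀ E L : ℝ, 1 ≤ L → ∀ φ : L2Box d L, ‖φ‖ = 1 →
      ‖(∫ ω, expectation φ (resolventOp (hamiltonian L B lam ω) (E + η * I)) ∂(configLaw d L μ))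
        - ∑ n ∈ Finset.range (N + 1), (lam : ℂ) ^ n * coeffS L B μ χ n E η δ φ φ‖ ≤ δ := by
  set a := scale η δ with ha
  have ha0 : 0 < a := scale_pos hη δ
  set u : ℝ → ℂ := fun t => (χ (a * t) : ℂ) with hu
  have huc : ContDiff ℝ 2 u := by
    have h1 : ContDiff ℝ 2 χ := mod_cast contDiff_infty.1 hχ.smooth 2
    exact Complex.ofRealCLM.contDiff.comp (h1.comp (contDiff_const.mul contDiff_id))
  have hs : ∀ t, 2 / a < |t| → u t = 0 := by
    intro t ht
    have h1 : 2 ≤ |a * t| := by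
      rw [abs_mul, abs_of_pos ha0]
      rw [div_lt_iff₀ ha0] at ht
      linarith
    simp [hu, hχ.eq_zero _ h1]
  have hu1 : ∀ t, ‖1 - u t‖ ≤ 1 := by
    intro t
    have h1 := hχ.mem_Icc (a * t)
    have h2 : 1 - u t = ((1 - χ (a * t) : ℝ) : ℂ) := by simp [hu]
    rw [h2, Complex.norm_real, Real.norm_eq_abs, abs_le]
    constructor <;> linarith [h1.1, h1.2]
  have hu2 : ∀ t, |t| ≤ a⁻¹ → u t = 1 := by
    intro t ht
    have h1 : |a * t| ≤ 1 := by
      rw [abs_mul, abs_of_pos ha0]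
      calc a * |t| ≤ a * a⁻¹ := mul_le_mul_of_nonneg_left ht ha0.le
        _ = 1 := mul_inv_cancel₀ ha0.ne'
    simp [hu, hχ.eq_one _ h1]
  obtain ⟨C, hC0, hC⟩ := exists_norm_laplaceFourier_le huc hs
  have hB := profileBound_pos (B := B)
  have hr : 0 ≤ 2 / a := by positivity
  -- With this `t` consecutive terms of the series decrease by a factor `1 / 2`.
  set t : ℝ := 2 * (lam₀ * (Real.exp (2 * Real.pi * (2 / a)) * profileBound B)) with ht
  have ht0 : 0 < t := by positivity
  set K : ℝ := Real.pi * C * Real.exp (2 * Real.pi * (2 / a)) * Real.exp (Real.exp t - 1) * 2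
    with hK
  have hK0 : 0 ≤ K := by positivity
  obtain ⟨N, hN⟩ : ∃ N : ℕ, K * (1 / 2) ^ (N + 1) ≤ δ / 2 := by
    have h1 : Filter.Tendsto (fun N : ℕ => K * (1 / 2 : ℝ) ^ (N + 1)) Filter.atTop
        (nhds (K * 0)) :=
      ((Filter.tendsto_add_atTop_iff_nat 1).2 (tendsto_pow_atTop_nhds_zero_of_lt_one
        (by norm_num) (by norm_num))).const_mul K
    rw [mul_zero] at h1
    exact (h1.eventually (ge_mem_nhds (by positivity : (0 : ℝ) < δ / 2))).exists
  refine ⟨N, fun lam hlam E L hL φ hφ => ?_⟩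
  have him : (E + η * I : ℂ).im = η := by simp
  have h := norm_integral_expectation_sub_sum_le_uniform (B := B) (z := E + η * I) hL hμ hlam ha0
    hr huc hs hu1 hu2 hC0 hC hφ (by rw [him]; exact hη) ht0 le_rfl (N + 1)
  rw [him] at h
  have h2 := exp_neg_div_scale_le hη hδ
  have h3 : ∀ n, coeffS L B μ χ n E η δ φ φ = (-1) ^ n * ∫ α : ℝ, laplaceFourier u α *
      coeffT L B μ n (E + η * I + 2 * Real.pi * α) φ φ := by
    intro n
    simp_rw [coeffS, ← fourier_eq_laplaceFourier]
    rfl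
  simp_rw [h3]
  refine h.trans ?_
  rw [← ha] at h2
  linarith

end Cutoff

/-! ### Sums over the dual lattice -/

section Modes

/-- The values of a function of `⌊k / L⌋`, summed over integers `k`: each value occurs at most
`L + 1` times. -/
theorem sum_floor_div_le {L : ℝ} (hL : 1 ≤ L) {c : ℤ → ℝ} (hc0 : ∀ j, 0 ≤ c j) (hc : Summable c)
    (t : Finset ℤ) : ∑ k ∈ t, c ⌊(k : ℝ) / L⌋ ≤ L * (2 * ∑' j, c j) := by
  have hL0 : 0 < L := by linarith
  rw [Finset.sum_comp c fun k : ℤ => ⌊(k : ℝ) / L⌋]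
  have hcard : ∀ j : ℤ, ((t.filter fun k : ℤ => ⌊(k : ℝ) / L⌋ = j).card : ℝ) ≤ 2 * L := by
    intro j
    have hsub : (t.filter fun k : ℤ => ⌊(k : ℝ) / L⌋ = j)
        ⊆ Finset.Ico ⌈(j : ℝ) * L⌉ ⌈((j : ℝ) + 1) * L⌉ := by
      intro k hk
      rw [Finset.mem_filter, Int.floor_eq_iff] at hk
      obtain ⟨-, h1, h2⟩ := hk
      rw [le_div_iff₀ hL0] at h1
      rw [div_lt_iff₀ hL0] at h2
      exact Finset.mem_Ico.2 ⟨Int.ceil_le.2 h1, Int.lt_ceil.2 h2⟩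
    have h1 := Finset.card_le_card hsub
    rw [Int.card_Ico] at h1
    have h2 : ⌈(j : ℝ) * L⌉ ≤ ⌈((j : ℝ) + 1) * L⌉ := Int.ceil_le_ceil (by nlinarith)
    have h3 : ((⌈((j : ℝ) + 1) * L⌉ - ⌈(j : ℝ) * L⌉).toNat : ℝ)
        = (⌈((j : ℝ) + 1) * L⌉ : ℝ) - ⌈(j : ℝ) * L⌉ := by
      have : ((⌈((j : ℝ) + 1) * L⌉ - ⌈(j : ℝ) * L⌉).toNat : ℤ)
        = ⌈((j : ℝ) + 1) * L⌉ - ⌈(j : ℝ) * L⌉ := Int.toNat_of_nonneg (by omega)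
      exact_mod_cast this
    have h4 : ((t.filter fun k : ℤ => ⌊(k : ℝ) / L⌋ = j).card : ℝ)
        ≤ ((⌈((j : ℝ) + 1) * L⌉ - ⌈(j : ℝ) * L⌉).toNat : ℝ) := by exact_mod_cast h1
    have h5 := Int.ceil_lt_add_one (((j : ℝ) + 1) * L)
    have h6 := Int.le_ceil ((j : ℝ) * L)
    rw [h3] at h4
    linarith
  calc ∑ j ∈ t.image fun k : ℤ => ⌊(k : ℝ) / L⌋,
        (t.filter fun k : ℤ => ⌊(k : ℝ) / L⌋ = j).card • c j
      ≤ ∑ j ∈ t.image fun k : ℤ => ⌊(k : ℝ) / L⌋, 2 * L * c j := by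
        refine Finset.sum_le_sum fun j _ => ?_
        rw [nsmul_eq_mul]
        exact mul_le_mul_of_nonneg_right (hcard j) (hc0 j)
    _ ≤ 2 * L * ∑' j, c j := by
        rw [← Finset.mul_sum]
        exact mul_le_mul_of_nonneg_left (hc.sum_le_tsum _ fun j _ => hc0 j) (by positivity)
    _ = _ := by ring

theorem summable_one_add_sq_rpow :
    Summable fun j : ℤ => (1 + (j : ℝ) ^ 2) ^ (-(7 / 12) : ℝ) := by
  refine Summable.of_nonneg_of_le (fun j => by positivity) (fun j => ?_)
    (((Real.summable_abs_int_rpow (b := 7 / 6) (by norm_num))).add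
      (summable_of_hasFiniteSupport (f := fun j : ℤ => if j = 0 then (1 : ℝ) else 0) ?_))
  · by_cases hj : j = 0
    · subst hj
      simp [Real.zero_rpow]
    · have hj0 : 0 < |(j : ℝ)| := abs_pos.2 (by exact_mod_cast hj)
      rw [if_neg hj, add_zero]
      calc (1 + (j : ℝ) ^ 2) ^ (-(7 / 12) : ℝ) ≤ (|(j : ℝ)| ^ 2) ^ (-(7 / 12) : ℝ) := by
            refine Real.rpow_le_rpow_of_nonpos (by positivity) ?_ (by norm_num)
            rw [sq_abs]
            linarith
        _ = |(j : ℝ)| ^ (-(7 / 6) : ℝ) := by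
            rw [← Real.rpow_natCast, ← Real.rpow_mul hj0.le]
            norm_num
  · refine (Set.finite_singleton (0 : ℤ)).subset fun j hj => ?_
    by_contra h
    exact hj (if_neg h)

theorem exists_sum_rpow_le : ∃ K : ℝ, 0 ≤ K ∧ ∀ L : ℝ, 1 ≤ L → ∀ t : Finset ℤ,
    ∑ k ∈ t, (1 + ((k : ℝ) / L) ^ 2) ^ (-(7 / 12) : ℝ) ≤ L * K := by
  set c : ℤ → ℝ := fun j => (3 : ℝ) ^ (7 / 12 : ℝ) * (1 + (j : ℝ) ^ 2) ^ (-(7 / 12) : ℝ) with hc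
  have hc0 : ∀ j, 0 ≤ c j := fun j => by positivity
  have hcs : Summable c := summable_one_add_sq_rpow.mul_left _
  refine ⟨2 * ∑' j, c j, mul_nonneg zero_le_two (tsum_nonneg hc0), fun L hL t => ?_⟩
  refine (Finset.sum_le_sum fun k _ => ?_).trans (sum_floor_div_le hL hc0 hcs t)
  set x : ℝ := (k : ℝ) / L with hx
  have h1 := Int.floor_le x
  have h2 := Int.lt_floor_add_one x
  -- `1 + j² ≤ 3 (1 + x²)` for `j = ⌊x⌋`.
  have h3 : (1 + (⌊x⌋ : ℝ) ^ 2) / 3 ≤ 1 + x ^ 2 := by nlinarith [sq_nonneg (x + 1), sq_nonneg (x - 1)]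
  calc (1 + x ^ 2) ^ (-(7 / 12) : ℝ) ≤ ((1 + (⌊x⌋ : ℝ) ^ 2) / 3) ^ (-(7 / 12) : ℝ) :=
        Real.rpow_le_rpow_of_nonpos (by positivity) h3 (by norm_num)
    _ = c ⌊x⌋ := by
        rw [hc, Real.div_rpow (by positivity) (by norm_num), div_eq_mul_inv,
          ← Real.rpow_neg (by norm_num), neg_neg, mul_comm]

variable {d : ℕ}

/-- An integrable power of `1 + |p|²` in dimension at most three. -/
def modeWeight (p : Space d) : ℝ := (1 + ‖p‖ ^ 2) ^ (-(7 / 4) : ℝ)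

theorem modeWeight_pos (p : Space d) : 0 < modeWeight p := by
  unfold modeWeight
  positivity

theorem modeWeight_le_prod (hd3 : d ≤ 3) (p : Space d) :
    modeWeight p ≤ ∏ j, (1 + p j ^ 2) ^ (-(7 / 12) : ℝ) := by
  set b : ℝ := (1 + ‖p‖ ^ 2) ^ (-(7 / 12) : ℝ) with hb
  have hb0 : 0 ≤ b := by positivity
  have hb1 : b ≤ 1 := Real.rpow_le_one_of_one_le_of_nonpos (by nlinarith [sq_nonneg ‖p‖])
    (by norm_num)
  have h1 : modeWeight p = b ^ 3 := by
    rw [hb, ← Real.rpow_natCast, ← Real.rpow_mul (by positivity), modeWeight]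
    norm_num
  rw [h1]
  calc b ^ 3 ≤ b ^ d := pow_le_pow_of_le_one hb0 hb1 hd3
    _ = ∏ _j : Fin d, b := by simp
    _ ≤ _ := by
      refine Finset.prod_le_prod (fun _ _ => hb0) fun j _ => ?_
      refine Real.rpow_le_rpow_of_nonpos (by positivity) ?_ (by norm_num)
      have h2 := PiLp.norm_apply_le p j
      have h3 : p j ^ 2 ≤ ‖p‖ ^ 2 := by
        rw [← sq_abs]
        exact pow_le_pow_left₀ (abs_nonneg _) h2 2
      linarith

/-- The normalized sum of `modeWeight` over the dual lattice is bounded uniformly in the volume. -/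
theorem exists_sum_modeWeight_le (hd3 : d ≤ 3) : ∃ K : ℝ, 0 ≤ K ∧ ∀ L : ℝ, 1 ≤ L →
    ∀ s : Finset (Fin d → ℤ), ∑ m ∈ s, modeWeight (dualPt L m) ≤ L ^ d * K := by
  classical
  obtain ⟨K, hK0, hK⟩ := exists_sum_rpow_le
  refine ⟨K ^ d, by positivity, fun L hL s => ?_⟩
  set g : ℤ → ℝ := fun k => (1 + ((k : ℝ) / L) ^ 2) ^ (-(7 / 12) : ℝ) with hg
  have hg0 : ∀ k, 0 ≤ g k := fun k => by positivity
  have hsub : s ⊆ Fintype.piFinset fun j => s.image fun m => m j := by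
    intro m hm
    rw [Fintype.mem_piFinset]
    exact fun j => Finset.mem_image_of_mem _ hm
  calc ∑ m ∈ s, modeWeight (dualPt L m) ≤ ∑ m ∈ s, ∏ j, g (m j) :=
        Finset.sum_le_sum fun m _ => modeWeight_le_prod hd3 _
    _ ≤ ∑ m ∈ Fintype.piFinset fun j => s.image fun m => m j, ∏ j, g (m j) :=
        Finset.sum_le_sum_of_subset_of_nonneg hsub fun m _ _ =>
          Finset.prod_nonneg fun j _ => hg0 _
    _ = ∏ j, ∑ k ∈ s.image fun m => m j, g k := (Finset.prod_univ_sum _ _).symm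
    _ ≤ ∏ _j : Fin d, L * K := Finset.prod_le_prod
        (fun j _ => Finset.sum_nonneg fun k _ => hg0 k) fun j _ => hK L hL _
    _ = L ^ d * K ^ d := by simp [mul_pow]

theorem exists_summable_modeWeight (hd3 : d ≤ 3) : ∃ K : ℝ, 0 < K ∧ ∀ L : ℝ, 1 ≤ L →
    (Summable fun m : Fin d → ℤ => modeWeight (dualPt L m)) ∧
      (L ^ d)⁻¹ * ∑' m : Fin d → ℤ, modeWeight (dualPt L m) ≤ K := by
  obtain ⟨K, hK0, hK⟩ := exists_sum_modeWeight_le hd3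
  refine ⟨K + 1, by positivity, fun L hL => ?_⟩
  have hs : Summable fun m : Fin d → ℤ => modeWeight (dualPt L m) :=
    summable_of_sum_le (fun m => (modeWeight_pos _).le) (hK L hL)
  refine ⟨hs, ?_⟩
  rw [inv_mul_le_iff₀ (by positivity)]
  refine (hs.tsum_le_of_sum_le (hK L hL)).trans ?_
  have : 0 < L ^ d := by positivity
  nlinarith

theorem modeWeight_anti {p : Space d} {κ : ℝ} (hp : ‖p‖ ≤ κ) :
    (1 + κ ^ 2) ^ (-(7 / 4) : ℝ) ≤ modeWeight p := by
  refine Real.rpow_le_rpow_of_nonpos (by positivity) ?_ (by norm_num)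
  have := pow_le_pow_left₀ (norm_nonneg p) hp 2
  linarith

theorem finite_modes (hd3 : d ≤ 3) {L : ℝ} (hL : 1 ≤ L) (κ : ℝ) :
    Finite {m : Fin d → ℤ // ‖dualPt L m‖ ≤ κ} := by
  obtain ⟨K, -, hK⟩ := exists_summable_modeWeight hd3
  have h := (hK L hL).1.tendsto_cofinite_zero
  have hpos : (0 : ℝ) < (1 + κ ^ 2) ^ (-(7 / 4) : ℝ) := by positivity
  have h2 := h.eventually (gt_mem_nhds hpos)
  rw [Filter.eventually_cofinite] at h2
  exact (h2.subset fun m hm => not_lt.2 (modeWeight_anti hm)).to_subtype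

theorem dualInt_mono (hd3 : d ≤ 3) {L : ℝ} (hL : 1 ≤ L) {κ : ℝ} {g h : (Fin d → ℤ) → ℝ}
    (hgh : ∀ m, ‖dualPt L m‖ ≤ κ → g m ≤ h m) : dualInt L κ g ≤ dualInt L κ h := by
  have := finite_modes hd3 hL κ
  unfold dualInt
  refine mul_le_mul_of_nonneg_left ?_ (by positivity)
  exact Summable.tsum_le_tsum (fun m => hgh m m.2) Summable.of_finite Summable.of_finite

theorem dualInt_const_mul (L κ c : ℝ) (g : (Fin d → ℤ) → ℝ) :
    dualInt L κ (fun m => c * g m) = c * dualInt L κ g := by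
  unfold dualInt
  rw [tsum_mul_left]
  ring

theorem dualInt_sum (hd3 : d ≤ 3) {L : ℝ} (hL : 1 ≤ L) (κ : ℝ) {ι : Type*} (s : Finset ι)
    (g : ι → (Fin d → ℤ) → ℝ) :
    ∑ i ∈ s, dualInt L κ (g i) = dualInt L κ fun m => ∑ i ∈ s, g i m := by
  have := finite_modes hd3 hL κ
  unfold dualInt
  rw [← Finset.mul_sum, Summable.tsum_finsetSum fun i _ => Summable.of_finite]

theorem dualInt_sub (hd3 : d ≤ 3) {L : ℝ} (hL : 1 ≤ L) (κ : ℝ) (g h : (Fin d → ℤ) → ℝ) :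
    dualInt L κ g - dualInt L κ h = dualInt L κ fun m => g m - h m := by
  have := finite_modes hd3 hL κ
  unfold dualInt
  rw [← mul_sub, Summable.tsum_sub Summable.of_finite Summable.of_finite]

theorem abs_dualInt_le (hd3 : d ≤ 3) {L : ℝ} (hL : 1 ≤ L) (κ : ℝ) (g : (Fin d → ℤ) → ℝ) :
    |dualInt L κ g| ≤ dualInt L κ fun m => |g m| := by
  rw [abs_le]
  constructor
  · have h := dualInt_mono hd3 hL (κ := κ) (g := fun m => -1 * |g m|) (h := g) fun m _ => by
      simpa using neg_abs_le (g m)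
    rw [dualInt_const_mul] at h
    linarith
  · exact dualInt_mono hd3 hL fun m _ => le_abs_self _

theorem dualInt_one_le_modeBound (hd3 : d ≤ 3) {L : ℝ} (hL : 1 ≤ L) (κ : ℝ) :
    dualInt (d := d) L κ (fun _ => 1) ≤ modeBound d κ := by
  obtain ⟨K, hK0, hK⟩ := exists_summable_modeWeight hd3
  refine le_csSup ⟨((1 + κ ^ 2) ^ (-(7 / 4) : ℝ))⁻¹ * K, ?_⟩ ⟨L, hL, rfl⟩
  rintro x ⟨L', hL', rfl⟩
  have hpos : (0 : ℝ) < (1 + κ ^ 2) ^ (-(7 / 4) : ℝ) := by positivity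
  have hfin := finite_modes hd3 hL' κ
  refine (dualInt_mono hd3 hL' (h := fun m => ((1 + κ ^ 2) ^ (-(7 / 4) : ℝ))⁻¹
    * modeWeight (dualPt L' m)) fun m hm => ?_).trans ?_
  · rw [le_inv_mul_iff₀ hpos, mul_one]
    exact modeWeight_anti hm
  · rw [dualInt_const_mul]
    refine mul_le_mul_of_nonneg_left (le_trans ?_ (hK L' hL').2) (by positivity)
    unfold dualInt
    refine mul_le_mul_of_nonneg_left ?_ (by positivity)
    exact Summable.tsum_subtype_le _ _ (fun m => (modeWeight_pos _).le) (hK L' hL').1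

theorem modeBound_pos (hd3 : d ≤ 3) {κ : ℝ} (hκ : 0 < κ) : 0 < modeBound d κ := by
  refine lt_of_lt_of_le one_pos (le_trans ?_ (dualInt_one_le_modeBound hd3 le_rfl κ))
  have := finite_modes hd3 le_rfl (d := d) κ
  have h0 : ‖dualPt (1 : ℝ) (0 : Fin d → ℤ)‖ ≤ κ := by
    have : dualPt (1 : ℝ) (0 : Fin d → ℤ) = 0 := by
      ext j
      simp [dualPt]
    rw [this, norm_zero]
    exact hκ.le
  unfold dualInt
  have hs : Summable fun _ : {m : Fin d → ℤ // ‖dualPt (1 : ℝ) m‖ ≤ κ} => (1 : ℝ) :=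
    Summable.of_finite
  have h1 := hs.le_tsum ⟨0, h0⟩ fun _ _ => zero_le_one
  simpa using h1

/-- The part of a sum over the dual lattice outside the ball of radius `κ`. -/
theorem abs_tsum_sub_dualInt_le {L : ℝ} (hL : 0 < L) (κ : ℝ) {g h : (Fin d → ℤ) → ℝ}
    (hg : Summable g) (hh : Summable h) (hh0 : ∀ m, 0 ≤ h m)
    (hgh : ∀ m, κ < ‖dualPt L m‖ → |g m| ≤ h m) :
    |(L ^ d)⁻¹ * ∑' m, g m - dualInt L κ g| ≤ (L ^ d)⁻¹ * ∑' m, h m := by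
  set s : Set (Fin d → ℤ) := {m | ‖dualPt L m‖ ≤ κ} with hs
  have h1 := hg.tsum_subtype_add_tsum_subtype_compl s
  have h2 : (L ^ d)⁻¹ * ∑' m, g m - dualInt L κ g = (L ^ d)⁻¹ * ∑' m : ↑sᶜ, g m := by
    unfold dualInt
    rw [← mul_sub, ← h1]
    congr 1
    exact add_sub_cancel_left _ _
  rw [h2, abs_mul, abs_of_nonneg (by positivity : 0 ≤ (L ^ d)⁻¹)]
  refine mul_le_mul_of_nonneg_left ?_ (by positivity)
  refine le_trans ?_ (Summable.tsum_subtype_le h sᶜ hh0 hh)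
  refine tsum_of_norm_bounded (f := fun m : ↑sᶜ => g m) (hh.subtype sᶜ).hasSum fun m => ?_
  exact hgh m (not_le.1 m.2)

end Modes

/-! ### The diagonal elements of the smoothed spectral density -/

section Diagonal

variable {d : ℕ} {L : ℝ} {B : 𝓢(Space d, ℝ)} {μ : Measure ℝ} {lam lam₀ E E₀ η : ℝ}

theorem norm_planeWave (hL : 0 < L) (m : Fin d → ℤ) : ‖planeWave L m‖ = 1 :=
  (orthonormal_planeWave hL).1 m

/-- The diagonal element `⟨φ_p, f_{E,η}(H) φ_p⟩ = η ‖(H - E + iη)⁻¹ φ_p‖²`. -/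
def diagReal (L : ℝ) (B : 𝓢(Space d, ℝ)) (lam E η : ℝ) (m : Fin d → ℤ) (ω : Config d) : ℝ :=
  η * ‖resolventOp (hamiltonian L B lam ω) (E - η * I) (planeWave L m)‖ ^ 2

theorem diagReal_nonneg (hη : 0 < η) (m : Fin d → ℤ) (ω : Config d) :
    0 ≤ diagReal L B lam E η m ω := by
  unfold diagReal
  positivity

theorem diagElt_lorentzian (hL : 0 < L) (hη : 0 < η) (m : Fin d → ℤ) (ω : Config d) :
    diagElt (lorentzian (hamiltonian L B lam ω) E η) m = (diagReal L B lam E η m ω : ℂ) :=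
  (hasRealResolvent_hamiltonian hL lam ω).inner_lorentzian_eq_norm_sq E hη _

theorem diagReal_eq_im (hL : 0 < L) (hη : 0 < η) (m : Fin d → ℤ) (ω : Config d) :
    diagReal L B lam E η m ω
      = (expectation (planeWave L m) (resolventOp (hamiltonian L B lam ω) (E + η * I))).im := by
  refine Complex.ofReal_injective ?_
  rw [← diagElt_lorentzian hL hη]
  exact (hasRealResolvent_hamiltonian hL lam ω).inner_lorentzian E hη _

theorem traceL_lorentzian (hL : 0 < L) (hη : 0 < η) (ω : Config d) :
    traceL (lorentzian (hamiltonian L B lam ω) E η)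
      = ((∑' m, diagReal L B lam E η m ω : ℝ) : ℂ) := by
  unfold traceL
  rw [Complex.ofReal_tsum]
  exact tsum_congr fun m => diagElt_lorentzian hL hη m ω

theorem measurable_diagReal (hL : 0 < L) (hη : 0 < η) (m : Fin d → ℤ) :
    Measurable (diagReal L B lam E η m) := by
  have him : ((E : ℂ) - η * I).im ≠ 0 := by simpa using hη.ne'
  exact ((stronglyMeasurable_resolventOp_hamiltonian hL lam him
    (planeWave L m)).norm.measurable.pow_const 2).const_mul η

/-- The constant `A` with `(1 + p²)² ≤ A ((ν(p) - E)² + η²)` for `|E| ≤ E₀`. -/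
def energyConst (E₀ η : ℝ) : ℝ := 2 * (1 + 2 * E₀) ^ 2 / η ^ 2 + 8

theorem energyConst_pos : 0 < energyConst E₀ η := by
  unfold energyConst
  positivity

theorem sq_le_energyConst_mul (hη : 0 < η) (hE : E ∈ Set.Icc (-E₀) E₀) (p : Space d) :
    (1 + ‖p‖ ^ 2) ^ 2 ≤ energyConst E₀ η * ((energy p - E) ^ 2 + η ^ 2) := by
  set y := energy p - E with hy
  have hp : 1 + ‖p‖ ^ 2 = 1 + 2 * E + 2 * y := by
    rw [hy, energy]
    ring
  have hE0 : 0 ≤ E₀ := by linarith [hE.1.trans hE.2]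
  have h1 : (1 + 2 * E) ^ 2 ≤ (1 + 2 * E₀) ^ 2 :=
    sq_le_sq' (by linarith [hE.1]) (by linarith [hE.2])
  have h2 : energyConst E₀ η * (y ^ 2 + η ^ 2)
      = 2 * (1 + 2 * E₀) ^ 2 * y ^ 2 / η ^ 2 + 8 * y ^ 2 + 2 * (1 + 2 * E₀) ^ 2 + 8 * η ^ 2 := by
    unfold energyConst
    field_simp
    ring
  have h3 : 0 ≤ 2 * (1 + 2 * E₀) ^ 2 * y ^ 2 / η ^ 2 := by positivity
  rw [hp, h2]
  nlinarith [sq_nonneg (1 + 2 * E - 2 * y), sq_nonneg η]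

theorem norm_inv_energy_sub_sq_le (hη : 0 < η) (hE : E ∈ Set.Icc (-E₀) E₀) (p : Space d) :
    ‖((energy p : ℂ) - (E - η * I))⁻¹‖ ^ 2 ≤ energyConst E₀ η * ((1 + ‖p‖ ^ 2) ^ 2)⁻¹ := by
  have h1 : ‖(energy p : ℂ) - (E - η * I)‖ ^ 2 = (energy p - E) ^ 2 + η ^ 2 := by
    rw [← Complex.normSq_eq_norm_sq, Complex.normSq_apply]
    simp
    ring
  rw [norm_inv, inv_pow, h1, ← div_eq_mul_inv, inv_le_comm₀ (by positivity)
    (div_pos energyConst_pos (by positivity)), inv_div, div_le_iff₀ energyConst_pos, mul_comm]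
  exact sq_le_energyConst_mul hη hE p

/-- One step of the resolvent expansion shows the decay of the diagonal elements at large
momenta. -/
theorem diagReal_le (hL : 0 < L) (hη : 0 < η) (hlam : lam ∈ Set.Icc 0 lam₀)
    (hE : E ∈ Set.Icc (-E₀) E₀) (m : Fin d → ℤ) (ω : Config d) :
    diagReal L B lam E η m ω ≤ 2 * η * energyConst E₀ η * ((1 + ‖dualPt L m‖ ^ 2) ^ 2)⁻¹
      * (1 + (η⁻¹ * lam₀) ^ 2 * ‖potentialOp L B ω (planeWave L m)‖ ^ 2) := by
  have him : ((E : ℂ) - η * I).im ≠ 0 := by simpa using hη.ne'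
  have hT := hasRealResolvent_kinetic (d := d) hL
  have hH := hasRealResolvent_hamiltonian (B := B) hL lam ω
  set z : ℂ := E - η * I with hz
  set φ := planeWave (d := d) L m with hφ
  set c : ℂ := ((energy (dualPt L m) : ℂ) - z)⁻¹ with hc
  set R := resolventOp (hamiltonian L B lam ω) z with hRdef
  have hR : ‖R‖ ≤ η⁻¹ := by
    have h := hH.norm_resolventOp_le him
    rwa [show z.im = -η by simp [hz], abs_neg, abs_of_pos hη] at h
  have h1 : R φ = c • (φ - (lam : ℂ) • R (potentialOp L B ω φ)) := by
    have h := congrArg (fun A : L2Box d L →L[ℂ] L2Box d L => A φ)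
      ((hH.isResolventAt him).pert_eq_sub (W := (lam : ℂ) • potentialOp L B ω)
        (hT.isResolventAt him))
    change R φ = resolventOp (kinetic d L) z φ
      - R ((lam : ℂ) • potentialOp L B ω (resolventOp (kinetic d L) z φ)) at h
    rw [resolventOp_kinetic_planeWave hL him] at h
    rw [h, map_smul, map_smul, map_smul, smul_sub, smul_comm c]
  have hV := norm_nonneg (potentialOp L B ω φ)
  have h2 : ‖R φ‖ ≤ ‖c‖ * (1 + η⁻¹ * lam₀ * ‖potentialOp L B ω φ‖) := by
    rw [h1, norm_smul]
    refine mul_le_mul_of_nonneg_left ?_ (norm_nonneg _)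
    refine (norm_sub_le _ _).trans (add_le_add (norm_planeWave hL m).le ?_)
    rw [norm_smul, Complex.norm_real, Real.norm_of_nonneg hlam.1]
    calc lam * ‖R (potentialOp L B ω φ)‖ ≤ lam₀ * (η⁻¹ * ‖potentialOp L B ω φ‖) :=
          mul_le_mul hlam.2 ((R.le_opNorm _).trans (mul_le_mul_of_nonneg_right hR hV))
            (norm_nonneg _) (hlam.1.trans hlam.2)
      _ = _ := by ring
  have h3 : ‖c‖ ^ 2 ≤ energyConst E₀ η * ((1 + ‖dualPt L m‖ ^ 2) ^ 2)⁻¹ :=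
    norm_inv_energy_sub_sq_le hη hE _
  set v := η⁻¹ * lam₀ * ‖potentialOp L B ω φ‖ with hv
  have h4 : (η⁻¹ * lam₀) ^ 2 * ‖potentialOp L B ω φ‖ ^ 2 = v ^ 2 := by
    rw [hv]
    ring
  rw [h4]
  calc diagReal L B lam E η m ω = η * ‖R φ‖ ^ 2 := rfl
    _ ≤ η * (‖c‖ * (1 + v)) ^ 2 := by gcongr
    _ = η * ‖c‖ ^ 2 * (1 + v) ^ 2 := by ring
    _ ≤ η * (energyConst E₀ η * ((1 + ‖dualPt L m‖ ^ 2) ^ 2)⁻¹) * (2 * (1 + v ^ 2)) := by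
        refine mul_le_mul (mul_le_mul_of_nonneg_left h3 hη.le) ?_ (by positivity) ?_
        · nlinarith [sq_nonneg (1 - v)]
        · have := energyConst_pos (E₀ := E₀) (η := η)
          positivity
    _ = _ := by ring

theorem inv_sq_le_modeWeight (p : Space d) : ((1 + ‖p‖ ^ 2) ^ 2)⁻¹ ≤ modeWeight p := by
  rw [modeWeight, ← Real.rpow_natCast, ← Real.rpow_neg (by positivity)]
  exact Real.rpow_le_rpow_of_exponent_le (by nlinarith [sq_nonneg ‖p‖]) (by norm_num)

theorem inv_sq_le_mul_modeWeight {κ : ℝ} (hκ : 0 ≤ κ) {p : Space d} (hp : κ < ‖p‖) :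
    ((1 + ‖p‖ ^ 2) ^ 2)⁻¹ ≤ (1 + κ ^ 2) ^ (-(1 / 4) : ℝ) * modeWeight p := by
  have h1 : ((1 + ‖p‖ ^ 2) ^ 2)⁻¹ = (1 + ‖p‖ ^ 2) ^ (-(1 / 4) : ℝ) * modeWeight p := by
    rw [modeWeight, ← Real.rpow_natCast, ← Real.rpow_neg (by positivity),
      ← Real.rpow_add (by positivity)]
    norm_num
  rw [h1]
  refine mul_le_mul_of_nonneg_right ?_ (modeWeight_pos p).le
  refine Real.rpow_le_rpow_of_nonpos (by positivity) ?_ (by norm_num)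
  have := pow_le_pow_left₀ hκ hp.le 2
  linarith

theorem summable_diagReal (hd3 : d ≤ 3) (hL : 1 ≤ L) (hη : 0 < η) (hlam : lam ∈ Set.Icc 0 lam₀)
    (hE : E ∈ Set.Icc (-E₀) E₀) (ω : Config d) :
    (Summable fun m => diagReal L B lam E η m ω) ∧ ∑' m, diagReal L B lam E η m ω
      ≤ 2 * η * energyConst E₀ η * (1 + (η⁻¹ * lam₀) ^ 2 * ‖potentialOp L B ω‖ ^ 2)
        * ∑' m : Fin d → ℤ, modeWeight (dualPt L m) := by
  have hL0 : 0 < L := by linarith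
  obtain ⟨K, -, hK⟩ := exists_summable_modeWeight hd3
  have hA := energyConst_pos (E₀ := E₀) (η := η)
  have hle : ∀ m, diagReal L B lam E η m ω ≤ 2 * η * energyConst E₀ η
      * (1 + (η⁻¹ * lam₀) ^ 2 * ‖potentialOp L B ω‖ ^ 2) * modeWeight (dualPt L m) := by
    intro m
    refine (diagReal_le hL0 hη hlam hE m ω).trans ?_
    rw [mul_right_comm]
    have h1 : ‖potentialOp L B ω (planeWave L m)‖ ≤ ‖potentialOp L B ω‖ := by
      simpa [norm_planeWave hL0] using (potentialOp L B ω).le_opNorm (planeWave L m)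
    have h2 := inv_sq_le_modeWeight (dualPt L m)
    gcongr
  have hs := (hK L hL).1.mul_left (2 * η * energyConst E₀ η
    * (1 + (η⁻¹ * lam₀) ^ 2 * ‖potentialOp L B ω‖ ^ 2))
  have hsum := Summable.of_nonneg_of_le (fun m => diagReal_nonneg hη m ω) hle hs
  refine ⟨hsum, ?_⟩
  rw [← tsum_mul_left]
  exact hsum.tsum_le_tsum hle hs

variable [IsProbabilityMeasure μ]

theorem integrable_diagReal (hL : 0 < L) (hη : 0 < η) (m : Fin d → ℤ) :
    Integrable (diagReal L B lam E η m) (configLaw d L μ) := by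
  have him : ((E : ℂ) + η * I).im ≠ 0 := by simpa using hη.ne'
  have h := (integrable_expectation_resolventOp (B := B) (μ := μ) hL lam him
    (norm_planeWave hL m)).im
  exact h.congr (.of_forall fun ω => (diagReal_eq_im hL hη m ω).symm)

/-- A bound for the averaged diagonal elements, up to the decay in the momentum. -/
def diagConst (B : 𝓢(Space d, ℝ)) (lam₀ E₀ η : ℝ) : ℝ :=
  2 * η * energyConst E₀ η
    * (1 + (η⁻¹ * lam₀) ^ 2 * (2 * profileBound B ^ 2 * Real.exp (Real.exp 1 - 1)))

theorem diagConst_pos (hη : 0 < η) : 0 < diagConst B lam₀ E₀ η := by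
  have hA := energyConst_pos (E₀ := E₀) (η := η)
  unfold diagConst
  positivity

theorem integral_diagReal_le (hL : 1 ≤ L) (hμ : ∀ᵐ v ∂μ, |v| ≤ 1) (hη : 0 < η)
    (hlam : lam ∈ Set.Icc 0 lam₀) (hE : E ∈ Set.Icc (-E₀) E₀) (m : Fin d → ℤ) :
    ∫ ω, diagReal L B lam E η m ω ∂(configLaw d L μ)
      ≤ diagConst B lam₀ E₀ η * ((1 + ‖dualPt L m‖ ^ 2) ^ 2)⁻¹ := by
  have hL0 : 0 < L := by linarith
  have := isProbabilityMeasure_configLaw (d := d) (μ := μ) hL0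
  have hφ := norm_planeWave hL0 m
  have hi := integrable_norm_potentialOp_sq (B := B) (μ := μ) hL0 hμ hφ
  have hb := integral_norm_potentialOp_sq_le (B := B) (μ := μ) hL hμ hφ
  have hA := energyConst_pos (E₀ := E₀) (η := η)
  refine (integral_mono (integrable_diagReal hL0 hη m)
    (((integrable_const (1 : ℝ)).add (hi.const_mul _)).const_mul _)
    (diagReal_le hL0 hη hlam hE m)).trans ?_
  rw [integral_const_mul]
  have h2 : ∫ ω, ((1 : ℝ) + (η⁻¹ * lam₀) ^ 2 * ‖potentialOp L B ω (planeWave L m)‖ ^ 2)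
      ∂(configLaw d L μ) ≤ 1 + (η⁻¹ * lam₀) ^ 2
        * (2 * profileBound B ^ 2 * Real.exp (Real.exp 1 - 1)) := by
    rw [integral_add (integrable_const _) (hi.const_mul _), integral_const_mul]
    simp only [integral_const, probReal_univ, smul_eq_mul, mul_one]
    gcongr
  refine (mul_le_mul_of_nonneg_left h2 (by positivity)).trans (le_of_eq ?_)
  unfold diagConst
  ring

theorem integrable_tsum_diagReal (hd3 : d ≤ 3) (hL : 1 ≤ L) (hμ : ∀ᵐ v ∂μ, |v| ≤ 1)
    (hη : 0 < η) (hlam : lam ∈ Set.Icc 0 lam₀) (hE : E ∈ Set.Icc (-E₀) E₀) :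
    Integrable (fun ω => ∑' m, diagReal L B lam E η m ω) (configLaw d L μ) := by
  have hL0 : 0 < L := by linarith
  have := isProbabilityMeasure_configLaw (d := d) (μ := μ) hL0
  have hA := energyConst_pos (E₀ := E₀) (η := η)
  have hB := profileBound_pos (B := B)
  have hmeas : Measurable fun ω => ∑' m, diagReal L B lam E η m ω :=
    Measurable.tsum fun m => measurable_diagReal hL0 hη m
  set W : ℝ := ∑' m : Fin d → ℤ, modeWeight (dualPt L m) with hW
  have hW0 : 0 ≤ W := tsum_nonneg fun m => (modeWeight_pos _).le
  have hdom : Integrable (fun ω : Config d => 2 * η * energyConst E₀ η *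
      (1 + (η⁻¹ * lam₀) ^ 2 * Real.exp (2 * profileBound B * ω.1)) * W) (configLaw d L μ) :=
    (((integrable_const (1 : ℝ)).add ((integrable_exp_configLaw hL0 _).const_mul _)).const_mul
      _).mul_const _
  refine hdom.mono' hmeas.aestronglyMeasurable ?_
  filter_upwards [ae_configLaw_weights hL0 hμ] with ω hω
  rw [Real.norm_of_nonneg (tsum_nonneg fun m => diagReal_nonneg hη m ω)]
  refine (summable_diagReal hd3 hL hη hlam hE ω).2.trans ?_
  have h1 : ‖potentialOp L B ω‖ ^ 2 ≤ Real.exp (2 * profileBound B * ω.1) := by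
    have h2 : ‖potentialOp L B ω‖ ≤ Real.exp (profileBound B * ω.1) := by
      refine (norm_potentialOp_le hω).trans ?_
      have := Real.add_one_le_exp (profileBound B * ω.1)
      linarith
    rw [show 2 * profileBound B * (ω.1 : ℝ) = profileBound B * ω.1 + profileBound B * ω.1 by ring,
      Real.exp_add, ← pow_two]
    exact pow_le_pow_left₀ (norm_nonneg _) h2 2
  gcongr

/-- The averaged trace is the sum of the averaged diagonal elements. -/
theorem hasSum_integral_diagReal (hd3 : d ≤ 3) (hL : 1 ≤ L) (hμ : ∀ᵐ v ∂μ, |v| ≤ 1)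
    (hη : 0 < η) (hlam : lam ∈ Set.Icc 0 lam₀) (hE : E ∈ Set.Icc (-E₀) E₀) :
    HasSum (fun m => ∫ ω, diagReal L B lam E η m ω ∂(configLaw d L μ))
      (∫ ω, ∑' m, diagReal L B lam E η m ω ∂(configLaw d L μ)) := by
  have hL0 : 0 < L := by linarith
  obtain ⟨K, -, hK⟩ := exists_summable_modeWeight hd3
  refine hasSum_integral_of_summable_integral_norm (fun m => integrable_diagReal hL0 hη m) ?_
  refine Summable.of_nonneg_of_le (fun m => integral_nonneg fun ω => norm_nonneg _) (fun m => ?_)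
    ((hK L hL).1.mul_left (diagConst B lam₀ E₀ η))
  have h1 : ∀ ω, ‖diagReal L B lam E η m ω‖ = diagReal L B lam E η m ω := fun ω =>
    Real.norm_of_nonneg (diagReal_nonneg hη m ω)
  simp_rw [h1]
  exact (integral_diagReal_le hL hμ hη hlam hE m).trans
    (mul_le_mul_of_nonneg_left (inv_sq_le_modeWeight _) (diagConst_pos hη).le)

/-- The momentum cutoff can be chosen uniformly in the volume, the energy and the coupling. -/
theorem exists_cutoff (hd3 : d ≤ 3) (B : 𝓢(Space d, ℝ)) (hμ : ∀ᵐ v ∂μ, |v| ≤ 1) (hη : 0 < η)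
    {ε : ℝ} (hε : 0 < ε) (lam₀ E₀ : ℝ) :
    ∃ κ : ℝ, 0 < κ ∧ ∀ lam ∈ Set.Icc 0 lam₀, ∀ E ∈ Set.Icc (-E₀) E₀, ∀ L : ℝ, 1 ≤ L →
      |(L ^ d)⁻¹ * (∫ ω, ∑' m, diagReal L B lam E η m ω ∂(configLaw d L μ))
        - dualInt L κ fun m => ∫ ω, diagReal L B lam E η m ω ∂(configLaw d L μ)| ≤ ε := by
  obtain ⟨K, hK0, hK⟩ := exists_summable_modeWeight hd3
  have hD := diagConst_pos (B := B) (lam₀ := lam₀) (E₀ := E₀) hη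
  set D := diagConst B lam₀ E₀ η with hDdef
  obtain ⟨κ, hκ, hκ0⟩ : ∃ κ : ℝ, D * (1 + κ ^ 2) ^ (-(1 / 4) : ℝ) * K ≤ ε ∧ 0 < κ := by
    have h1 : Filter.Tendsto (fun κ : ℝ => 1 + κ ^ 2) Filter.atTop Filter.atTop :=
      Filter.tendsto_atTop_add_const_left _ _ (Filter.tendsto_pow_atTop two_ne_zero)
    have h2 := (((tendsto_rpow_neg_atTop (by norm_num : (0 : ℝ) < 1 / 4)).comp h1).const_mul
      D).mul_const K
    rw [mul_zero, zero_mul] at h2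
    exact ((h2.eventually (ge_mem_nhds hε)).and (Filter.eventually_gt_atTop 0)).exists
  refine ⟨κ, hκ0, fun lam hlam E hE L hL => ?_⟩
  have hL0 : 0 < L := by linarith
  have hs := hasSum_integral_diagReal (B := B) hd3 hL hμ hη hlam hE
  rw [← hs.tsum_eq]
  refine (abs_tsum_sub_dualInt_le hL0 κ hs.summable
    (h := fun m => D * (1 + κ ^ 2) ^ (-(1 / 4) : ℝ) * modeWeight (dualPt L m))
    ((hK L hL).1.mul_left _) (fun m => ?_) fun m hm => ?_).trans ?_
  · have := modeWeight_pos (dualPt L m)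
    positivity
  · rw [abs_of_nonneg (integral_nonneg fun ω => diagReal_nonneg hη m ω), mul_assoc]
    exact (integral_diagReal_le hL hμ hη hlam hE m).trans
      (mul_le_mul_of_nonneg_left (inv_sq_le_mul_modeWeight hκ0.le hm) hD.le)
  · rw [tsum_mul_left, mul_left_comm]
    exact (mul_le_mul_of_nonneg_left (hK L hL).2 (by positivity)).trans hκ

/-- Taking imaginary parts in an expansion of the averaged resolvent. -/
theorem abs_integral_diagReal_sub_le (hL : 0 < L) (hη : 0 < η) {δ : ℝ} (m : Fin d → ℤ) {N : ℕ}
    {S : ℕ → ℂ} (h : ‖(∫ ω, expectation (planeWave L m)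
      (resolventOp (hamiltonian L B lam ω) (E + η * I)) ∂(configLaw d L μ))
        - ∑ n ∈ Finset.range N, (lam : ℂ) ^ n * S n‖ ≤ δ) :
    |(∫ ω, diagReal L B lam E η m ω ∂(configLaw d L μ))
      - ∑ n ∈ Finset.range N, lam ^ n * (S n).im| ≤ δ := by
  have him : ((E : ℂ) + η * I).im ≠ 0 := by simpa using hη.ne'
  have hi := integrable_expectation_resolventOp (B := B) (μ := μ) hL lam him (norm_planeWave hL m)
  have h1 : ∫ ω, diagReal L B lam E η m ω ∂(configLaw d L μ)
      = (∫ ω, expectation (planeWave L m)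
        (resolventOp (hamiltonian L B lam ω) (E + η * I)) ∂(configLaw d L μ)).im := by
    simp_rw [diagReal_eq_im hL hη]
    exact integral_im hi
  have h2 : ∑ n ∈ Finset.range N, lam ^ n * (S n).im
      = (∑ n ∈ Finset.range N, (lam : ℂ) ^ n * S n).im := by
    rw [Complex.im_sum]
    refine Finset.sum_congr rfl fun n _ => ?_
    rw [← Complex.ofReal_pow, Complex.im_ofReal_mul]
  rw [h1, h2, ← Complex.sub_im]
  exact (Complex.abs_im_le_norm _).trans h

end Diagonal

end PoissonDOS

end

theorem mainTheorem2 (d : ℕ) (hd1 : 1 ≤ d) (hd3 : d ≤ 3)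
    (B : 𝓢(PoissonDOS.Space d, ℝ)) (hB : PoissonDOS.AdmissibleProfile B)
    (μ : Measure ℝ) [IsProbabilityMeasure μ] (hμ : PoissonDOS.BoundedMoments μ)
    (hpos : ∀ᵐ v ∂μ, 0 < v)
    (χ : ℝ → ℝ) (hχ : PoissonDOS.IsCutoff χ)
    (η ε lam₀ E₀ : ℝ) (hη : 0 < η) (hε : 0 < ε) (hlam₀ : 0 < lam₀) (hE₀ : 0 < E₀) :
    ∃ (N : ℕ) (κ : ℝ), 0 < κ ∧
      ∀ lam ∈ Set.Icc 0 lam₀, ∀ E ∈ Set.Icc (-E₀) E₀, ∀ L : ℝ, 1 ≤ L →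
        (∀ᵐ ω ∂(PoissonDOS.configLaw d L μ), Summable
          (PoissonDOS.diagElt (PoissonDOS.lorentzian (PoissonDOS.hamiltonian L B lam ω) E η))) ∧
        Integrable (fun ω => PoissonDOS.traceL
          (PoissonDOS.lorentzian (PoissonDOS.hamiltonian L B lam ω) E η))
          (PoissonDOS.configLaw d L μ) ∧
        ‖((L : ℂ) ^ d)⁻¹ * (∫ ω, PoissonDOS.traceL
            (PoissonDOS.lorentzian (PoissonDOS.hamiltonian L B lam ω) E η)
            ∂(PoissonDOS.configLaw d L μ)) -
          ((∑ n ∈ Finset.range (N + 1), PoissonDOS.dualInt L κ (fun q => lam ^ n *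
            (PoissonDOS.coeffS L B μ χ n E η (ε / (2 * PoissonDOS.modeBound d κ))
              (PoissonDOS.planeWave L q) (PoissonDOS.planeWave L q)).im) : ℝ) : ℂ)‖ ≤ ε := by
  have hw := hμ.ae_abs_le_one
  obtain ⟨κ, hκ0, hκ⟩ := PoissonDOS.exists_cutoff hd3 B hw hη (half_pos hε) lam₀ E₀
  have hM := PoissonDOS.modeBound_pos hd3 hκ0
  set δ : ℝ := ε / (2 * PoissonDOS.modeBound d κ) with hδdef
  have hδ : 0 < δ := by positivity
  obtain ⟨N, hN⟩ := PoissonDOS.exists_order B hw hχ hη hδ hlam₀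
  refine ⟨N, κ, hκ0, fun lam hlam E hE L hL => ?_⟩
  have hL0 : 0 < L := by linarith
  refine ⟨.of_forall fun ω => ?_, ?_, ?_⟩
  · have h := (PoissonDOS.summable_diagReal (B := B) hd3 hL hη hlam hE ω).1
    refine (Complex.summable_ofReal.2 h).congr fun m => ?_
    exact (PoissonDOS.diagElt_lorentzian hL0 hη m ω).symm
  · simp_rw [PoissonDOS.traceL_lorentzian hL0 hη]
    exact (PoissonDOS.integrable_tsum_diagReal hd3 hL hw hη hlam hE).ofReal
  · simp_rw [PoissonDOS.traceL_lorentzian hL0 hη]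
    rw [integral_complex_ofReal, ← Complex.ofReal_pow, ← Complex.ofReal_inv, ← Complex.ofReal_mul,
      ← Complex.ofReal_sub, Complex.norm_real, Real.norm_eq_abs,
      PoissonDOS.dualInt_sum hd3 hL]
    have h1 := hκ lam hlam E hE L hL
    have h2 := PoissonDOS.abs_dualInt_le hd3 hL κ fun m =>
      (∫ ω, PoissonDOS.diagReal L B lam E η m ω ∂(PoissonDOS.configLaw d L μ))
        - ∑ n ∈ Finset.range (N + 1), lam ^ n *
          (PoissonDOS.coeffS L B μ χ n E η δ (PoissonDOS.planeWave L m)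
            (PoissonDOS.planeWave L m)).im
    have h3 := PoissonDOS.dualInt_mono hd3 hL (κ := κ) (h := fun _ => δ * 1) fun m _ =>
      (PoissonDOS.abs_integral_diagReal_sub_le hL0 hη m
        (hN lam hlam E L hL _ (PoissonDOS.norm_planeWave hL0 m))).trans (mul_one δ).ge
    rw [PoissonDOS.dualInt_const_mul] at h3
    have h4 : δ * PoissonDOS.dualInt (d := d) L κ (fun _ => 1) ≤ ε / 2 := by
      refine (mul_le_mul_of_nonneg_left
        (PoissonDOS.dualInt_one_le_modeBound hd3 hL κ) hδ.le).trans (le_of_eq ?_)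
      rw [hδdef]
      field_simp
    rw [← PoissonDOS.dualInt_sub hd3 hL] at h2
    refine (abs_sub_le _ _ _).trans ((add_le_add h1 (h2.trans (h3.trans h4))).trans (le_of_eq ?_))
    ring
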